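/- Let $V_N=\{0,1\}^N$ be the hypercube, viewed as the additive group $(\mathbb Z/2)^N$, with Hamming norm $|\cdot|$, and write $x\sim y$ when $|x-y|=1$. Let $(E_x)_{x\in V_N}$ be i.i.d. random variables distributed as the positive part of a standard Gaussian, with joint law $\mathbb P$ and expectation $\mathbb E$. Let $\phi(\lambda)=\mathbb E[e^{\lambda E_x}]$. Fix $\beta>0$ and let $\tau_{N,x}=e^{\beta\sqrt N E_x}$ and $\tau_N=(\tau_{N,x})_{x\in V_N}$. Fix $\overline a<1/20$ and a real sequence $(a_N)$ with $1\le a_N\le \overline a\sqrt{2\log N}$ for all large $N$. Given $\tau_N$, let $(X_t)_{t\ge 0}$ be the continuous-time Markov chain on $V_N$ with jump rates $\omega_N(x,y)=e^{a_N(E_x+E_y)}$ for $x\sim y$; write $\mathbf P^{\tau_N}_z$, $\mathbf E^{\tau_N}_z$ for its law and expectation when started from $z$, and $\overline{\mathbb P}_N$, $\overline{\mathbb E}_N$ for the joint (annealed) law and expectation of the energies and of the walk started from a uniformly chosen point of $V_N$. A site is discovered by time $t$ if it is at distance at most $1$ from $X_s$ for some $s\in[0,t]$; let $D_N(t)$ be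 the number of sites discovered by time $t$. Fix $\overline c\in(0,\log 2)$ and positive reals $\mathsf t_N$ with $\log \mathsf t_N\sim\overline c N$, and let $$\mathsf d_N=\overline{\mathbb E}_N[D_N(\mathsf t_N)],\qquad b_N=(2\log\mathsf d_N)^{1/2}-\frac{\log\log\mathsf d_N+\log(4\pi)}{2(2\log\mathsf d_N)^{1/2}},\qquad B_N=e^{\beta\sqrt N b_N}.$$ Replace each site $y$ in the sequence of successive positions of the walk by the block of the $N+1$ sites $y+z$, $|z|\le1$, listed in an arbitrary fixed order (which may depend on $y$), and then keep only the first occurrence of every site; the resulting enumeration $x_1,x_2,\dots,x_{2^N}$ of $V_N$ is the exploration process. For $\delta>0$, let $x_N^{(\delta)}(1)$ be the first site $x$ in this enumeration that is a deep trap, that is, $\tau_{N,x}\ge\delta B_N$ (if there is one). Let $\tau_N^{(\delta)}(1)$ be the environment seen from it, $(\tau_N^{(\delta)}(1))_z=\tau_{N,\,x_N^{(\delta)}(1)+z}$, and let $$G_N(\tau_N)=\mathbf E^{\tau_N}_0\left[\int_0^{\infty}e^{-t/N^2}\,\mathbf 1_{X_t=0}\,dt\right].$$ Then for every $\delta>0$,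 under $\overline{\mathbb P}_N$, the quantity $N^2\phi(a_N)^2\,G_N(\tau_N^{(\delta)}(1))$ converges to $1$ in probability as $N\to\infty$: for every $\eta>0$, $$\overline{\mathbb P}_N\left[x_N^{(\delta)}(1)\text{ exists and } \left|N^2\phi(a_N)^2\,G_N(\tau_N^{(\delta)}(1))-1\right|\le\eta\right]\longrightarrow 1 .$$ Moreover, $$\frac{\mathsf d_N}{\mathsf t_N}\sim N^2\phi(a_N)^2\qquad(N\to\infty).$$ -/

import Mathlib

open MeasureTheory ProbabilityTheory Filter Topology

noncomputable section

namespace REM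

/-- The hypercube `{0,1}^N` as an additive group; `hammingNorm` and `hammingDist` give `|x|` and
`|x - y|`. -/
abbrev V (N : ℕ) : Type := Fin N → ZMod 2

/-- The law `𝒩₊(0,1)` of the positive part of a standard Gaussian. -/
def posGaussian : Measure ℝ := (gaussianReal 0 1).map (fun x => max x 0)

/-- `φ(l) = 𝔼[exp (l E_x)]`. -/
def phi (l : ℝ) : ℝ := ∫ x, Real.exp (l * x) ∂posGaussian

/-- The law `ℙ` of the energies `(E_x)`: i.i.d. with law `𝒩₊(0,1)`. -/
def energyLaw (N : ℕ) : Measure (V N → ℝ) := Measure.pi fun _ => posGaussian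

/-- The Gibbs weight `τ_{N,x} = exp (β √N E_x)`. -/
def tau {N : ℕ} (β : ℝ) (E : V N → ℝ) (x : V N) : ℝ := Real.exp (β * √(N : ℝ) * E x)

/-- The environment translated by `x`: `(θ_x E)_z = E_{x+z}`. For `N ≥ 1` the energies and the
weights `τ_N` determine each other, so environments are recorded through the energies. -/
def shift {N : ℕ} (x : V N) (E : V N → ℝ) : V N → ℝ := fun z => E (x + z)

/-! ### The accelerated walk

The continuous-time Markov chain with jump rates `ω_N(x,y) = exp (a_N (E_x + E_y))`, `x ∼ y`, is
realised with independent exponential clocks. On arrival at `y` at the `n`-th jump, the neighbour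
`y + e_i` is given the clock `ξ n i / ω_N(y, y + e_i)`, where the `ξ n i` are i.i.d. standard
exponential variables (so that this clock is exponential of parameter `ω_N(y, y + e_i)`), and the
walk jumps to the neighbour whose clock rings first, at the time when it rings. -/

/-- The jump rate `ω_N(x,y)` between two neighbours. -/
def rate {N : ℕ} (a : ℝ) (E : V N → ℝ) (x y : V N) : ℝ := Real.exp (a * (E x + E y))

/-- The standard basis vector `e_i` of the hypercube. -/
def unit {N : ℕ} (i : Fin N) : V N := Pi.single i 1

instance : IsProbabilityMeasure (expMeasure 1) := isProbabilityMeasure_expMeasure one_pos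

/-- The law of the i.i.d. standard exponential variables `(ξ n i)`. -/
def noise (N : ℕ) : Measure (ℕ → Fin N → ℝ) :=
  Measure.infinitePi fun _ : ℕ => Measure.pi fun _ : Fin N => expMeasure 1

/-- The clock attached to the `i`-th neighbour of `y`. -/
def clock {N : ℕ} (a : ℝ) (E : V N → ℝ) (y : V N) (u : Fin N → ℝ) (i : Fin N) : ℝ :=
  u i / rate a E y (y + unit i)

/-- One jump: from the current position and the time of arrival there to the next ones. The case
`none` occurs only for `N = 0`, where there is no neighbour to jump to. -/
def step {N : ℕ} (a : ℝ) (E : V N → ℝ) (p : V N × ℝ) (u : Fin N → ℝ) : V N × ℝ :=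
  match (List.finRange N).argmin (clock a E p.1 u) with
  | none => (p.1, p.2 + 1)
  | some i => (p.1 + unit i, p.2 + clock a E p.1 u i)

/-- The position after the `n`-th jump and the time of the `n`-th jump, for the walk started
from `z`. -/
def jumps {N : ℕ} (a : ℝ) (E : V N → ℝ) (z : V N) (ξ : ℕ → Fin N → ℝ) : ℕ → V N × ℝ
  | 0 => (z, 0)
  | n + 1 => step a E (jumps a E z ξ n) (ξ n)

/-- The walk at time `t`: its position after the last jump that takes place no later than `t`. -/
def walk {N : ℕ} (a : ℝ) (E : V N → ℝ) (z : V N) (ξ : ℕ → Fin N → ℝ) (t : ℝ) : V N :=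
  (jumps a E z ξ (sSup {n : ℕ | (jumps a E z ξ n).2 ≤ t})).1

/-- A realisation: the energies, the starting point, and the clocks. -/
abbrev Sample (N : ℕ) : Type := (V N → ℝ) × V N × (ℕ → Fin N → ℝ)

/-- The annealed law `ℙ̄_N`: the energies have law `ℙ`, the starting point is uniform. -/
def annealed (N : ℕ) : Measure (Sample N) :=
  (energyLaw N).prod ((uniformOn Set.univ).prod (noise N))

/-- `G_N`, the expectation of `∫_0^∞ exp (-t/N²) 1_{X_t = 0} dt` for the walk started from `0`. -/
def green {N : ℕ} (a : ℝ) (E : V N → ℝ) : ℝ :=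
  ∫ ξ, (∫ t in Set.Ioi (0 : ℝ), Real.exp (-t / (N : ℝ) ^ 2) *
    Set.indicator {s : ℝ | walk a E 0 ξ s = 0} (fun _ => (1 : ℝ)) t) ∂noise N

/-! ### Scales -/

/-- The set `𝒟_N(t)` of sites discovered before time `t`. -/
def discovered {N : ℕ} (a : ℝ) (ω : Sample N) (t : ℝ) : Set (V N) :=
  {x | ∃ s, 0 ≤ s ∧ s ≤ t ∧ hammingDist (walk a ω.1 ω.2.1 ω.2.2 s) x ≤ 1}

/-- `𝖽_N = 𝔼̄_N[D_N(𝗍_N)]`, with `D_N(t)` the number of sites discovered before time `t`. -/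
def dScale (N : ℕ) (a t : ℝ) : ℝ := ∫ ω, ((discovered a ω t).ncard : ℝ) ∂annealed N

/-- `b_N`, as a function of `d = 𝖽_N`. -/
def bScale (d : ℝ) : ℝ :=
  √(2 * Real.log d)
    - 1 / (2 * √(2 * Real.log d)) * (Real.log (Real.log d) + Real.log (4 * Real.pi))

/-- `B_N = exp (β √N b_N)`. -/
def BScale (N : ℕ) (β a t : ℝ) : ℝ := Real.exp (β * √(N : ℝ) * bScale (dScale N a t))

/-! ### The exploration process and the first deep trap -/

/-- An order of enumeration of `{z : |z| ≤ 1}`, which may depend on the site `y` around which the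
points `y + z` are listed. -/
abbrev Order (N : ℕ) : Type := V N → Fin (N + 1) ≃ {z : V N // hammingNorm z ≤ 1}

/-- The successive positions `Y_0, Y_1, …` of the walk, each replaced by the block of the `N + 1`
points at distance at most one from it. (Positions are listed with repetitions, which has no
effect once repeated points are removed.) -/
def seen {N : ℕ} (a : ℝ) (o : Order N) (ω : Sample N) (m : ℕ) : V N :=
  let y := (jumps a ω.1 ω.2.1 ω.2.2 (m / (N + 1))).1
  y + (o y (Fin.ofNat (N + 1) m) : V N)

/-- The exploration process (`explore i` is the point `x_{i+1}`): the sequence `seen` where only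
the first occurrence of each point is kept. -/
def explore {N : ℕ} (a : ℝ) (o : Order N) (ω : Sample N) (i : ℕ) : V N :=
  seen a o ω (Nat.nth (fun m => ∀ k < m, seen a o ω k ≠ seen a o ω m) i)

open Classical in
/-- The first deep trap discovered: the first of the points `x_1, …, x_{2^N}` of the exploration
process with `τ_{N,x} ≥ θ` (where `θ` stands for `δ B_N`); `none` if there is no such point. -/
def firstDeepTrap {N : ℕ} (β a θ : ℝ) (o : Order N) (ω : Sample N) : Option (V N) :=
  if h : ∃ i, i < 2 ^ N ∧ θ ≤ tau β ω.1 (explore a o ω i) then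
    some (explore a o ω (Nat.find h))
  else none

end REM

end

noncomputable section

namespace REM

open scoped ENNReal

/-! ### The hypercube and Dirichlet forms -/

variable {N : ℕ}

/-! Write `M = exitRate N a = N² φ(a)²`. About `N²` edges leave the unit ball around a site and each
has mean conductance `φ(a)²`, so `M` is the typical conductance between the ball and its complement
(`outflow`). Both assertions reduce to the fact that the capacity of such a ball is asymptotically
`M`, for the walk killed at the relevant rate.

Capacities are bounded above by testing with the indicator of the ball (`dir_ind_ball_le`), and
below by an explicit flow (`flow_bound`). The flow leaves the ball through its boundary edges in
proportion to their conductances, takes one uniform extra step, and is then spread over the cube by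
the Poincaré inequality. Its energy is close to `1 / outflow`: edges at a deep trap are excellent
conductors, and after the extra step the mass is so spread out that what remains is negligible.

The walk enters in two ways. Its survival probabilities solve the killed backward equation
(`measure_survival`), and comparing `exp (sL)` with `1 + sL` and with the resolvent turns capacity
bounds into bounds on hitting probabilities at deterministic times (`exists_survival`). The Green
function is the resolvent at `0` (`integral_occupation`), squeezed by the same two principles
(`green_shift_bounds`).

Since `abar < 1/20`, `φ(2a)²` is at most of order `N^(1/50)`, so second moments show that `outflow`
concentrates around `M` (`Good`). This gives `dScale ∼ t M` (`tendsto_dScale`), the second claim. It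
also makes the density `p` of deep traps comparable to `1 / dScale` (`Regime.posGaussian_bounds`).

For the first claim, run the walk up to time `K t` with `K` large and fixed. There are of order `2^N
p` deep traps that are well separated and in a `Good` environment, and the flow from all of them
shows that one is visited with probability close to `1` (`annealed_no_good_trap_le`). `Good` at `x`
does not involve `E x`, so the expected number of discovered deep traps in a bad environment is at
most about `p K t M` times a small factor, which is small (`annealed_discover_bad_le`). Hence the
first deep trap exists and its environment is `Good`, and there the Green function is close to `1 /
M` (`abs_green_sub_one_le`). -/

lemma unit_add_self (i : Fin N) : unit i + unit i = (0 : V N) := by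
  ext j
  simp only [Pi.add_apply, Pi.zero_apply]
  exact CharTwo.add_self_eq_zero _

@[simp] lemma add_unit_add_unit (y : V N) (i : Fin N) : y + unit i + unit i = y := by
  rw [add_assoc, unit_add_self, add_zero]

lemma sum_add_unit {M : Type*} [AddCommMonoid M] (f : V N → M) (i : Fin N) :
    ∑ y, f (y + unit i) = ∑ y, f y :=
  Fintype.sum_equiv (Equiv.addRight (unit i)) _ _ fun _ => rfl

lemma sum_unit_support (y : V N) :
    ∑ i ∈ Finset.univ.filter (fun i => y i ≠ 0), unit i = y := by
  ext j
  have h2 : ∀ c : ZMod 2, c = 0 ∨ c = 1 := by decide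
  rw [Finset.sum_apply]
  rcases h2 (y j) with h | h
  · rw [h]
    refine Finset.sum_eq_zero fun i hi => ?_
    have : j ≠ i := by
      rintro rfl
      exact (Finset.mem_filter.1 hi).2 h
    simp [unit, Pi.single_eq_of_ne this]
  · rw [Finset.sum_eq_single j, h]
    · simp [unit]
    · intro i _ hij
      simp [unit, Pi.single_eq_of_ne hij.symm]
    · intro hj
      simp [h] at hj

/-- The basis vectors generate the group, so every point is reached from `0` by successive
translations. -/
lemma eq_of_invariant {α : Type*} (F : V N → α) (hF : ∀ i y, F (y + unit i) = F y) (y : V N) :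
    F y = F 0 := by
  have key : ∀ s : Finset (Fin N), F (∑ i ∈ s, unit i) = F 0 := by
    intro s
    induction s using Finset.induction_on with
    | empty => simp
    | insert i s hi ih => rw [Finset.sum_insert hi, add_comm, hF, ih]
  rw [← sum_unit_support y, key]

/-- The Dirichlet form of the conductances `c y i` of the edges `{y, y + e_i}`. -/
def dirB (c : V N → Fin N → ℝ) (f g : V N → ℝ) : ℝ :=
  1 / 2 * ∑ y, ∑ i, c y i * ((f y - f (y + unit i)) * (g y - g (y + unit i)))

/-- The Dirichlet energy. -/
def dir (c : V N → Fin N → ℝ) (f : V N → ℝ) : ℝ :=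
  1 / 2 * ∑ y, ∑ i, c y i * (f y - f (y + unit i)) ^ 2

/-- The generator of the walk with jump rates `c`. -/
def gen (c : V N → Fin N → ℝ) (f : V N → ℝ) (y : V N) : ℝ :=
  ∑ i, c y i * (f (y + unit i) - f y)

/-- The conductances are those of undirected edges. -/
def Symm (c : V N → Fin N → ℝ) : Prop := ∀ y i, c (y + unit i) i = c y i

lemma dir_eq_dirB (c : V N → Fin N → ℝ) (f : V N → ℝ) : dir c f = dirB c f f := by
  simp only [dir, dirB, sq]

lemma dir_nonneg {c : V N → Fin N → ℝ} (hc : ∀ y i, 0 ≤ c y i) (f : V N → ℝ) : 0 ≤ dir c f :=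
  mul_nonneg (by norm_num) (Finset.sum_nonneg fun y _ => Finset.sum_nonneg fun i _ =>
    mul_nonneg (hc y i) (sq_nonneg _))

lemma sum_mul_gen {c : V N → Fin N → ℝ} (hc : Symm c) (f g : V N → ℝ) :
    ∑ y, f y * gen c g y = - dirB c f g := by
  have h1 : ∑ y, f y * gen c g y = ∑ i, ∑ y, f y * (c y i * (g (y + unit i) - g y)) := by
    rw [Finset.sum_comm]
    refine Finset.sum_congr rfl fun y _ => ?_
    rw [gen, Finset.mul_sum]
  have h2 : dirB c f g = ∑ i, 1 / 2 *
      ∑ y, c y i * ((f y - f (y + unit i)) * (g y - g (y + unit i))) := by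
    rw [dirB, Finset.sum_comm, Finset.mul_sum]
  rw [h1, h2, ← Finset.sum_neg_distrib]
  refine Finset.sum_congr rfl fun i _ => ?_
  -- Translation by `unit i` exchanges the endpoints of the edges in direction `i`. Averaging the
  -- two forms of the sum (`h4`) produces the product of gradients.
  have h3 : ∑ y, f y * (c y i * (g (y + unit i) - g y))
      = ∑ y, f (y + unit i) * (c y i * (g y - g (y + unit i))) := by
    rw [← sum_add_unit _ i]
    refine Finset.sum_congr rfl fun y _ => ?_
    rw [add_unit_add_unit, hc]
  have h4 : ∑ y, f y * (c y i * (g (y + unit i) - g y)) = 1 / 2 *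
      (∑ y, f y * (c y i * (g (y + unit i) - g y))
        + ∑ y, f (y + unit i) * (c y i * (g y - g (y + unit i)))) := by
    rw [← h3]; ring
  rw [h4, ← Finset.sum_add_distrib, ← mul_neg, ← Finset.sum_neg_distrib]
  congr 1
  exact Finset.sum_congr rfl fun y _ => by ring

lemma dirB_comm (c : V N → Fin N → ℝ) (f g : V N → ℝ) : dirB c f g = dirB c g f := by
  simp only [dirB, mul_comm]

lemma sum_gen {c : V N → Fin N → ℝ} (hc : Symm c) (g : V N → ℝ) : ∑ y, gen c g y = 0 := by
  have := sum_mul_gen hc (fun _ => 1) g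
  simpa [dirB] using this

/-! ### The Poincaré inequality on the hypercube -/

/-- Averaging over the `i`-th coordinate. -/
def avg (i : Fin N) (f : V N → ℝ) (y : V N) : ℝ := (f y + f (y + unit i)) / 2

lemma sum_avg (i : Fin N) (f : V N → ℝ) : ∑ y, avg i f y = ∑ y, f y := by
  simp only [avg, ← Finset.sum_div, Finset.sum_add_distrib, sum_add_unit]
  ring

/-- Pythagoras: averaging in one direction is an orthogonal projection, and the half-gradient is the
complementary component. -/
lemma sum_sq_avg (i : Fin N) (f : V N → ℝ) :
    ∑ y, f y ^ 2 = ∑ y, avg i f y ^ 2 + ∑ y, ((f y - f (y + unit i)) / 2) ^ 2 := by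
  have h : ∑ y, f y ^ 2 = 1 / 2 * (∑ y, f y ^ 2 + ∑ y, f (y + unit i) ^ 2) := by
    rw [sum_add_unit (fun y => f y ^ 2)]; ring
  rw [h, ← Finset.sum_add_distrib, ← Finset.sum_add_distrib, Finset.mul_sum]
  refine Finset.sum_congr rfl fun y _ => ?_
  rw [avg]; ring

lemma sum_sq_avg_le (i : Fin N) (f : V N → ℝ) : ∑ y, avg i f y ^ 2 ≤ ∑ y, f y ^ 2 := by
  rw [sum_sq_avg i f]
  exact le_add_of_nonneg_right (Finset.sum_nonneg fun y _ => sq_nonneg _)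

/-- Averaging in direction `j` commutes with the gradient in direction `i` and contracts the `ℓ²`
norm. -/
lemma sum_sq_grad_avg_le (i j : Fin N) (f : V N → ℝ) :
    ∑ y, ((avg j f y - avg j f (y + unit i)) / 2) ^ 2
      ≤ ∑ y, ((f y - f (y + unit i)) / 2) ^ 2 := by
  refine le_trans (le_of_eq ?_) (sum_sq_avg_le j fun y => (f y - f (y + unit i)) / 2)
  refine Finset.sum_congr rfl fun y _ => ?_
  simp only [avg]
  rw [add_right_comm y (unit i) (unit j)]
  ring

/-- Averaging over the coordinates of a list. -/
def avgs (l : List (Fin N)) (f : V N → ℝ) : V N → ℝ := l.foldr avg f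

lemma sum_avgs (l : List (Fin N)) (f : V N → ℝ) : ∑ y, avgs l f y = ∑ y, f y := by
  induction l with
  | nil => rfl
  | cons i l ih => rw [← ih]; exact sum_avg i _

lemma sum_sq_grad_avgs_le (l : List (Fin N)) (i : Fin N) (f : V N → ℝ) :
    ∑ y, ((avgs l f y - avgs l f (y + unit i)) / 2) ^ 2
      ≤ ∑ y, ((f y - f (y + unit i)) / 2) ^ 2 := by
  induction l with
  | nil => rfl
  | cons j l ih => exact (sum_sq_grad_avg_le i j _).trans ih

/-- Tensorisation of the variance. Each averaging loses the energy in its own direction, and the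
contraction of gradients allows this loss to be measured on `f` instead of on the partly averaged
function. -/
lemma sum_sq_le_avgs (l : List (Fin N)) (f : V N → ℝ) :
    ∑ y, f y ^ 2 ≤ ∑ y, avgs l f y ^ 2
      + (l.map fun i => ∑ y, ((f y - f (y + unit i)) / 2) ^ 2).sum := by
  induction l with
  | nil => simp [avgs]
  | cons i l ih =>
    have h1 := sum_sq_avg i (avgs l f)
    have h2 := sum_sq_grad_avgs_le l i f
    have h3 : avgs (i :: l) f = avg i (avgs l f) := rfl
    rw [List.map_cons, List.sum_cons, h3]
    linarith

lemma avgs_add_unit (l : List (Fin N)) (f : V N → ℝ) {i : Fin N} (hi : i ∈ l) (y : V N) :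
    avgs l f (y + unit i) = avgs l f y := by
  induction l generalizing y with
  | nil => simp at hi
  | cons j l ih =>
    have h3 : avgs (j :: l) f = avg j (avgs l f) := rfl
    rw [h3]
    rcases List.mem_cons.1 hi with rfl | h
    · simp only [avg, add_unit_add_unit]
      ring
    · simp only [avg, ih h, add_right_comm y (unit i) (unit j)]

/-- The mean of a function for the uniform distribution. -/
def mean (f : V N → ℝ) : ℝ := (∑ y, f y) / 2 ^ N

lemma card_V : Fintype.card (V N) = 2 ^ N := by simp [V]

lemma avgs_finRange (f : V N → ℝ) (y : V N) : avgs (List.finRange N) f y = mean f := by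
  have h : ∀ y, avgs (List.finRange N) f y = avgs (List.finRange N) f 0 :=
    eq_of_invariant _ fun i y => avgs_add_unit _ f (List.mem_finRange i) y
  have h1 := sum_avgs (List.finRange N) f
  simp only [h] at h1
  rw [Finset.sum_const, Finset.card_univ, card_V, nsmul_eq_mul] at h1
  rw [h, mean, ← h1]
  push_cast
  field_simp

lemma sum_sub_mean (f : V N → ℝ) : ∑ y, (f y - mean f) = 0 := by
  rw [Finset.sum_sub_distrib, Finset.sum_const, Finset.card_univ, card_V, nsmul_eq_mul, mean]
  push_cast
  field_simp
  ring

/-- Once all coordinates are averaged the centred function vanishes, so only the directional terms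
survive. They carry a factor `1/4` against `1/2` in the energy; the loss is harmless since the
inequality only serves an error term of the flow. -/
theorem poincare {c : V N → Fin N → ℝ} (hc : ∀ y i, 1 ≤ c y i) (f : V N → ℝ) :
    ∑ y, (f y - mean f) ^ 2 ≤ dir c f := by
  set g : V N → ℝ := fun y => f y - mean f with hg
  have hm : mean g = 0 := by rw [mean, hg, sum_sub_mean, zero_div]
  have h := sum_sq_le_avgs (List.finRange N) g
  simp only [avgs_finRange, hm] at h
  refine h.trans ?_
  have hd : dir c f = ∑ i, 1 / 2 * ∑ y, c y i * (f y - f (y + unit i)) ^ 2 := by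
    rw [dir, Finset.sum_comm, Finset.mul_sum]
  rw [← List.ofFn_eq_map, List.sum_ofFn, hd]
  simp only [ne_eq, OfNat.ofNat_ne_zero, not_false_eq_true, zero_pow, Finset.sum_const_zero,
    zero_add]
  refine Finset.sum_le_sum fun i _ => ?_
  rw [Finset.mul_sum]
  refine Finset.sum_le_sum fun y _ => ?_
  have : g y - g (y + unit i) = f y - f (y + unit i) := by simp [hg]
  rw [this]
  nlinarith [mul_nonneg (sub_nonneg.2 (hc y i)) (sq_nonneg (f y - f (y + unit i))),
    sq_nonneg (f y - f (y + unit i))]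

lemma mean_le (f : V N → ℝ) : mean f ≤ √(∑ y, f y ^ 2 / 2 ^ N) := by
  apply Real.le_sqrt_of_sq_le
  have h := sq_sum_le_card_mul_sum_sq (s := Finset.univ) (f := f)
  rw [Finset.card_univ, card_V] at h
  rw [mean, div_pow, ← Finset.sum_div, div_le_div_iff₀ (by positivity) (by positivity)]
  push_cast at h
  nlinarith [mul_le_mul_of_nonneg_right h (show (0 : ℝ) ≤ 2 ^ N by positivity)]

/-! ### A lower bound on capacities by a flow -/

lemma unit_apply (i j : Fin N) : (unit i : V N) j = if j = i then 1 else 0 := by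
  simp [unit, Pi.single_apply]

lemma unit_injective : Function.Injective (unit : Fin N → V N) := by
  intro i j h
  have := congrFun h i
  simp only [unit_apply, if_true] at this
  by_contra hne
  simp [hne] at this

lemma hammingDist_add_unit (x : V N) (i : Fin N) : hammingDist x (x + unit i) = 1 := by
  rw [hammingDist]
  have : (Finset.univ.filter fun j => x j ≠ (x + unit i) j) = {i} := by
    ext j
    simp [unit_apply]
  rw [this, Finset.card_singleton]

/-- Ordered pairs of distinct directions. -/
def pairs (N : ℕ) : Finset (Fin N × Fin N) := Finset.univ.offDiag

/-- Ordered triples of distinct directions. -/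
def triples (N : ℕ) : Finset ((Fin N × Fin N) × Fin N) :=
  (pairs N ×ˢ Finset.univ).filter fun t => t.2 ≠ t.1.1 ∧ t.2 ≠ t.1.2

lemma mem_pairs {p : Fin N × Fin N} : p ∈ pairs N ↔ p.1 ≠ p.2 := by simp [pairs]

lemma mem_triples {t : (Fin N × Fin N) × Fin N} :
    t ∈ triples N ↔ t.1.1 ≠ t.1.2 ∧ t.2 ≠ t.1.1 ∧ t.2 ≠ t.1.2 := by simp [triples, mem_pairs]

lemma card_pairs : ((pairs N).card : ℝ) = N * (N - 1) := by
  rw [pairs, Finset.offDiag_card, Finset.card_univ, Fintype.card_fin,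
    Nat.cast_sub (Nat.le_mul_self N)]
  push_cast; ring

lemma sum_triples (h : Fin N × Fin N → ℝ) :
    ∑ t ∈ triples N, h t.1 = (N - 2) * ∑ p ∈ pairs N, h p := by
  rw [triples, Finset.sum_filter, Finset.sum_product, Finset.mul_sum]
  refine Finset.sum_congr rfl fun p hp => ?_
  rw [← Finset.sum_filter]
  dsimp only
  rw [Finset.sum_const, nsmul_eq_mul]
  congr 1
  have h1 : (Finset.univ.filter fun k => k ≠ p.1 ∧ k ≠ p.2) = ({p.1, p.2} : Finset (Fin N))ᶜ := by
    ext k; simp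
  have hne := mem_pairs.1 hp
  have h2 : ({p.1, p.2} : Finset (Fin N)).card = 2 := Finset.card_pair hne
  have h3 : 2 ≤ N := by
    have := Finset.card_le_univ ({p.1, p.2} : Finset (Fin N))
    rw [h2, Fintype.card_fin] at this
    exact this
  rw [h1, Finset.card_compl, h2, Fintype.card_fin, Nat.cast_sub h3]
  norm_num

/-- The total conductance between the unit ball around `x` and its complement. -/
def outflow (c : V N → Fin N → ℝ) (x : V N) : ℝ := ∑ p ∈ pairs N, c (x + unit p.1) p.2

/-- The sum of the squares of the conductances between the unit ball around `x` and its
complement. -/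
def outflowSq (c : V N → Fin N → ℝ) (x : V N) : ℝ := ∑ p ∈ pairs N, c (x + unit p.1) p.2 ^ 2

/-- Congestion bound: a site or edge used by at most `M` paths is charged at most `M` times. -/
lemma sum_comp_le_of_card_fiber_le {ι κ : Type*} [DecidableEq κ] [Fintype κ] (s : Finset ι)
    (φ : ι → κ) (G : κ → ℝ) (hG : ∀ k, 0 ≤ G k) (M : ℕ)
    (hM : ∀ t₀ ∈ s, (s.filter fun t => φ t = φ t₀).card ≤ M) :
    ∑ t ∈ s, G (φ t) ≤ M * ∑ k, G k := by
  rw [← Finset.sum_fiberwise s φ, Finset.mul_sum]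
  refine Finset.sum_le_sum fun k _ => ?_
  have h1 : ∑ t ∈ s.filter (fun t => φ t = k), G (φ t)
      = ∑ t ∈ s.filter (fun t => φ t = k), G k :=
    Finset.sum_congr rfl fun t ht => by rw [(Finset.mem_filter.1 ht).2]
  rw [h1, Finset.sum_const, nsmul_eq_mul]
  refine mul_le_mul_of_nonneg_right ?_ (hG k)
  rcases (s.filter (fun t => φ t = k)).eq_empty_or_nonempty with h | ⟨t₀, ht₀⟩
  · rw [h]; simp
  · have h2 := (Finset.mem_filter.1 ht₀)
    have := hM t₀ h2.1
    rw [h2.2] at this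
    exact_mod_cast this

/-- The points of `T` are at mutual distance larger than `6`. -/
def Separated (T : Finset (V N)) : Prop := ∀ x ∈ T, ∀ y ∈ T, hammingDist x y ≤ 6 → x = y

/-- The separation `6` is twice the length `3` of the paths carrying the flow, so paths from
distinct centres never meet. -/
lemma Separated.eq_of_hammingDist_le {T : Finset (V N)} (hT : Separated T) {x y v : V N}
    (hx : x ∈ T) (hy : y ∈ T) (h1 : hammingDist x v ≤ 3) (h2 : hammingDist y v ≤ 3) : x = y := by
  refine hT x hx y hy ?_
  have := hammingDist_triangle_right x y v
  omega

lemma hammingDist_path_one (x : V N) (i : Fin N) : hammingDist x (x + unit i) ≤ 3 := by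
  rw [hammingDist_add_unit]; norm_num

lemma hammingDist_path_two (x : V N) (i j : Fin N) :
    hammingDist x (x + unit i + unit j) ≤ 2 := by
  have := hammingDist_triangle x (x + unit i) (x + unit i + unit j)
  rw [hammingDist_add_unit, hammingDist_add_unit] at this
  exact this

lemma hammingDist_path_three (x : V N) (i j k : Fin N) :
    hammingDist x (x + unit i + unit j + unit k) ≤ 3 := by
  have := hammingDist_triangle x (x + unit i + unit j) (x + unit i + unit j + unit k)
  have h2 := hammingDist_path_two x i j
  rw [hammingDist_add_unit] at this
  omega

/-- The energy of the oriented edge `(y, y + e_i)`. -/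
def edge (c : V N → Fin N → ℝ) (f : V N → ℝ) (q : V N × Fin N) : ℝ :=
  c q.1 q.2 * (f q.1 - f (q.1 + unit q.2)) ^ 2

lemma sum_edge (c : V N → Fin N → ℝ) (f : V N → ℝ) : ∑ q, edge c f q = 2 * dir c f := by
  rw [Fintype.sum_prod_type, dir]
  simp only [edge]
  ring

/-! ### Path counting and the energy of the flow -/

section flow

variable {c : V N → Fin N → ℝ} {T : Finset (V N)}

/-- The constant must be sharp, because this feeds the leading term of `flow_bound`. The sum over
all oriented edges is twice the Dirichlet form, so each second edge is counted together with its
reversal, and no oriented edge may then occur twice. -/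
lemma sum_edge_second_le (hs : Symm c) (hc : ∀ y i, 1 ≤ c y i)
    (hT : Separated T) (f : V N → ℝ) :
    ∑ q ∈ T ×ˢ pairs N, edge c f (q.1 + unit q.2.1, q.2.2) ≤ dir c f := by
  set φ : (V N × Fin N × Fin N) × Bool → V N × Fin N := fun t =>
    (if t.2 then t.1.1 + unit t.1.2.1 + unit t.1.2.2 else t.1.1 + unit t.1.2.1, t.1.2.2) with hφ
  have h1 := sum_comp_le_of_card_fiber_le ((T ×ˢ pairs N) ×ˢ Finset.univ) φ (edge c f)
    (fun k => mul_nonneg (zero_le_one.trans (hc _ _)) (sq_nonneg _)) 1 ?_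
  · rw [Finset.sum_product, sum_edge] at h1
    have h2 : ∀ q : V N × Fin N × Fin N, ∑ b : Bool, edge c f (φ (q, b))
        = 2 * edge c f (q.1 + unit q.2.1, q.2.2) := by
      intro q
      simp only [Fintype.sum_bool, hφ, edge, if_true, add_unit_add_unit, hs _ q.2.2]
      simp only [Bool.false_eq_true, if_false]
      ring
    rw [Finset.sum_congr rfl fun q _ => h2 q, ← Finset.mul_sum] at h1
    push_cast at h1
    linarith
  · rintro t₀ ht₀
    rw [Finset.card_le_one]
    -- Separation recovers the centre. Coordinate `j` then tells the two orientations apart: it is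
    -- unchanged at `x + unit i` and flipped at `x + unit i + unit j`.
    have key : ∀ t ∈ ((T ×ˢ pairs N) ×ˢ Finset.univ).filter (fun t => φ t = φ t₀), t = t₀ := by
      rintro ⟨⟨x, i, j⟩, b⟩ ht
      obtain ⟨⟨x', i', j'⟩, b'⟩ := t₀
      simp only [Finset.mem_filter, Finset.mem_product, Finset.mem_univ, and_true, mem_pairs,
        hφ, Prod.mk.injEq] at ht ht₀
      obtain ⟨⟨hx, hij⟩, he, rfl⟩ := ht
      obtain ⟨hx', hij'⟩ := ht₀
      have hxx : x = x' := by
        have d1 := hammingDist_path_one x i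
        have d2 := (hammingDist_path_two x i j).trans (by norm_num : 2 ≤ 3)
        have d1' := hammingDist_path_one x' i'
        have d2' := (hammingDist_path_two x' i' j).trans (by norm_num : 2 ≤ 3)
        cases b <;> cases b' <;> simp only [Bool.false_eq_true, if_false, if_true] at he
        · exact hT.eq_of_hammingDist_le hx hx' d1 (he ▸ d1')
        · exact hT.eq_of_hammingDist_le hx hx' d1 (he ▸ d2')
        · exact hT.eq_of_hammingDist_le hx hx' d2 (he ▸ d1')
        · exact hT.eq_of_hammingDist_le hx hx' d2 (he ▸ d2')
      subst hxx
      cases b <;> cases b' <;> simp only [Bool.false_eq_true, if_false, if_true] at he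
      · rw [unit_injective (add_left_cancel he)]
      · rw [add_assoc] at he
        have := congrFun (add_left_cancel he) j
        simp [unit_apply, hij.symm, hij'.symm] at this
      · rw [add_assoc] at he
        have := congrFun (add_left_cancel he) j
        simp [unit_apply, hij.symm, hij'.symm] at this
      · rw [unit_injective (add_left_cancel (add_right_cancel he))]
    intro t ht t' ht'
    rw [key t ht, key t' ht']

/-- The displacement determines the set of directions, so both directions of a competing path lie in
`{i₀, j₀}`: at most `2 * 2` choices. A crude count suffices for an error term. -/
lemma sum_path_two_le (hT : Separated T) (G : V N × Fin N → ℝ) (hG : ∀ k, 0 ≤ G k) :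
    ∑ q ∈ T ×ˢ triples N, G (q.1 + unit q.2.1.1 + unit q.2.1.2, q.2.2) ≤ 4 * ∑ k, G k := by
  have := sum_comp_le_of_card_fiber_le (T ×ˢ triples N)
    (fun q => (q.1 + unit q.2.1.1 + unit q.2.1.2, q.2.2)) G hG 4 ?_
  · exact_mod_cast this
  rintro ⟨x₀, ⟨i₀, j₀⟩, k₀⟩ h₀
  have hsub : (T ×ˢ triples N).filter (fun q => (q.1 + unit q.2.1.1 + unit q.2.1.2, q.2.2)
      = (x₀ + unit i₀ + unit j₀, k₀)) ⊆
      {x₀} ×ˢ ((({i₀, j₀} : Finset (Fin N)) ×ˢ ({i₀, j₀} : Finset (Fin N))) ×ˢ {k₀}) := by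
    rintro ⟨x, ⟨i, j⟩, k⟩ h
    simp only [Finset.mem_filter, Finset.mem_product, mem_triples, Prod.mk.injEq] at h h₀
    obtain ⟨⟨hx, hij, -, -⟩, he, rfl⟩ := h
    have hxx : x = x₀ := hT.eq_of_hammingDist_le hx h₀.1
      ((hammingDist_path_two x i j).trans (by norm_num))
      (he ▸ (hammingDist_path_two x₀ i₀ j₀).trans (by norm_num))
    subst hxx
    rw [add_assoc, add_assoc] at he
    have hi := congrFun (add_left_cancel he) i
    have hj := congrFun (add_left_cancel he) j
    simp only [Pi.add_apply, unit_apply, hij, hij.symm, if_true, if_false] at hi hj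
    simp only [Finset.mem_product, Finset.mem_singleton, Finset.mem_insert, true_and, and_true]
    constructor <;> by_contra hcon <;> push Not at hcon <;> simp [hcon] at hi hj
  refine (Finset.card_le_card hsub).trans ?_
  simp only [Finset.card_product, Finset.card_singleton, one_mul, mul_one]
  exact Nat.mul_le_mul Finset.card_le_two Finset.card_le_two

/-- Three directions, each confined to a set of at most three elements: `27` choices at most. -/
lemma sum_path_three_le (hT : Separated T) (G : V N → ℝ) (hG : ∀ k, 0 ≤ G k) :
    ∑ q ∈ T ×ˢ triples N, G (q.1 + unit q.2.1.1 + unit q.2.1.2 + unit q.2.2)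
      ≤ 27 * ∑ k, G k := by
  have := sum_comp_le_of_card_fiber_le (T ×ˢ triples N)
    (fun q => q.1 + unit q.2.1.1 + unit q.2.1.2 + unit q.2.2) G hG 27 ?_
  · exact_mod_cast this
  rintro ⟨x₀, ⟨i₀, j₀⟩, k₀⟩ h₀
  set D : Finset (Fin N) := {i₀, j₀, k₀} with hD
  have hDc : D.card ≤ 3 := Finset.card_le_three
  have hsub : (T ×ˢ triples N).filter (fun q => q.1 + unit q.2.1.1 + unit q.2.1.2 + unit q.2.2
      = x₀ + unit i₀ + unit j₀ + unit k₀) ⊆ {x₀} ×ˢ ((D ×ˢ D) ×ˢ D) := by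
    rintro ⟨x, ⟨i, j⟩, k⟩ h
    simp only [Finset.mem_filter, Finset.mem_product, mem_triples] at h h₀
    obtain ⟨⟨hx, hij, hki, hkj⟩, he⟩ := h
    have hxx : x = x₀ := hT.eq_of_hammingDist_le hx h₀.1 (hammingDist_path_three x i j k)
      (he ▸ hammingDist_path_three x₀ i₀ j₀ k₀)
    subst hxx
    simp only [add_assoc] at he
    have hi := congrFun (add_left_cancel he) i
    have hj := congrFun (add_left_cancel he) j
    have hk := congrFun (add_left_cancel he) k
    simp only [Pi.add_apply, unit_apply, hij, hij.symm, hki, hki.symm, hkj, hkj.symm, if_true,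
      if_false] at hi hj hk
    simp only [hD, Finset.mem_product, Finset.mem_singleton, Finset.mem_insert, true_and]
    refine ⟨⟨?_, ?_⟩, ?_⟩ <;> by_contra hcon <;> push Not at hcon <;> simp [hcon] at hi hj hk
  refine (Finset.card_le_card hsub).trans ?_
  simp only [Finset.card_product, Finset.card_singleton, one_mul]
  exact Nat.mul_le_mul (Nat.mul_le_mul hDc hDc) hDc

/-- The square root of the energy of the flow from a set of centres, see `flow_bound`. -/
def flowConst (N : ℕ) (s q ε : ℝ) : ℝ := √(1 / s) + √(2 * ε) + 9 * √(q / (s ^ 2 * (N - 2)))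

/-- Thomson's principle in dual form: `f x - mean f` is averaged along random paths of length three
and Cauchy–Schwarz is applied to each segment. The third step is essential. Without it the squared
weights sum to about `q / s²`, too large against `1 / s`; one uniform step divides this by `N - 2`.
-/
theorem flow_bound (hs : Symm c) (hc : ∀ y i, 1 ≤ c y i)
    (hT : Separated T) (f : V N → ℝ)
    (hN : 3 ≤ N) {s q ε : ℝ} (hs0 : 0 < s) (hS : ∀ x ∈ T, s ≤ outflow c x)
    (hq : ∀ x ∈ T, outflowSq c x ≤ q) (hε0 : 0 ≤ ε)
    (hε : ∀ x ∈ T, ∀ i, (f x - f (x + unit i)) ^ 2 ≤ ε * edge c f (x, i)) :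
    ∑ x ∈ T, (f x - mean f) ≤ √(T.card * dir c f) * flowConst N s q ε := by
  have hN2 : (0 : ℝ) < N - 2 := by
    have : (3 : ℝ) ≤ N := by exact_mod_cast hN
    linarith
  have hc0 : ∀ y i, 0 ≤ c y i := fun y i => zero_le_one.trans (hc y i)
  have hD : 0 ≤ dir c f := dir_nonneg hc0 f
  have hedge : ∀ k, 0 ≤ edge c f k := fun k => mul_nonneg (hc0 _ _) (sq_nonneg _)
  have hSpos : ∀ x ∈ T, 0 < outflow c x := fun x hx => hs0.trans_le (hS x hx)
  set n : ℝ := (T.card : ℝ) with hn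
  -- The first two directions are drawn in proportion to the conductance of the second edge, the
  -- choice that minimises the energy across the boundary of the ball.
  set w : V N → Fin N × Fin N → ℝ := fun x p => c (x + unit p.1) p.2 / outflow c x with hw
  have hw0 : ∀ x ∈ T, ∀ p, 0 ≤ w x p := fun x hx p => div_nonneg (hc0 _ _) (hSpos x hx).le
  have hw1 : ∀ x ∈ T, ∑ p ∈ pairs N, w x p = 1 := fun x hx => by
    simp only [hw]
    rw [← Finset.sum_div]
    exact div_self (hSpos x hx).ne'
  set T1 := ∑ q ∈ T ×ˢ pairs N, w q.1 q.2 * (f q.1 - f (q.1 + unit q.2.1)) with hT1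
  set T2 := ∑ q ∈ T ×ˢ pairs N, w q.1 q.2 *
    (f (q.1 + unit q.2.1) - f (q.1 + unit q.2.1 + unit q.2.2)) with hT2
  set T3 := ∑ q ∈ T ×ˢ triples N, w q.1 q.2.1 / (N - 2) *
    (f (q.1 + unit q.2.1.1 + unit q.2.1.2)
      - f (q.1 + unit q.2.1.1 + unit q.2.1.2 + unit q.2.2)) with hT3
  set T4 := ∑ q ∈ T ×ˢ triples N, w q.1 q.2.1 / (N - 2) *
    (f (q.1 + unit q.2.1.1 + unit q.2.1.2 + unit q.2.2) - mean f) with hT4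
  have hdecomp : ∑ x ∈ T, (f x - mean f) = T1 + T2 + T3 + T4 := by
    rw [hT1, hT2, hT3, hT4]
    simp only [Finset.sum_product]
    rw [← Finset.sum_add_distrib, ← Finset.sum_add_distrib, ← Finset.sum_add_distrib]
    refine Finset.sum_congr rfl fun x hx => ?_
    rw [← Finset.sum_add_distrib, add_assoc, ← Finset.sum_add_distrib]
    have h3 := sum_triples (N := N) fun p => w x p / (N - 2) *
      (f (x + unit p.1 + unit p.2) - mean f)
    have h4 : ∑ t ∈ triples N, (w x t.1 / (N - 2) *
        (f (x + unit t.1.1 + unit t.1.2) - f (x + unit t.1.1 + unit t.1.2 + unit t.2)) +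
        w x t.1 / (N - 2) * (f (x + unit t.1.1 + unit t.1.2 + unit t.2) - mean f))
        = ∑ p ∈ pairs N, w x p * (f (x + unit p.1 + unit p.2) - mean f) := by
      rw [Finset.mul_sum] at h3
      refine (Finset.sum_congr rfl fun t _ => ?_).trans
        (h3.trans (Finset.sum_congr rfl fun p _ => ?_))
      · ring
      · field_simp
    rw [h4, ← Finset.sum_add_distrib]
    have h5 : f x - mean f = ∑ p ∈ pairs N, w x p * (f x - mean f) := by
      rw [← Finset.sum_mul, hw1 x hx, one_mul]
    rw [h5]
    exact Finset.sum_congr rfl fun p _ => by ring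
  -- The first edge costs little: either its conductance is at least `1 / ε`, or `f` is constant
  -- along it.
  have hb1 : T1 ≤ √(n * dir c f) * √(2 * ε) := by
    have h1 : T1 ≤ √(∑ q ∈ T ×ˢ pairs N, √(w q.1 q.2) ^ 2) *
        √(∑ q ∈ T ×ˢ pairs N, (√(w q.1 q.2) * (f q.1 - f (q.1 + unit q.2.1))) ^ 2) := by
      refine le_trans (le_of_eq ?_) (Real.sum_mul_le_sqrt_mul_sqrt _ _ _)
      refine Finset.sum_congr rfl fun q hq => ?_
      rw [← mul_assoc, Real.mul_self_sqrt (hw0 _ (Finset.mem_product.1 hq).1 _)]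
    have h2 : ∑ q ∈ T ×ˢ pairs N, √(w q.1 q.2) ^ 2 = n := by
      rw [Finset.sum_product]
      have : ∀ x ∈ T, ∑ p ∈ pairs N, √(w x p) ^ 2 = 1 := fun x hx => by
        rw [← hw1 x hx]
        exact Finset.sum_congr rfl fun p _ => Real.sq_sqrt (hw0 x hx p)
      rw [Finset.sum_congr rfl this]
      simp [hn]
    have h3 : ∑ q ∈ T ×ˢ pairs N, (√(w q.1 q.2) * (f q.1 - f (q.1 + unit q.2.1))) ^ 2
        ≤ 2 * ε * dir c f := by
      rw [Finset.sum_product]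
      have : ∀ x ∈ T, ∑ p ∈ pairs N, (√(w x p) * (f x - f (x + unit p.1))) ^ 2
          ≤ ε * ∑ i, edge c f (x, i) := fun x hx => by
        calc ∑ p ∈ pairs N, (√(w x p) * (f x - f (x + unit p.1))) ^ 2
            ≤ ∑ p ∈ pairs N, w x p * (ε * ∑ i, edge c f (x, i)) := by
              refine Finset.sum_le_sum fun p _ => ?_
              rw [mul_pow, Real.sq_sqrt (hw0 x hx p)]
              refine mul_le_mul_of_nonneg_left ((hε x hx p.1).trans ?_) (hw0 x hx p)
              exact mul_le_mul_of_nonneg_left (Finset.single_le_sum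
                (f := fun i => edge c f (x, i)) (fun i _ => hedge _) (Finset.mem_univ _)) hε0
          _ = _ := by rw [← Finset.sum_mul, hw1 x hx, one_mul]
      refine (Finset.sum_le_sum this).trans ?_
      rw [← Finset.mul_sum]
      have h4 : ∑ x ∈ T, ∑ i, edge c f (x, i) ≤ 2 * dir c f := by
        rw [← sum_edge, Fintype.sum_prod_type]
        exact Finset.sum_le_sum_of_subset_of_nonneg (Finset.subset_univ _)
          fun x _ _ => Finset.sum_nonneg fun i _ => hedge _
      nlinarith
    refine h1.trans ?_
    rw [h2, Real.sqrt_mul (Nat.cast_nonneg _), mul_assoc]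
    refine mul_le_mul_of_nonneg_left ?_ (Real.sqrt_nonneg _)
    rw [← Real.sqrt_mul hD]
    exact Real.sqrt_le_sqrt (h3.trans (le_of_eq (by ring)))
  -- The leading term. Splitting the weight as `√c * (√c / outflow)` makes the first Cauchy–Schwarz
  -- factor exactly `∑ 1 / outflow`.
  have hb2 : T2 ≤ √(n * dir c f) * √(1 / s) := by
    have h1 : T2 ≤ √(∑ q ∈ T ×ˢ pairs N, (√(c (q.1 + unit q.2.1) q.2.2) / outflow c q.1) ^ 2) *
        √(∑ q ∈ T ×ˢ pairs N, (√(c (q.1 + unit q.2.1) q.2.2) *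
          (f (q.1 + unit q.2.1) - f (q.1 + unit q.2.1 + unit q.2.2))) ^ 2) := by
      refine le_trans (le_of_eq ?_) (Real.sum_mul_le_sqrt_mul_sqrt _ _ _)
      refine Finset.sum_congr rfl fun q _ => ?_
      simp only [hw]
      have := Real.mul_self_sqrt (hc0 (q.1 + unit q.2.1) q.2.2)
      set r := √(c (q.1 + unit q.2.1) q.2.2)
      rw [← this]; ring
    have h2 : ∑ q ∈ T ×ˢ pairs N, (√(c (q.1 + unit q.2.1) q.2.2) / outflow c q.1) ^ 2
        ≤ n * (1 / s) := by
      rw [Finset.sum_product]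
      have : ∀ x ∈ T, ∑ p ∈ pairs N, (√(c (x + unit p.1) p.2) / outflow c x) ^ 2 ≤ 1 / s :=
        fun x hx => by
        calc ∑ p ∈ pairs N, (√(c (x + unit p.1) p.2) / outflow c x) ^ 2
            = ∑ p ∈ pairs N, c (x + unit p.1) p.2 / outflow c x ^ 2 :=
              Finset.sum_congr rfl fun p _ => by rw [div_pow, Real.sq_sqrt (hc0 _ _)]
          _ = 1 / outflow c x := by
              rw [← Finset.sum_div, ← outflow, sq]
              field_simp [(hSpos x hx).ne']
          _ ≤ 1 / s := one_div_le_one_div_of_le hs0 (hS x hx)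
      refine (Finset.sum_le_sum this).trans ?_
      simp [hn]
    have h3 : ∑ q ∈ T ×ˢ pairs N, (√(c (q.1 + unit q.2.1) q.2.2) *
          (f (q.1 + unit q.2.1) - f (q.1 + unit q.2.1 + unit q.2.2))) ^ 2 ≤ dir c f := by
      refine le_trans (le_of_eq ?_) (sum_edge_second_le hs hc hT f)
      exact Finset.sum_congr rfl fun q _ => by rw [mul_pow, Real.sq_sqrt (hc0 _ _), edge]
    refine h1.trans ((mul_le_mul (Real.sqrt_le_sqrt h2) (Real.sqrt_le_sqrt h3)
      (Real.sqrt_nonneg _) (Real.sqrt_nonneg _)).trans (le_of_eq ?_))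
    rw [← Real.sqrt_mul (by positivity), ← Real.sqrt_mul (by positivity)]
    congr 1; ring
  set R : ℝ := q / (s ^ 2 * (N - 2)) with hR
  -- Each pair of directions has `N - 2` extensions, each with a squared weight divided by `(N -
  -- 2)²`: a net gain of `N - 2`.
  have hwR : ∑ q ∈ T ×ˢ triples N, (w q.1 q.2.1 / (N - 2)) ^ 2 ≤ n * R := by
    rw [Finset.sum_product]
    have : ∀ x ∈ T, ∑ t ∈ triples N, (w x t.1 / (N - 2)) ^ 2 ≤ R := fun x hx => by
      rw [sum_triples fun p => (w x p / (N - 2)) ^ 2]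
      calc ((N : ℝ) - 2) * ∑ p ∈ pairs N, (w x p / (N - 2)) ^ 2
          = outflowSq c x / (outflow c x ^ 2 * (N - 2)) := by
            rw [outflowSq, Finset.sum_div, Finset.mul_sum]
            refine Finset.sum_congr rfl fun p _ => ?_
            have := (hSpos x hx).ne'
            simp only [hw]
            field_simp
        _ ≤ R := by
            have h0 : 0 ≤ outflowSq c x := Finset.sum_nonneg fun p _ => sq_nonneg _
            have := hq x hx
            refine div_le_div₀ (h0.trans this) this (by positivity) ?_
            exact mul_le_mul_of_nonneg_right (pow_le_pow_left₀ hs0.le (hS x hx) 2) hN2.le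
    refine (Finset.sum_le_sum this).trans ?_
    simp [hn]
  -- The multiplicity `4` and the two orientations give `8`, rounded up to the square `9`.
  have hb3 : T3 ≤ √(n * dir c f) * (3 * √R) := by
    have h3 : ∑ q ∈ T ×ˢ triples N, (f (q.1 + unit q.2.1.1 + unit q.2.1.2)
      - f (q.1 + unit q.2.1.1 + unit q.2.1.2 + unit q.2.2)) ^ 2 ≤ 9 * dir c f := by
      calc _ ≤ ∑ q ∈ T ×ˢ triples N, edge c f (q.1 + unit q.2.1.1 + unit q.2.1.2, q.2.2) := by
            refine Finset.sum_le_sum fun q _ => ?_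
            exact le_mul_of_one_le_left (sq_nonneg _) (hc _ _)
        _ ≤ 4 * ∑ k, edge c f k := sum_path_two_le hT _ hedge
        _ ≤ 9 * dir c f := by rw [sum_edge]; linarith
    refine (Real.sum_mul_le_sqrt_mul_sqrt _ _ _).trans ((mul_le_mul (Real.sqrt_le_sqrt hwR)
      (Real.sqrt_le_sqrt h3) (Real.sqrt_nonneg _) (Real.sqrt_nonneg _)).trans (le_of_eq ?_))
    rw [Real.sqrt_mul (Nat.cast_nonneg _), Real.sqrt_mul (by norm_num : (0 : ℝ) ≤ 9),
      Real.sqrt_mul (Nat.cast_nonneg _), show (9 : ℝ) = 3 ^ 2 by norm_num,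
      Real.sqrt_sq (by norm_num : (0 : ℝ) ≤ 3)]
    ring
  -- The multiplicity `27` is rounded up to the square `36`; `3 + 6` is the factor `9` in
  -- `flowConst`.
  have hb4 : T4 ≤ √(n * dir c f) * (6 * √R) := by
    have h3 : ∑ q ∈ T ×ˢ triples N, (f (q.1 + unit q.2.1.1 + unit q.2.1.2 + unit q.2.2)
      - mean f) ^ 2 ≤ 36 * dir c f := by
      calc _ ≤ 27 * ∑ v, (f v - mean f) ^ 2 :=
            sum_path_three_le hT (fun v => (f v - mean f) ^ 2) fun _ => sq_nonneg _
        _ ≤ 36 * dir c f := by have := poincare hc f; linarith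
    refine (Real.sum_mul_le_sqrt_mul_sqrt _ _ _).trans ((mul_le_mul (Real.sqrt_le_sqrt hwR)
      (Real.sqrt_le_sqrt h3) (Real.sqrt_nonneg _) (Real.sqrt_nonneg _)).trans (le_of_eq ?_))
    rw [Real.sqrt_mul (Nat.cast_nonneg _), Real.sqrt_mul (by norm_num : (0 : ℝ) ≤ 36),
      Real.sqrt_mul (Nat.cast_nonneg _), show (36 : ℝ) = 6 ^ 2 by norm_num,
      Real.sqrt_sq (by norm_num : (0 : ℝ) ≤ 6)]
    ring
  rw [hdecomp, flowConst, ← hR]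
  linarith

/-- The mean is absorbed by the mass term `μ ∑ f²`, so the flow estimate becomes a lower bound on
capacities for the killed walk, with no centring left. It serves both the Green function and hitting
probabilities. -/
theorem sum_le_sqrt_energy (hs : Symm c) (hc : ∀ y i, 1 ≤ c y i)
    (hT : Separated T) (f : V N → ℝ)
    (hN : 3 ≤ N) {s q ε μ : ℝ} (hs0 : 0 < s)
    (hS : ∀ x ∈ T, s ≤ outflow c x)
    (hq : ∀ x ∈ T, outflowSq c x ≤ q) (hε0 : 0 ≤ ε)
    (hε : ∀ x ∈ T, ∀ i, (f x - f (x + unit i)) ^ 2 ≤ ε * edge c f (x, i)) (hμ : 0 < μ)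
    (hf : 0 ≤ ∑ x ∈ T, f x) :
    (∑ x ∈ T, f x) ^ 2 ≤ (dir c f + μ * ∑ y, f y ^ 2) *
      (T.card * flowConst N s q ε ^ 2 + (T.card : ℝ) ^ 2 / (2 ^ N * μ)) := by
  have hD : 0 ≤ dir c f := dir_nonneg (fun y i => zero_le_one.trans (hc y i)) f
  have hF : 0 ≤ ∑ y, f y ^ 2 := Finset.sum_nonneg fun _ _ => sq_nonneg _
  have h1 := flow_bound hs hc hT f hN hs0 hS hq hε0 hε
  rw [Finset.sum_sub_distrib, Finset.sum_const, nsmul_eq_mul,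
    Real.sqrt_mul (Nat.cast_nonneg _)] at h1
  have h2 := mean_le f
  rw [← Finset.sum_div] at h2
  set n : ℝ := (T.card : ℝ) with hn
  have hn0 : 0 ≤ n := Nat.cast_nonneg _
  set K := flowConst N s q ε
  set A := √(dir c f) with hA
  set B := √(μ * ∑ y, f y ^ 2) with hB
  set r := n / √(2 ^ N * μ) with hr
  have hA2 : A ^ 2 = dir c f := Real.sq_sqrt hD
  have hB2 : B ^ 2 = μ * ∑ y, f y ^ 2 := Real.sq_sqrt (by positivity)
  have hr2 : r ^ 2 = n ^ 2 / (2 ^ N * μ) := by rw [hr, div_pow, Real.sq_sqrt (by positivity)]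
  have hp2 : (√n * K) ^ 2 = n * K ^ 2 := by rw [mul_pow, Real.sq_sqrt hn0]
  have h3 : n * √((∑ y, f y ^ 2) / 2 ^ N) = B * r := by
    rw [hB, hr, Real.sqrt_mul hμ.le, Real.sqrt_mul (by positivity),
      Real.sqrt_div' _ (by positivity)]
    field_simp
  have h4 : ∑ x ∈ T, f x ≤ A * (√n * K) + B * r := by
    have := mul_le_mul_of_nonneg_left h2 hn0
    linarith
  rw [← hA2, ← hB2, ← hp2, ← hr2]
  refine (pow_le_pow_left₀ hf h4 2).trans ?_
  nlinarith [sq_nonneg (A * r - B * (√n * K))]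

end flow

/-! ### Semigroups of symmetric operators -/

section spectral

variable {F : Type*} [NormedAddCommGroup F] [InnerProductSpace ℝ F] [FiniteDimensional ℝ F]

/-- On the spectrum of `T`, which is nonpositive, `1 + x ≤ exp x ≤ 1 / (1 - x)`. The first bound
gives the short-time estimate and the second compares the semigroup with the resolvent `w`. -/
theorem exists_semigroup_orbit {T : F →ₗ[ℝ] F} (hT : T.IsSymmetric)
    (hneg : ∀ x, inner ℝ (T x) x ≤ 0) (b : F) :
    ∃ v : ℝ → F, (∀ s, HasDerivAt v (T (v s)) s) ∧ v 0 = b ∧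
      (∀ s, 0 ≤ s → inner ℝ b b + s * inner ℝ b (T b) ≤ inner ℝ b (v s)) ∧
      (∀ s, 0 ≤ s → ∃ w, w - s • T w = b ∧ inner ℝ b (v s) ≤ inner ℝ b w) := by
  set e := hT.eigenvectorBasis rfl with he
  set l := hT.eigenvalues rfl with hl
  have hTe : ∀ k, T (e k) = l k • e k := fun k => hT.apply_eigenvectorBasis rfl k
  have hl0 : ∀ k, l k ≤ 0 := fun k => by
    have h := hneg (e k)
    rw [hTe, inner_smul_left, real_inner_self_eq_norm_sq, e.orthonormal.1 k] at h
    simpa using h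
  set c := fun k => inner ℝ (e k) b with hc
  have hb : ∑ k, c k • e k = b := e.sum_repr' b
  have hbe : ∀ k, inner ℝ b (e k) = c k := fun k => real_inner_comm _ _
  have hsum : ∀ a : _ → ℝ, inner ℝ b (∑ k, a k • e k) = ∑ k, a k * c k := fun a => by
    rw [inner_sum]
    exact Finset.sum_congr rfl fun k _ => by rw [inner_smul_right, hbe]
  have hTs : ∀ a : _ → ℝ, T (∑ k, a k • e k) = ∑ k, (a k * l k) • e k := fun a => by
    rw [map_sum]
    exact Finset.sum_congr rfl fun k _ => by rw [map_smul, hTe, smul_smul]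
  refine ⟨fun s => ∑ k, (Real.exp (s * l k) * c k) • e k, fun s => ?_, ?_, fun s hs => ?_,
    fun s hs => ⟨∑ k, (c k / (1 - s * l k)) • e k, ?_, ?_⟩⟩
  · rw [hTs]
    refine HasDerivAt.fun_sum fun k _ => HasDerivAt.smul_const ?_ _
    have h1 : HasDerivAt (fun s : ℝ => Real.exp (s * l k)) (Real.exp (s * l k) * (1 * l k)) s :=
      ((hasDerivAt_id s).mul_const (l k)).exp
    convert h1.mul_const (c k) using 1
    ring
  · simpa using hb
  · rw [hsum]
    have h1 : inner ℝ b b = ∑ k, c k * c k := by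
      conv_lhs => rw [← hb]
      rw [hb, ← hsum, hb]
    have h2 : inner ℝ b (T b) = ∑ k, c k * l k * c k := by
      rw [← hsum, ← hTs, hb]
    rw [h1, h2, Finset.mul_sum, ← Finset.sum_add_distrib]
    refine Finset.sum_le_sum fun k _ => ?_
    nlinarith [mul_le_mul_of_nonneg_right (Real.add_one_le_exp (s * l k)) (mul_self_nonneg (c k))]
  · rw [hTs, Finset.smul_sum, ← Finset.sum_sub_distrib]
    conv_rhs => rw [← hb]
    refine Finset.sum_congr rfl fun k _ => ?_
    have : 1 - s * l k ≠ 0 := by nlinarith [hl0 k]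
    rw [smul_smul, ← sub_smul]
    congr 1
    field_simp
  · rw [hsum, hsum]
    refine Finset.sum_le_sum fun k _ => ?_
    have h0 : 0 < 1 - s * l k := by nlinarith [hl0 k]
    have h1 : Real.exp (s * l k) ≤ 1 / (1 - s * l k) := by
      rw [le_div_iff₀ h0]
      have h2 := Real.add_one_le_exp (-(s * l k))
      calc Real.exp (s * l k) * (1 - s * l k)
          ≤ Real.exp (s * l k) * Real.exp (-(s * l k)) :=
            mul_le_mul_of_nonneg_left (by linarith) (Real.exp_pos _).le
        _ = 1 := by rw [← Real.exp_add]; simp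
    calc Real.exp (s * l k) * c k * c k = Real.exp (s * l k) * (c k * c k) := by ring
      _ ≤ 1 / (1 - s * l k) * (c k * c k) :=
        mul_le_mul_of_nonneg_right h1 (mul_self_nonneg _)
      _ = _ := by ring

end spectral

/-! ### Killed walks, resolvents and capacities -/

/-- The indicator function of a set of sites. -/
def ind (A : Finset (V N)) (y : V N) : ℝ := if y ∈ A then 1 else 0

lemma dir_one_sub (c : V N → Fin N → ℝ) (f : V N → ℝ) : dir c (fun y => 1 - f y) = dir c f := by
  simp only [dir]
  congr 1
  refine Finset.sum_congr rfl fun y _ => Finset.sum_congr rfl fun i _ => ?_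
  ring

lemma gen_one_sub (c : V N → Fin N → ℝ) (f : V N → ℝ) (y : V N) :
    gen c (fun y => 1 - f y) y = - gen c f y := by
  simp only [gen, ← Finset.sum_neg_distrib]
  exact Finset.sum_congr rfl fun i _ => by ring

/-- The generator of the walk killed on `A`. -/
def killed (c : V N → Fin N → ℝ) (A : Finset (V N)) :
    EuclideanSpace ℝ (V N) →ₗ[ℝ] EuclideanSpace ℝ (V N) where
  toFun f := WithLp.toLp 2 fun y => (1 - ind A y) * gen c (fun z => (1 - ind A z) * f z) y
  map_add' f g := by
    ext y
    simp only [PiLp.add_apply, gen]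
    rw [← mul_add, ← Finset.sum_add_distrib]
    congr 1
    exact Finset.sum_congr rfl fun i _ => by ring
  map_smul' r f := by
    ext y
    simp only [PiLp.smul_apply, gen, smul_eq_mul, RingHom.id_apply, Finset.mul_sum]
    exact Finset.sum_congr rfl fun i _ => by ring

lemma killed_apply (c : V N → Fin N → ℝ) (A : Finset (V N)) (f : EuclideanSpace ℝ (V N))
    (y : V N) :
    killed c A f y = (1 - ind A y) * gen c (fun z => (1 - ind A z) * f z) y := rfl

lemma inner_killed {c : V N → Fin N → ℝ} (hs : Symm c) (A : Finset (V N))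
    (f g : EuclideanSpace ℝ (V N)) :
    inner ℝ (killed c A f) g
      = - dirB c (fun z => (1 - ind A z) * g z) (fun z => (1 - ind A z) * f z) := by
  rw [← sum_mul_gen hs, PiLp.inner_apply]
  refine Finset.sum_congr rfl fun y _ => ?_
  rw [killed_apply]
  simp only [RCLike.inner_apply, conj_trivial]
  ring

/-- The survival function of the walk killed on `A`, with the bounds on its mass in terms of the
Dirichlet form. -/
theorem exists_killed_semigroup {c : V N → Fin N → ℝ} (hs : Symm c) (hc : ∀ y i, 0 ≤ c y i)
    (A : Finset (V N)) :
    ∃ v : ℝ → V N → ℝ,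
      (∀ s, ∀ y ∉ A, HasDerivAt (fun s => v s y) (gen c (v s) y) s) ∧
      (∀ y, Continuous fun s => v s y) ∧
      (∀ y ∉ A, v 0 y = 1) ∧ (∀ s, ∀ y ∈ A, v s y = 0) ∧
      (∀ s, 0 ≤ s → 2 ^ N - A.card - s * dir c (ind A) ≤ ∑ y, v s y) ∧
      (∀ s, 0 < s → ∃ h : V N → ℝ, (∀ y ∈ A, h y = 1) ∧
        ∑ y, v s y ≤ 2 ^ N - s * (dir c h + 1 / s * ∑ y, h y ^ 2)) := by
  set b : EuclideanSpace ℝ (V N) := WithLp.toLp 2 fun y => 1 - ind A y with hb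
  have hby : ∀ y, b y = 1 - ind A y := fun y => rfl
  have hindA : ∀ y ∈ A, ind A y = 1 := fun y hy => if_pos hy
  have hindA' : ∀ y ∉ A, ind A y = 0 := fun y hy => if_neg hy
  -- Symmetry is the reason why `killed` cuts off both before and after applying the generator.
  have hsymm : (killed c A).IsSymmetric := fun f g => by
    rw [inner_killed hs, ← real_inner_comm, inner_killed hs, dirB_comm]
  have hneg : ∀ f, inner ℝ (killed c A f) f ≤ 0 := fun f => by
    rw [inner_killed hs, ← dir_eq_dirB]
    exact neg_nonpos.2 (dir_nonneg hc _)
  obtain ⟨v, hv, hv0, hlow, hup⟩ := exists_semigroup_orbit hsymm hneg b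
  have hd : ∀ s y, HasDerivAt (fun s => v s y) (killed c A (v s) y) s := fun s y =>
    ((EuclideanSpace.proj y : EuclideanSpace ℝ (V N) →L[ℝ] ℝ).hasFDerivAt.comp_hasDerivAt s (hv s))
  have hvA : ∀ s, ∀ y ∈ A, v s y = 0 := fun s y hy => by
    have h1 : ∀ s, HasDerivAt (fun s => v s y) 0 s := fun s => by
      have := hd s y
      rwa [killed_apply, hindA y hy, sub_self, zero_mul] at this
    have h2 := is_const_of_deriv_eq_zero (fun s => (h1 s).differentiableAt)
      (fun s => (h1 s).deriv) s 0
    rw [h2, hv0, hby, hindA y hy, sub_self]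
  have hsum : ∀ f : EuclideanSpace ℝ (V N), (∀ y ∈ A, f y = 0) → inner ℝ b f = ∑ y, f y := by
    intro f hf
    rw [PiLp.inner_apply]
    refine Finset.sum_congr rfl fun y _ => ?_
    simp only [RCLike.inner_apply, conj_trivial, hby]
    by_cases hy : y ∈ A
    · rw [hf y hy, zero_mul]
    · rw [hindA' y hy, sub_zero, mul_one]
  have hred : ∀ f : EuclideanSpace ℝ (V N), (∀ y ∈ A, f y = 0) →
      (fun z => (1 - ind A z) * f z) = fun z => f z := fun f hf => by
    funext z
    by_cases hz : z ∈ A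
    · rw [hf z hz, mul_zero]
    · rw [hindA' z hz]; ring
  refine ⟨fun s y => v s y, fun s y hy => ?_,
    fun y => continuous_iff_continuousAt.2 fun s => (hd s y).continuousAt, fun y hy => ?_, hvA,
    fun s h0 => ?_, fun s h0 => ?_⟩
  · have := hd s y
    rwa [killed_apply, hindA' y hy, sub_zero, one_mul, hred _ (hvA s)] at this
  · show v 0 y = 1
    rw [hv0, hby, hindA' y hy, sub_zero]
  · have h1 := hlow s h0
    rw [hsum (v s) (hvA s)] at h1
    refine le_trans (le_of_eq ?_) h1
    have hbA : ∀ y ∈ A, b y = 0 := fun y hy => by rw [hby, hindA y hy, sub_self]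
    rw [hsum b hbA, real_inner_comm, inner_killed hs, ← dir_eq_dirB, hred b hbA]
    have h2 : dir c (fun z => b z) = dir c (ind A) := dir_one_sub c (ind A)
    rw [h2]
    have h3 : ∑ y, b y = 2 ^ N - A.card := by
      simp only [hby, Finset.sum_sub_distrib, ind]
      rw [Finset.sum_const, Finset.card_univ, card_V]
      simp
    rw [h3]; ring
  · obtain ⟨w, hw, hle⟩ := hup s h0.le
    have hwy : ∀ y, w y - s * killed c A w y = 1 - ind A y := fun y => by
      rw [← hby, ← hw]; rfl
    have hwA : ∀ y ∈ A, w y = 0 := fun y hy => by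
      have := hwy y
      rw [killed_apply, hindA y hy] at this
      linarith
    -- `1 - w` is the equilibrium potential of `A` for the form `dir + (1/s) ∑ h²`: it is `1` on `A`
    -- and satisfies `h - s L h = 0` elsewhere.
    refine ⟨fun y => 1 - w y, fun y hy => by simp [hwA y hy], ?_⟩
    rw [hsum (v s) (hvA s), hsum w hwA] at hle
    refine hle.trans (le_of_eq ?_)
    set h : V N → ℝ := fun y => 1 - w y with hh
    have hoff : ∀ y ∉ A, h y - s * gen c h y = 0 := fun y hy => by
      have := hwy y
      rw [killed_apply, hindA' y hy, hred w hwA] at this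
      rw [hh, gen_one_sub]
      linarith
    -- The residual lives on `A`, where `h = 1`; so the energy of `h` equals the total residual,
    -- which is the mass lost by `w`.
    have h1 : ∑ y, h y * (h y - s * gen c h y) = ∑ y, (h y - s * gen c h y) := by
      refine Finset.sum_congr rfl fun y _ => ?_
      by_cases hy : y ∈ A
      · have : h y = 1 := by rw [hh]; simp [hwA y hy]
        rw [this, one_mul]
      · rw [hoff y hy, mul_zero]
    have h2 : ∑ y, h y * (h y - s * gen c h y) = ∑ y, h y ^ 2 + s * dir c h := by
      rw [dir_eq_dirB, ← neg_neg (dirB c h h), ← sum_mul_gen hs, mul_neg, ← sub_eq_add_neg,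
        Finset.mul_sum, ← Finset.sum_sub_distrib]
      exact Finset.sum_congr rfl fun y _ => by ring
    have h3 : ∑ y, (h y - s * gen c h y) = 2 ^ N - ∑ y, w y := by
      rw [Finset.sum_sub_distrib, ← Finset.mul_sum, sum_gen hs, mul_zero, sub_zero, hh,
        Finset.sum_sub_distrib, Finset.sum_const, Finset.card_univ, card_V]
      simp
    have h4 : s * (dir c h + 1 / s * ∑ y, h y ^ 2) = ∑ y, h y ^ 2 + s * dir c h := by
      field_simp
      ring
    rw [h4, ← h2, h1, h3]
    ring

/-- The resolvent. -/
theorem exists_resolvent {c : V N → Fin N → ℝ} (hs : Symm c) (hc : ∀ y i, 0 ≤ c y i) {l : ℝ}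
    (hl : 0 < l) (b : V N → ℝ) : ∃ g : V N → ℝ, ∀ y, l * g y - gen c g y = b y := by
  let R : (V N → ℝ) →ₗ[ℝ] (V N → ℝ) :=
    { toFun := fun g y => l * g y - gen c g y
      map_add' := fun f g => by
        ext y
        simp only [Pi.add_apply, gen]
        rw [show ∑ i, c y i * (f (y + unit i) + g (y + unit i) - (f y + g y))
          = ∑ i, c y i * (f (y + unit i) - f y) + ∑ i, c y i * (g (y + unit i) - g y) by
            rw [← Finset.sum_add_distrib]
            exact Finset.sum_congr rfl fun i _ => by ring]
        ring
      map_smul' := fun r f => by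
        ext y
        simp only [Pi.smul_apply, gen, smul_eq_mul, RingHom.id_apply, mul_sub, Finset.mul_sum]
        congr 1
        · ring
        · exact Finset.sum_congr rfl fun i _ => by ring }
  have hR : ∀ g y, R g y = l * g y - gen c g y := fun _ _ => rfl
  -- In finite dimension injectivity suffices, and it follows by pairing the equation with `g`, as
  -- the form is at least `l ∑ g²`.
  have hinj : Function.Injective R := by
    rw [← LinearMap.ker_eq_bot, LinearMap.ker_eq_bot']
    intro g hg
    have h1 : ∑ y, g y * (l * g y - gen c g y) = 0 :=
      Finset.sum_eq_zero fun y _ => by rw [← hR, hg]; simp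
    have h2 : ∑ y, g y * (l * g y - gen c g y) = l * ∑ y, g y ^ 2 + dir c g := by
      rw [dir_eq_dirB, ← neg_neg (dirB c g g), ← sum_mul_gen hs, ← sub_eq_add_neg,
        Finset.mul_sum, ← Finset.sum_sub_distrib]
      exact Finset.sum_congr rfl fun y _ => by ring
    have h3 := dir_nonneg hc g
    have h4 : ∑ y, g y ^ 2 ≤ 0 := by
      by_contra hcon
      push Not at hcon
      have := mul_pos hl hcon
      linarith
    have h5 : ∑ y, g y ^ 2 = 0 := le_antisymm h4 (Finset.sum_nonneg fun _ _ => sq_nonneg _)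
    funext y
    have := (Finset.sum_eq_zero_iff_of_nonneg fun y _ => sq_nonneg (g y)).1 h5 y
      (Finset.mem_univ y)
    simpa using this
  obtain ⟨g, hg⟩ := (LinearMap.injective_iff_surjective.1 hinj) b
  exact ⟨g, fun y => by rw [← hR, hg]⟩

/-- The unit ball. -/
def ball (x : V N) : Finset (V N) := insert x (Finset.univ.image fun i => x + unit i)

lemma sum_ball (x : V N) (h : V N → ℝ) : ∑ y ∈ ball x, h y = h x + ∑ i, h (x + unit i) := by
  rw [ball, Finset.sum_insert, Finset.sum_image]
  · exact fun i _ j _ hij => unit_injective (add_left_cancel hij)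
  · intro hx
    obtain ⟨i, -, hi⟩ := Finset.mem_image.1 hx
    have := hammingDist_add_unit x i
    rw [hi, hammingDist_self] at this
    exact absurd this (by norm_num)

lemma card_ball (x : V N) : ((ball x).card : ℝ) = N + 1 := by
  have := sum_ball x fun _ => 1
  simp only [Finset.sum_const, nsmul_eq_mul, mul_one, Finset.card_univ, Fintype.card_fin] at this
  rw [this]; ring

lemma mem_ball_iff {x y : V N} : y ∈ ball x ↔ hammingDist x y ≤ 1 := by
  constructor
  · intro h
    rcases Finset.mem_insert.1 h with rfl | h
    · simp
    · obtain ⟨i, -, rfl⟩ := Finset.mem_image.1 h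
      rw [hammingDist_add_unit]
  · intro h
    have h2 : ∀ p q : ZMod 2, p ≠ q → q = p + 1 := by decide
    rw [hammingDist] at h
    rcases Nat.le_one_iff_eq_zero_or_eq_one.1 h with h | h
    · refine Finset.mem_insert.2 (Or.inl (funext fun j => ?_))
      by_contra hj
      have : j ∈ Finset.univ.filter fun i => x i ≠ y i :=
        Finset.mem_filter.2 ⟨Finset.mem_univ j, fun h => hj h.symm⟩
      rw [Finset.card_eq_zero.1 h] at this
      simp at this
    obtain ⟨i, hi⟩ := Finset.card_eq_one.1 h
    replace hi := hi.le
    by_cases hxy : x i = y i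
    · refine Finset.mem_insert.2 (Or.inl (funext fun j => ?_))
      by_contra hj
      have := hi (Finset.mem_filter.2 ⟨Finset.mem_univ j, fun h => hj h.symm⟩)
      rw [Finset.mem_singleton] at this
      subst this
      exact hj hxy.symm
    · refine Finset.mem_insert_of_mem (Finset.mem_image.2 ⟨i, Finset.mem_univ i,
        funext fun j => ?_⟩)
      rw [Pi.add_apply, unit_apply]
      by_cases hji : j = i
      · subst hji
        rw [if_pos rfl, h2 _ _ hxy]
      · rw [if_neg hji, add_zero]
        by_contra hj
        exact hji (Finset.mem_singleton.1 (hi (Finset.mem_filter.2 ⟨Finset.mem_univ j, hj⟩)))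

/-- Summation by parts leaves the edges going out of the ball. None starts at the centre, and an
edge back to the centre contributes nothing. -/
lemma dir_ind_ball_le {c : V N → Fin N → ℝ} (hs : Symm c) (hc : ∀ y i, 0 ≤ c y i) (x : V N) :
    dir c (ind (ball x)) ≤ outflow c x := by
  have hx : ind (ball x) x = 1 := if_pos (Finset.mem_insert_self _ _)
  have hxi : ∀ i, ind (ball x) (x + unit i) = 1 := fun i => if_pos
    (Finset.mem_insert_of_mem (Finset.mem_image.2 ⟨i, Finset.mem_univ i, rfl⟩))
  have h0 : ∀ y, 0 ≤ ind (ball x) y := fun y => by unfold ind; split_ifs <;> norm_num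
  have h1 : dir c (ind (ball x)) = ∑ y ∈ ball x, - gen c (ind (ball x)) y := by
    rw [dir_eq_dirB, ← neg_neg (dirB c _ _), ← sum_mul_gen hs, ← Finset.sum_neg_distrib]
    simp only [ind, ite_mul, one_mul, zero_mul, neg_ite, neg_zero, Finset.sum_ite_mem,
      Finset.univ_inter]
  have h2 : gen c (ind (ball x)) x = 0 := by
    simp only [gen, hx, hxi, sub_self, mul_zero, Finset.sum_const_zero]
  have hp : pairs N = (Finset.univ ×ˢ Finset.univ).filter fun p => p.1 ≠ p.2 := by
    ext p; simp [mem_pairs]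
  rw [h1, sum_ball, h2, neg_zero, zero_add, outflow, hp]
  rw [Finset.sum_filter, Finset.sum_product]
  refine Finset.sum_le_sum fun i _ => ?_
  rw [gen, ← Finset.sum_neg_distrib]
  refine Finset.sum_le_sum fun j _ => ?_
  rw [hxi]
  dsimp only
  split_ifs with hij
  · nlinarith [hc (x + unit i) j, h0 (x + unit i + unit j)]
  · push Not at hij
    subst hij
    rw [add_unit_add_unit, hx]
    simp

/-! ### Variational bounds on the Green function -/

section green

variable {c : V N → Fin N → ℝ} {l : ℝ} {g : V N → ℝ}

lemma resolvent_zero_eq (hs : Symm c)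
    (hg : ∀ y, l * g y - gen c g y = if y = 0 then 1 else 0) :
    g 0 = dir c g + l * ∑ y, g y ^ 2 := by
  have h1 : ∑ y, g y * (l * g y - gen c g y) = g 0 := by simp [hg]
  have h2 : ∑ y, g y * (l * g y - gen c g y) = dir c g + l * ∑ y, g y ^ 2 := by
    rw [dir_eq_dirB, ← neg_neg (dirB c g g), ← sum_mul_gen hs, add_comm, ← sub_eq_add_neg,
      Finset.mul_sum, ← Finset.sum_sub_distrib]
    exact Finset.sum_congr rfl fun y _ => by ring
  rw [← h1, h2]

/-- The energy of `g` is `g 0` itself, so the flow bound with the single centre `0` reads `g 0 ² ≤ g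
0 * (...)`, and one factor cancels. -/
theorem resolvent_zero_le (hs : Symm c) (hc : ∀ y i, 1 ≤ c y i) (hl : 0 < l)
    (hg : ∀ y, l * g y - gen c g y = if y = 0 then 1 else 0) (hN : 3 ≤ N) {s q ε : ℝ}
    (hs0 : 0 < s) (hS : s ≤ outflow c 0) (hq : outflowSq c 0 ≤ q) (hε0 : 0 ≤ ε)
    (hε : ∀ i, 1 ≤ ε * c 0 i) :
    g 0 ≤ flowConst N s q ε ^ 2 + 1 / (2 ^ N * l) := by
  have h0 := resolvent_zero_eq hs hg
  have hg0 : 0 ≤ g 0 := by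
    rw [h0]
    have := dir_nonneg (fun y i => zero_le_one.trans (hc y i)) g
    have : 0 ≤ ∑ y, g y ^ 2 := Finset.sum_nonneg fun _ _ => sq_nonneg _
    positivity
  have hT : Separated ({0} : Finset (V N)) := fun x hx y hy _ => by
    rw [Finset.mem_singleton.1 hx, Finset.mem_singleton.1 hy]
  have key := sum_le_sqrt_energy hs hc hT g hN (s := s) (q := q) (ε := ε) (μ := l) hs0
    (by simpa using hS) (by simpa using hq) hε0 (by
      intro x hx i
      rw [Finset.mem_singleton.1 hx, edge, ← mul_assoc]
      exact le_mul_of_one_le_left (sq_nonneg _) (hε i)) hl (by simpa using hg0)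
  simp only [Finset.sum_singleton, Finset.card_singleton, Nat.cast_one, one_mul, one_pow] at key
  rw [← h0] at key
  rcases hg0.eq_or_lt with h | h
  · rw [← h]; positivity
  · rw [sq] at key
    exact le_of_mul_le_mul_left key h

/-- Dirichlet's principle. Against a test function `f`, the energy form applied to `g` returns `f
0`; the indicator of the ball has energy at most `C`, and expanding the energy of `f / C - g` yields
`0 ≤ 1 / C - 2 / C + g 0`. -/
theorem le_resolvent_zero (hs : Symm c) (hc : ∀ y i, 1 ≤ c y i) (hl : 0 < l)
    (hg : ∀ y, l * g y - gen c g y = if y = 0 then 1 else 0) :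
    1 / (outflow c 0 + l * (N + 1)) ≤ g 0 := by
  have hc0 : ∀ y i, 0 ≤ c y i := fun y i => zero_le_one.trans (hc y i)
  have h0 := resolvent_zero_eq hs hg
  set f := ind (ball (0 : V N)) with hf
  set C := outflow c 0 + l * (N + 1) with hC
  have hCpos : 0 < C := by
    have : 0 ≤ outflow c 0 := Finset.sum_nonneg fun p _ => hc0 _ _
    positivity
  have hf2 : ∑ y, f y ^ 2 = N + 1 := by
    rw [← card_ball (0 : V N)]
    simp [hf, ind]
  have hfg : dirB c f g + l * ∑ y, f y * g y = 1 := by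
    have h1 : ∑ y, f y * (l * g y - gen c g y) = 1 := by
      simp [hg, hf, ind, ball]
    rw [← h1, ← neg_neg (dirB c f g), ← sum_mul_gen hs, add_comm, ← sub_eq_add_neg,
      Finset.mul_sum, ← Finset.sum_sub_distrib]
    exact Finset.sum_congr rfl fun y _ => by ring
  have hE : dir c f + l * ∑ y, f y ^ 2 ≤ C := by
    rw [hf2]
    exact add_le_add_left (dir_ind_ball_le hs hc0 0) _
  have hquad : 0 ≤ dir c (fun y => 1 / C * f y - g y)
      + l * ∑ y, (1 / C * f y - g y) ^ 2 :=
    add_nonneg (dir_nonneg hc0 _) (mul_nonneg hl.le (Finset.sum_nonneg fun _ _ => sq_nonneg _))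
  have hexp : dir c (fun y => 1 / C * f y - g y) + l * ∑ y, (1 / C * f y - g y) ^ 2
      = (1 / C) ^ 2 * (dir c f + l * ∑ y, f y ^ 2)
        - 2 * (1 / C) * (dirB c f g + l * ∑ y, f y * g y) + (dir c g + l * ∑ y, g y ^ 2) := by
    have e1 : dir c (fun y => 1 / C * f y - g y)
        = (1 / C) ^ 2 * dir c f - 2 * (1 / C) * dirB c f g + dir c g := by
      simp only [dir, dirB, Finset.mul_sum, ← Finset.sum_sub_distrib, ← Finset.sum_add_distrib]
      exact Finset.sum_congr rfl fun y _ => Finset.sum_congr rfl fun i _ => by ring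
    have e2 : ∑ y, (1 / C * f y - g y) ^ 2
        = (1 / C) ^ 2 * ∑ y, f y ^ 2 - 2 * (1 / C) * ∑ y, f y * g y + ∑ y, g y ^ 2 := by
      simp only [Finset.mul_sum, ← Finset.sum_sub_distrib, ← Finset.sum_add_distrib]
      exact Finset.sum_congr rfl fun y _ => by ring
    rw [e1, e2]; ring
  rw [hexp, hfg, ← h0] at hquad
  have h5 : (1 / C) ^ 2 * (dir c f + l * ∑ y, f y ^ 2) ≤ 1 / C := by
    calc _ ≤ (1 / C) ^ 2 * C := mul_le_mul_of_nonneg_left hE (by positivity)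
      _ = 1 / C := by field_simp
  linarith

end green

/-! ### The law of one jump -/

lemma expMeasure_Ioi {x : ℝ} (hx : 0 ≤ x) :
    expMeasure 1 (Set.Ioi x) = ENNReal.ofReal (Real.exp (-x)) := by
  have h := cdf_expMeasure_eq one_pos x
  rw [if_pos hx, cdf_eq_real, one_mul] at h
  have h2 : (expMeasure 1).real (Set.Ioi x) = Real.exp (-x) := by
    rw [← Set.compl_Iic, probReal_compl_eq_one_sub measurableSet_Iic, h]; ring
  rw [← h2, ofReal_measureReal]

lemma lintegral_expMeasure (K : ℝ → ℝ≥0∞) (hK : Measurable K) :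
    ∫⁻ x, K x ∂expMeasure 1 = ∫⁻ x in Set.Ioi 0, ENNReal.ofReal (Real.exp (-x)) * K x := by
  have h1 : expMeasure 1 = volume.withDensity (exponentialPDF 1) := rfl
  have hm : Measurable (exponentialPDF 1) := (measurable_exponentialPDFReal 1).ennreal_ofReal
  rw [h1, lintegral_withDensity_eq_lintegral_mul _ hm hK, setLIntegral_congr Ioi_ae_eq_Ici,
    ← lintegral_indicator measurableSet_Ici]
  refine lintegral_congr fun x => ?_
  by_cases hx : 0 ≤ x
  · rw [Set.indicator_of_mem (show x ∈ Set.Ici (0 : ℝ) from hx), Pi.mul_apply,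
      exponentialPDF_of_nonneg hx, one_mul, one_mul]
  · rw [Set.indicator_of_notMem (show x ∉ Set.Ici (0 : ℝ) from hx), Pi.mul_apply,
      exponentialPDF_of_neg (not_le.1 hx), zero_mul]

lemma lintegral_Ioi_div {w : ℝ} (hw : 0 < w) (K : ℝ → ℝ≥0∞) :
    ∫⁻ x in Set.Ioi 0, K (x / w) = ∫⁻ q in Set.Ioi 0, ENNReal.ofReal w * K q := by
  have h := Real.map_volume_mul_left (a := w⁻¹) (inv_ne_zero hw.ne')
  have he : MeasurableEmbedding fun x : ℝ => w⁻¹ * x :=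
    measurableEmbedding_mulLeft₀ (inv_ne_zero hw.ne')
  have h1 : (volume.restrict (Set.Ioi (0 : ℝ))).map (fun x => w⁻¹ * x)
      = ENNReal.ofReal w • volume.restrict (Set.Ioi 0) := by
    have h2 : (fun x : ℝ => w⁻¹ * x) ⁻¹' Set.Ioi 0 = Set.Ioi 0 := by
      ext x
      simp [hw]
    rw [← h2, ← he.restrict_map, h, Measure.restrict_smul, h2]
    congr 2
    rw [inv_inv, abs_of_pos hw]
  calc ∫⁻ x in Set.Ioi 0, K (x / w) = ∫⁻ x in Set.Ioi 0, K (w⁻¹ * x) := by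
        simp only [div_eq_inv_mul]
    _ = ∫⁻ q, K q ∂((volume.restrict (Set.Ioi (0 : ℝ))).map (fun x => w⁻¹ * x)) :=
        (he.lintegral_map _).symm
    _ = _ := by
        rw [h1, lintegral_smul_measure, smul_eq_mul, lintegral_const_mul' _ _ ENNReal.ofReal_ne_top]

/-- Competing exponential clocks: the `i`-th clock rings first, at a time of density
`w i * exp (- (∑ j, w j) q)`. -/
lemma lintegral_first_clock {M : ℕ} (w : Fin (M + 1) → ℝ) (hw : ∀ i, 0 < w i) (i : Fin (M + 1))
    (K : ℝ → ℝ≥0∞) (hK : Measurable K) :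
    ∫⁻ u, Set.indicator {u : Fin (M + 1) → ℝ | ∀ j, j ≠ i → u i / w i < u j / w j}
        (fun u => K (u i / w i)) u ∂(Measure.pi fun _ => expMeasure 1)
      = ∫⁻ q in Set.Ioi 0, ENNReal.ofReal (w i * Real.exp (-(∑ j, w j) * q)) * K q := by
  set F : ℝ × (Fin M → ℝ) → ℝ≥0∞ := Set.indicator
    {z | ∀ k, z.1 / w i < z.2 k / w (i.succAbove k)} (fun z => K (z.1 / w i)) with hF
  have hFm : Measurable F := by
    refine Measurable.indicator (by fun_prop) ?_
    rw [Set.ofPred_forall]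
    exact MeasurableSet.iInter fun k => measurableSet_lt (by fun_prop) (by fun_prop)
  have hmp := measurePreserving_piFinSuccAbove (fun _ : Fin (M + 1) => expMeasure 1) i
  have h1 : ∫⁻ u, Set.indicator {u : Fin (M + 1) → ℝ | ∀ j, j ≠ i → u i / w i < u j / w j}
        (fun u => K (u i / w i)) u ∂(Measure.pi fun _ => expMeasure 1)
      = ∫⁻ u, F (MeasurableEquiv.piFinSuccAbove (fun _ => ℝ) i u)
        ∂(Measure.pi fun _ => expMeasure 1) := by
    refine lintegral_congr fun u => ?_
    have hiff : u ∈ {u : Fin (M + 1) → ℝ | ∀ j, j ≠ i → u i / w i < u j / w j} ↔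
        MeasurableEquiv.piFinSuccAbove (fun _ => ℝ) i u ∈
          {z : ℝ × (Fin M → ℝ) | ∀ k, z.1 / w i < z.2 k / w (i.succAbove k)} := by
      constructor
      · intro h k
        exact h _ (Fin.succAbove_ne i k)
      · intro h j hj
        obtain ⟨k, rfl⟩ := Fin.exists_succAbove_eq hj
        exact h k
    by_cases hu : u ∈ {u : Fin (M + 1) → ℝ | ∀ j, j ≠ i → u i / w i < u j / w j}
    · rw [Set.indicator_of_mem hu, hF, Set.indicator_of_mem (hiff.1 hu)]
      rfl
    · rw [Set.indicator_of_notMem hu, hF, Set.indicator_of_notMem fun h => hu (hiff.2 h)]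
  rw [h1, hmp.lintegral_comp hFm, lintegral_prod _ hFm.aemeasurable,
    lintegral_expMeasure _ hFm.lintegral_prod_right']
  -- With the `i`-th clock fixed, the others must independently exceed `x / w i`; the product of
  -- their survival probabilities and the density of the `i`-th variable is a single exponential.
  have h2 : ∀ x ∈ Set.Ioi (0 : ℝ), ENNReal.ofReal (Real.exp (-x)) *
      ∫⁻ r, F (x, r) ∂(Measure.pi fun _ : Fin M => expMeasure 1)
      = ENNReal.ofReal (Real.exp (-(∑ j, w j) * (x / w i))) * K (x / w i) := by
    intro x hx
    have hx0 : 0 < x := hx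
    have h3 : ∀ r : Fin M → ℝ, F (x, r) = Set.indicator
        (Set.univ.pi fun k => Set.Ioi (w (i.succAbove k) * (x / w i)))
        (fun _ => K (x / w i)) r := by
      intro r
      have hiff : (x, r) ∈ {z : ℝ × (Fin M → ℝ) | ∀ k, z.1 / w i < z.2 k / w (i.succAbove k)} ↔
          r ∈ Set.univ.pi fun k => Set.Ioi (w (i.succAbove k) * (x / w i)) := by
        simp only [Set.mem_ofPred_eq, Set.mem_pi, Set.mem_univ, true_imp_iff, Set.mem_Ioi]
        exact forall_congr' fun k => by rw [lt_div_iff₀ (hw _), mul_comm]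
      by_cases hr : r ∈ Set.univ.pi fun k => Set.Ioi (w (i.succAbove k) * (x / w i))
      · rw [Set.indicator_of_mem hr, hF, Set.indicator_of_mem (hiff.2 hr)]
      · rw [Set.indicator_of_notMem hr, hF, Set.indicator_of_notMem fun h => hr (hiff.1 h)]
    simp only [h3]
    rw [lintegral_indicator (MeasurableSet.univ_pi fun _ => measurableSet_Ioi), setLIntegral_const,
      Measure.pi_pi]
    have h4 : ∀ k, expMeasure 1 (Set.Ioi (w (i.succAbove k) * (x / w i)))
        = ENNReal.ofReal (Real.exp (-(w (i.succAbove k) * (x / w i)))) := fun k =>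
      expMeasure_Ioi (mul_nonneg (hw _).le (div_nonneg hx0.le (hw _).le))
    simp only [h4]
    rw [← ENNReal.ofReal_prod_of_nonneg fun k _ => (Real.exp_pos _).le, ← Real.exp_sum,
      mul_comm (K _), ← mul_assoc, ← ENNReal.ofReal_mul (Real.exp_pos _).le, ← Real.exp_add]
    congr 3
    rw [Fin.sum_univ_succAbove w i, Finset.sum_neg_distrib, ← Finset.sum_mul]
    have := (hw i).ne'
    field_simp
    ring
  rw [setLIntegral_congr_fun measurableSet_Ioi h2,
    lintegral_Ioi_div (hw i) fun q => ENNReal.ofReal (Real.exp (-(∑ j, w j) * q)) * K q]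
  refine lintegral_congr fun q => ?_
  rw [← mul_assoc, ← ENNReal.ofReal_mul (hw i).le]

/-- The conductances of the walk. -/
def cond (a : ℝ) (E : V N → ℝ) (y : V N) (i : Fin N) : ℝ := rate a E y (y + unit i)

lemma cond_pos (a : ℝ) (E : V N → ℝ) (y : V N) (i : Fin N) : 0 < cond a E y i := Real.exp_pos _

lemma cond_symm (a : ℝ) (E : V N → ℝ) : Symm (cond a E) := fun y i => by
  rw [cond, cond, add_unit_add_unit, rate, rate, add_comm (E _)]

lemma one_le_cond {a : ℝ} (ha : 0 ≤ a) {E : V N → ℝ} (hE : ∀ x, 0 ≤ E x) (y : V N) (i : Fin N) :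
    1 ≤ cond a E y i := Real.one_le_exp (mul_nonneg ha (add_nonneg (hE _) (hE _)))

lemma step_of_strict (a : ℝ) (E : V N → ℝ) (p : V N × ℝ) (u : Fin N → ℝ) (i : Fin N)
    (h : ∀ j, j ≠ i → clock a E p.1 u i < clock a E p.1 u j) :
    step a E p u = (p.1 + unit i, p.2 + clock a E p.1 u i) := by
  have h1 : (List.finRange N).argmin (clock a E p.1 u) = some i := by
    rcases hm : (List.finRange N).argmin (clock a E p.1 u) with _ | j
    · rw [List.argmin_eq_none] at hm
      exact absurd (List.mem_finRange i) (by rw [hm]; simp)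
    · have h2 : clock a E p.1 u j ≤ clock a E p.1 u i :=
        List.le_of_mem_argmin (List.mem_finRange i) hm
      by_contra hne
      exact absurd h2 (not_le.2 (h j fun e => hne (by rw [e])))
  rw [step, h1]

lemma exists_step_eq (hN : 1 ≤ N) (a : ℝ) (E : V N → ℝ) (p : V N × ℝ) (u : Fin N → ℝ) :
    ∃ i, step a E p u = (p.1 + unit i, p.2 + clock a E p.1 u i) := by
  rcases hm : (List.finRange N).argmin (clock a E p.1 u) with _ | j
  · rw [List.argmin_eq_none] at hm
    exact absurd (List.mem_finRange (⟨0, hN⟩ : Fin N)) (by rw [hm]; simp)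
  · exact ⟨j, by rw [step, hm]⟩

lemma measurable_clock (a : ℝ) (y : V N) (i : Fin N) :
    Measurable fun q : (V N → ℝ) × (Fin N → ℝ) => clock a q.1 y q.2 i := by
  unfold clock rate
  fun_prop

/-- `List.argmin` breaks ties by position in the list, so the event is a finite combination of
comparisons of clocks. -/
lemma measurableSet_argmin_clock (a : ℝ) (y : V N) (o : Option (Fin N)) :
    MeasurableSet {q : (V N → ℝ) × (Fin N → ℝ) |
      (List.finRange N).argmin (clock a q.1 y q.2) = o} := by
  rcases o with _ | i
  · simp only [List.argmin_eq_none]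
    exact MeasurableSet.const _
  · simp only [List.argmin_eq_some_iff]
    rw [Set.ofPred_and, Set.ofPred_and]
    refine (MeasurableSet.const _).inter (MeasurableSet.inter ?_ ?_)
    · have : ∀ j : Fin N, MeasurableSet {q : (V N → ℝ) × (Fin N → ℝ) |
          j ∈ List.finRange N → clock a q.1 y q.2 i ≤ clock a q.1 y q.2 j} := fun j =>
        (MeasurableSet.const _).imp
          (measurableSet_le (measurable_clock a y i) (measurable_clock a y j))
      rw [Set.ofPred_forall]
      exact MeasurableSet.iInter this
    · have : ∀ j : Fin N, MeasurableSet {q : (V N → ℝ) × (Fin N → ℝ) |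
          j ∈ List.finRange N → clock a q.1 y q.2 j ≤ clock a q.1 y q.2 i →
            List.idxOf i (List.finRange N) ≤ List.idxOf j (List.finRange N)} := fun j =>
        (MeasurableSet.const _).imp ((measurableSet_le (measurable_clock a y j)
          (measurable_clock a y i)).imp (MeasurableSet.const _))
      rw [Set.ofPred_forall]
      exact MeasurableSet.iInter this

/-- `step` branches on a discrete choice; on each of the finitely many pieces with given position
and winning direction it is an explicit measurable map. -/
lemma measurable_step (a : ℝ) :
    Measurable fun q : (V N → ℝ) × (V N × ℝ) × (Fin N → ℝ) => step a q.1 q.2.1 q.2.2 := by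
  let g : V N → Option (Fin N) → (V N → ℝ) × (V N × ℝ) × (Fin N → ℝ) → V N × ℝ := fun y o q =>
    match o with
    | none => (y, q.2.1.2 + 1)
    | some i => (y + unit i, q.2.1.2 + clock a q.1 y q.2.2 i)
  have hg : ∀ y o, Measurable (g y o) := by
    intro y o
    rcases o with _ | i
    · exact measurable_const.prodMk (by fun_prop)
    · refine measurable_const.prodMk (Measurable.add (by fun_prop) ?_)
      exact (measurable_clock a y i).comp
        (measurable_fst.prodMk (measurable_snd.comp measurable_snd))
  intro S hS
  have : (fun q : (V N → ℝ) × (V N × ℝ) × (Fin N → ℝ) => step a q.1 q.2.1 q.2.2) ⁻¹' S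
      = ⋃ y : V N, ⋃ o : Option (Fin N), {q | q.2.1.1 = y} ∩
        ((fun q => (q.1, q.2.2)) ⁻¹' {q : (V N → ℝ) × (Fin N → ℝ) |
          (List.finRange N).argmin (clock a q.1 y q.2) = o} ∩ g y o ⁻¹' S) := by
    have key : ∀ q : (V N → ℝ) × (V N × ℝ) × (Fin N → ℝ), step a q.1 q.2.1 q.2.2
        = g q.2.1.1 ((List.finRange N).argmin (clock a q.1 q.2.1.1 q.2.2)) q := fun q => by
      unfold step g
      rcases (List.finRange N).argmin (clock a q.1 q.2.1.1 q.2.2) with _ | i <;> rfl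
    ext q
    simp only [Set.mem_preimage, Set.mem_iUnion, Set.mem_inter_iff, key]
    constructor
    · intro h
      exact ⟨q.2.1.1, _, rfl, rfl, h⟩
    · rintro ⟨y, o, h1, h2, h3⟩
      have h1' : q.2.1.1 = y := h1
      subst h1'
      have h2' : (List.finRange N).argmin (clock a q.1 q.2.1.1 q.2.2) = o := h2
      rw [h2']
      exact h3
  rw [this]
  refine MeasurableSet.iUnion fun y => MeasurableSet.iUnion fun o => MeasurableSet.inter ?_
    (MeasurableSet.inter ?_ (hg y o hS))
  · exact (measurable_fst.comp (measurable_fst.comp measurable_snd)) (measurableSet_singleton y)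
  · exact (measurable_fst.prodMk (measurable_snd.comp measurable_snd))
      (measurableSet_argmin_clock a y o)

lemma measurable_step_right (a : ℝ) (E : V N → ℝ) (p : V N × ℝ) :
    Measurable (step a E p) :=
  (measurable_step a).comp (measurable_const.prodMk (measurable_const.prodMk measurable_id))

/-- The events that clock `i` wins strictly are disjoint, and their probabilities `w i / ∑ w` add up
to `1`. Ties therefore have probability zero, and each event is treated by `lintegral_first_clock`.
-/
theorem lintegral_step (hN : 1 ≤ N) (a : ℝ) (E : V N → ℝ) (p : V N × ℝ) (H : V N × ℝ → ℝ≥0∞)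
    (hH : Measurable H) :
    ∫⁻ u, H (step a E p u) ∂(Measure.pi fun _ => expMeasure 1)
      = ∑ i, ∫⁻ q in Set.Ioi 0,
        ENNReal.ofReal (cond a E p.1 i * Real.exp (-(∑ j, cond a E p.1 j) * q)) *
          H (p.1 + unit i, p.2 + q) := by
  obtain ⟨M, rfl⟩ : ∃ M, N = M + 1 := ⟨N - 1, by omega⟩
  set w := cond a E p.1 with hw
  have hw0 : ∀ i, 0 < w i := fun i => cond_pos _ _ _ _
  set A : Fin (M + 1) → Set (Fin (M + 1) → ℝ) := fun i =>
    {u | ∀ j, j ≠ i → u i / w i < u j / w j} with hA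
  have hAm : ∀ i, MeasurableSet (A i) := fun i => by
    have : A i = ⋂ j, ⋂ (_ : j ≠ i), {u | u i / w i < u j / w j} := by
      ext u; simp [hA]
    rw [this]
    exact MeasurableSet.iInter fun j => MeasurableSet.iInter fun _ =>
      measurableSet_lt (by fun_prop) (by fun_prop)
  have hdisj : Pairwise (Function.onFun Disjoint A) := fun i j hij =>
    Set.disjoint_left.2 fun u hi hj => lt_asymm (hi j hij.symm) (hj i hij)
  have hr : 0 < ∑ j, w j := Finset.sum_pos (fun j _ => hw0 j) Finset.univ_nonempty
  set ν : Measure (Fin (M + 1) → ℝ) := Measure.pi fun _ => expMeasure 1 with hν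
  have hmeas : ∀ i, ν (A i) = ENNReal.ofReal (w i / ∑ j, w j) := fun i => by
    have := lintegral_first_clock w hw0 i (fun _ => 1) measurable_const
    rw [lintegral_indicator (hAm i)] at this
    simp only [lintegral_const, Measure.restrict_apply MeasurableSet.univ, Set.univ_inter, one_mul,
      mul_one] at this
    rw [this, ← ofReal_integral_eq_lintegral_ofReal]
    · rw [integral_const_mul, integral_exp_mul_Ioi (neg_neg_of_pos hr)]
      congr 1
      rw [mul_zero, Real.exp_zero, neg_div_neg_eq, mul_one_div]
    · exact (integrableOn_exp_mul_Ioi (neg_neg_of_pos hr) 0).const_mul _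
    · exact Eventually.of_forall fun q => mul_nonneg (hw0 i).le (Real.exp_pos _).le
  have hfull : ν (⋃ i, A i)ᶜ = 0 := by
    rw [prob_compl_eq_zero_iff (MeasurableSet.iUnion hAm), measure_iUnion hdisj hAm, tsum_fintype]
    simp only [hmeas]
    rw [← ENNReal.ofReal_sum_of_nonneg fun i _ => (div_pos (hw0 i) hr).le, ← Finset.sum_div,
      div_self hr.ne', ENNReal.ofReal_one]
  have hae : ∀ᵐ u ∂ν, H (step a E p u) = ∑ i, (A i).indicator
      (fun u => H (p.1 + unit i, p.2 + u i / w i)) u := by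
    filter_upwards [compl_mem_ae_iff.2 hfull] with u hu
    rw [Set.mem_compl_iff, Set.mem_compl_iff, not_not] at hu
    obtain ⟨i, hi⟩ := Set.mem_iUnion.1 hu
    rw [Finset.sum_eq_single i, Set.indicator_of_mem hi, step_of_strict a E p u i hi]
    · rfl
    · intro j _ hj
      exact Set.indicator_of_notMem (fun h => (Set.disjoint_left.1 (hdisj hj)) h hi) _
    · simp
  rw [lintegral_congr_ae hae, lintegral_finsetSum]
  · exact Finset.sum_congr rfl fun i _ => lintegral_first_clock w hw0 i
      (fun q => H (p.1 + unit i, p.2 + q)) (by fun_prop)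
  · exact fun i _ => Measurable.indicator (by fun_prop) (hAm i)

/-- The law of the position and the time of arrival after one jump. -/
def stepLaw (a : ℝ) (E : V N → ℝ) (p : V N × ℝ) : Measure (V N × ℝ) :=
  ∑ i, ((volume.restrict (Set.Ioi 0)).withDensity fun q =>
    ENNReal.ofReal (cond a E p.1 i * Real.exp (-(∑ j, cond a E p.1 j) * q))).map
      fun q => (p.1 + unit i, p.2 + q)

lemma map_step (hN : 1 ≤ N) (a : ℝ) (E : V N → ℝ) (p : V N × ℝ) :
    (Measure.pi fun _ => expMeasure 1).map (step a E p) = stepLaw a E p := by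
  ext S hS
  have hd : ∀ i, Measurable fun q : ℝ =>
    ENNReal.ofReal (cond a E p.1 i * Real.exp (-(∑ j, cond a E p.1 j) * q)) := fun i => by fun_prop
  have hm : ∀ i, Measurable fun q : ℝ => (p.1 + unit i, p.2 + q) := fun i => by fun_prop
  have h := lintegral_step hN a E p (S.indicator 1) (measurable_one.indicator hS)
  rw [← lintegral_map (measurable_one.indicator hS) (measurable_step_right a E p),
    lintegral_indicator_one hS] at h
  rw [h, stepLaw, Measure.finsetSum_apply]
  refine Finset.sum_congr rfl fun i _ => ?_
  rw [← lintegral_indicator_one hS, lintegral_map (measurable_one.indicator hS) (hm i)]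
  exact (lintegral_withDensity_eq_lintegral_mul _ (hd i)
    ((measurable_one.indicator hS).comp (hm i))).symm

theorem integral_step (hN : 1 ≤ N) (a : ℝ) (E : V N → ℝ) (p : V N × ℝ) (H : V N × ℝ → ℝ)
    (hH : Measurable H) {C : ℝ} (hC : ∀ z, |H z| ≤ C) :
    ∫ u, H (step a E p u) ∂(Measure.pi fun _ => expMeasure 1)
      = ∑ i, ∫ q in Set.Ioi 0,
        cond a E p.1 i * Real.exp (-(∑ j, cond a E p.1 j) * q) * H (p.1 + unit i, p.2 + q) := by
  have hm : ∀ i, Measurable fun q : ℝ => (p.1 + unit i, p.2 + q) := fun i => by fun_prop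
  have hp : IsProbabilityMeasure (stepLaw a E p) := by
    rw [← map_step hN]
    exact Measure.isProbabilityMeasure_map (measurable_step_right a E p).aemeasurable
  have hInt : Integrable H (stepLaw a E p) :=
    Integrable.of_bound hH.aestronglyMeasurable C (Eventually.of_forall hC)
  rw [← integral_map (measurable_step_right a E p).aemeasurable hH.aestronglyMeasurable,
    map_step hN, stepLaw, integral_finsetSum_measure]
  · refine Finset.sum_congr rfl fun i _ => ?_
    rw [integral_map (hm i).aemeasurable hH.aestronglyMeasurable,
      integral_withDensity_eq_integral_toReal_smul (by fun_prop)
        (Eventually.of_forall fun _ => ENNReal.ofReal_lt_top)]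
    refine integral_congr_ae (Eventually.of_forall fun q => ?_)
    simp only [smul_eq_mul]
    rw [ENNReal.toReal_ofReal (mul_nonneg (cond_pos _ _ _ _).le (Real.exp_pos _).le)]
  · intro i _
    refine hInt.mono_measure ?_
    rw [stepLaw]
    exact Finset.single_le_sum (f := fun i => ((volume.restrict (Set.Ioi 0)).withDensity fun q =>
      ENNReal.ofReal (cond a E p.1 i * Real.exp (-(∑ j, cond a E p.1 j) * q))).map
      fun q => (p.1 + unit i, p.2 + q)) (fun _ _ => Measure.zero_le _) (Finset.mem_univ i)

/-! ### The jump chain -/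

lemma measurable_jumps (a : ℝ) (n : ℕ) :
    Measurable fun ω : Sample N => jumps a ω.1 ω.2.1 ω.2.2 n := by
  induction n with
  | zero => exact (measurable_fst.comp measurable_snd).prodMk measurable_const
  | succ n ih =>
    have : Measurable fun ω : Sample N => (ω.1, jumps a ω.1 ω.2.1 ω.2.2 n, ω.2.2 n) :=
      measurable_fst.prodMk (ih.prodMk
        ((measurable_pi_apply n).comp (measurable_snd.comp measurable_snd)))
    exact (measurable_step a).comp this

lemma measurable_jumps_right (a : ℝ) (E : V N → ℝ) (z : V N) (n : ℕ) :
    Measurable fun ξ => jumps a E z ξ n :=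
  (measurable_jumps a n).comp (measurable_const.prodMk (measurable_const.prodMk measurable_id))

/-- Adaptedness: the state after `n` jumps ignores row `n` of the clocks, which can then be
resampled to obtain the Markov property. -/
lemma jumps_congr (a : ℝ) (E : V N → ℝ) (z : V N) {ξ ξ' : ℕ → Fin N → ℝ} {n : ℕ}
    (h : ∀ k < n, ξ k = ξ' k) : jumps a E z ξ n = jumps a E z ξ' n := by
  induction n with
  | zero => rfl
  | succ n ih =>
    simp only [jumps]
    rw [ih fun k hk => h k (hk.trans (Nat.lt_succ_self n)), h n (Nat.lt_succ_self n)]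

instance : IsProbabilityMeasure (noise N) := by unfold noise; infer_instance

/-- Resampling one of the coordinates of a product measure. -/
lemma measurePreserving_update_infinitePi {ι Ω : Type*} [DecidableEq ι] [MeasurableSpace Ω]
    (μ : Measure Ω) [IsProbabilityMeasure μ] (n : ι) :
    MeasurePreserving (fun p : (ι → Ω) × Ω => Function.update p.1 n p.2)
      ((Measure.infinitePi fun _ => μ).prod μ) (Measure.infinitePi fun _ => μ) := by
  have hm : Measurable fun p : (ι → Ω) × Ω => Function.update p.1 n p.2 := by
    rw [measurable_pi_iff]
    intro k
    by_cases hk : k = n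
    · subst hk
      simpa using measurable_snd
    · simp only [Function.update_of_ne hk]
      exact (measurable_pi_apply k).comp measurable_fst
  refine ⟨hm, ?_⟩
  refine Measure.eq_infinitePi _ fun s t ht => ?_
  rw [Measure.map_apply hm (MeasurableSet.pi s.countable_toSet fun i _ => ht i)]
  have hpre : (fun p : (ι → Ω) × Ω => Function.update p.1 n p.2) ⁻¹'
      (Set.pi s t) = (Set.pi (s.erase n) t) ×ˢ (if n ∈ s then t n else Set.univ) := by
    ext p
    simp only [Set.mem_preimage, Set.mem_pi, Set.mem_prod, Finset.mem_coe, Finset.mem_erase]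
    constructor
    · intro h
      refine ⟨fun k hk => ?_, ?_⟩
      · have := h k hk.2
        rwa [Function.update_of_ne hk.1] at this
      · split_ifs with hn
        · have := h n hn
          rwa [Function.update_self] at this
        · trivial
    · rintro ⟨h1, h2⟩ k hk
      by_cases hkn : k = n
      · subst hkn
        rw [if_pos hk] at h2
        rwa [Function.update_self]
      · rw [Function.update_of_ne hkn]
        exact h1 k ⟨hkn, hk⟩
  rw [hpre, Measure.prod_prod, Measure.infinitePi_pi _ fun i _ => ht i]
  split_ifs with hn
  · rw [mul_comm, Finset.mul_prod_erase s (fun i => μ (t i)) hn]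
  · rw [measure_univ, mul_one, Finset.erase_eq_of_notMem hn]

lemma measurePreserving_update_noise (n : ℕ) :
    MeasurePreserving (fun p : (ℕ → Fin N → ℝ) × (Fin N → ℝ) => Function.update p.1 n p.2)
      ((noise N).prod (Measure.pi fun _ => expMeasure 1)) (noise N) :=
  measurePreserving_update_infinitePi _ n

lemma lintegral_jumps_succ (a : ℝ) (E : V N → ℝ) (z : V N) (n : ℕ) (H : V N × ℝ → ℝ≥0∞)
    (hH : Measurable H) :
    ∫⁻ ξ, H (jumps a E z ξ (n + 1)) ∂noise N
      = ∫⁻ ξ, ∫⁻ u, H (step a E (jumps a E z ξ n) u) ∂(Measure.pi fun _ => expMeasure 1)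
        ∂noise N := by
  have hm : Measurable fun ξ => H (jumps a E z ξ (n + 1)) :=
    hH.comp (measurable_jumps_right a E z (n + 1))
  have hmp := measurePreserving_update_noise (N := N) n
  rw [← hmp.lintegral_comp hm]
  refine (lintegral_prod _ (hm.comp hmp.measurable).aemeasurable).trans ?_
  refine lintegral_congr fun ξ => lintegral_congr fun u => ?_
  simp only [Function.comp_apply, jumps]
  rw [Function.update_self, jumps_congr a E z (ξ' := ξ) fun k hk => Function.update_of_ne hk.ne _ _]

/-- The Markov property. -/
lemma integral_mul_jumps_succ (a : ℝ) (E : V N → ℝ) (z : V N) (n : ℕ)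
    (F : (ℕ → Fin N → ℝ) → ℝ) (hF : Measurable F)
    (hdep : ∀ ξ ξ', (∀ k < n, ξ k = ξ' k) → F ξ = F ξ') {B : ℝ} (hB : ∀ ξ, |F ξ| ≤ B)
    (H : V N × ℝ → ℝ) (hH : Measurable H) {C : ℝ} (hC : ∀ p, |H p| ≤ C) :
    ∫ ξ, F ξ * H (jumps a E z ξ (n + 1)) ∂noise N
      = ∫ ξ, F ξ * ∫ u, H (step a E (jumps a E z ξ n) u) ∂(Measure.pi fun _ => expMeasure 1)
        ∂noise N := by
  have hm : Measurable fun ξ => F ξ * H (jumps a E z ξ (n + 1)) :=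
    hF.mul (hH.comp (measurable_jumps_right a E z (n + 1)))
  have hmp := measurePreserving_update_noise (N := N) n
  conv_lhs => rw [← hmp.map_eq]
  rw [integral_map hmp.measurable.aemeasurable hm.aestronglyMeasurable, integral_prod]
  · refine integral_congr_ae (Eventually.of_forall fun ξ => ?_)
    simp only
    rw [← integral_const_mul]
    refine integral_congr_ae (Eventually.of_forall fun u => ?_)
    simp only [jumps]
    rw [Function.update_self,
      jumps_congr a E z (ξ' := ξ) fun k hk => Function.update_of_ne hk.ne _ _,
      hdep _ ξ fun k hk => Function.update_of_ne hk.ne _ _]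
  · refine Integrable.of_bound (hm.comp hmp.measurable).aestronglyMeasurable (B * C)
      (Eventually.of_forall fun p => ?_)
    rw [Real.norm_eq_abs, abs_mul]
    exact mul_le_mul (hB _) (hC _) (abs_nonneg _) ((abs_nonneg _).trans (hB fun _ _ => 0))

lemma ae_noise_pos : ∀ᵐ ξ ∂noise N, ∀ n i, 0 < ξ n i := by
  rw [ae_all_iff]
  intro n
  have h0 : ∀ᵐ x ∂expMeasure 1, 0 < x := by
    have := expMeasure_Ioi le_rfl
    rw [neg_zero, Real.exp_zero, ENNReal.ofReal_one] at this
    exact (prob_compl_eq_zero_iff measurableSet_Ioi).2 this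
  have h1 : ∀ᵐ u ∂(Measure.pi fun _ : Fin N => expMeasure 1), ∀ i, 0 < u i := by
    rw [ae_all_iff]
    intro i
    exact (Measure.quasiMeasurePreserving_eval (fun _ : Fin N => expMeasure 1) i).ae h0
  have h2 : (noise N).map (fun ξ => ξ n) = Measure.pi fun _ : Fin N => expMeasure 1 :=
    Measure.infinitePi_map_eval _ n
  rw [← h2] at h1
  exact ae_of_ae_map (measurable_pi_apply n).aemeasurable h1

/-! ### Regularity of trajectories -/

section path

variable (a : ℝ) (E : V N → ℝ) (z : V N)

lemma jumps_lt_of_pos (hN : 1 ≤ N) (a : ℝ) (E : V N → ℝ) (z : V N)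
    {ξ : ℕ → Fin N → ℝ} (hξ : ∀ n i, 0 < ξ n i) (n : ℕ) :
    (jumps a E z ξ n).2 < (jumps a E z ξ (n + 1)).2 := by
  obtain ⟨i, hi⟩ := exists_step_eq hN a E (jumps a E z ξ n) (ξ n)
  have : (jumps a E z ξ (n + 1)).2
      = (jumps a E z ξ n).2 + clock a E (jumps a E z ξ n).1 (ξ n) i := by
    simp only [jumps]
    rw [hi]
  rw [this]
  exact lt_add_of_pos_right _ (div_pos (hξ n i) (Real.exp_pos _))

lemma setLIntegral_exp {c r T : ℝ} (hr : 0 < r) (hc : 0 ≤ c) :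
    ∫⁻ q in Set.Ioi 0, ENNReal.ofReal (c * Real.exp (-r * q)) *
      ENNReal.ofReal (Real.exp (-(T + q)))
      = ENNReal.ofReal (c / (1 + r)) * ENNReal.ofReal (Real.exp (-T)) := by
  have hr1 : -(1 + r) < 0 := by linarith
  have h1 : ∀ q : ℝ, ENNReal.ofReal (c * Real.exp (-r * q)) * ENNReal.ofReal (Real.exp (-(T + q)))
      = ENNReal.ofReal (c * Real.exp (-T) * Real.exp (-(1 + r) * q)) := fun q => by
    rw [← ENNReal.ofReal_mul (mul_nonneg hc (Real.exp_pos _).le)]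
    congr 1
    rw [mul_assoc, mul_assoc, ← Real.exp_add, ← Real.exp_add]
    congr 2; ring
  simp only [h1]
  rw [← ofReal_integral_eq_lintegral_ofReal ((integrableOn_exp_mul_Ioi hr1 0).const_mul _)
    (Eventually.of_forall fun q => by positivity), integral_const_mul, integral_exp_mul_Ioi hr1,
    ← ENNReal.ofReal_mul (by positivity)]
  congr 1
  rw [mul_zero, Real.exp_zero, neg_div_neg_eq]
  ring

lemma sum_cond_pos (hN : 1 ≤ N) (a : ℝ) (E : V N → ℝ) (y : V N) : 0 < ∑ j, cond a E y j :=
  Finset.sum_pos (fun _ _ => cond_pos _ _ _ _) ⟨⟨0, hN⟩, Finset.mem_univ _⟩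

/-- There are finitely many jumps in finite time. -/
lemma ae_tendsto_jumps (hN : 1 ≤ N) (a : ℝ) (E : V N → ℝ) (z : V N) :
    ∀ᵐ ξ ∂noise N, Tendsto (fun n => (jumps a E z ξ n).2) atTop atTop := by
  set R : ℝ := ∑ y, ∑ j, cond a E y j with hR
  have hr : ∀ y, ∑ j, cond a E y j ≤ R := fun y =>
    Finset.single_le_sum (f := fun y => ∑ j, cond a E y j)
      (fun y _ => (sum_cond_pos hN a E y).le) (Finset.mem_univ y)
  have hR0 : 0 < R := (sum_cond_pos hN a E 0).trans_le (hr 0)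
  -- All jump rates are bounded by the sum `R` over the finite cube, so a jump multiplies the
  -- expectation of `exp (-time)` by at most `R / (1 + R) < 1`. Summability of these expectations
  -- forces the times to infinity.
  set ρ : ℝ≥0∞ := ENNReal.ofReal (R / (1 + R)) with hρ
  have hρ1 : ρ < 1 := by
    rw [hρ, ← ENNReal.ofReal_one, ENNReal.ofReal_lt_ofReal_iff one_pos, div_lt_one (by linarith)]
    linarith
  have hHm : Measurable fun p : V N × ℝ => ENNReal.ofReal (Real.exp (-p.2)) := by fun_prop
  have hstep : ∀ p : V N × ℝ,
      ∫⁻ u, ENNReal.ofReal (Real.exp (-(step a E p u).2)) ∂(Measure.pi fun _ => expMeasure 1)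
        ≤ ρ * ENNReal.ofReal (Real.exp (-p.2)) := fun p => by
    rw [lintegral_step hN a E p (fun p => ENNReal.ofReal (Real.exp (-p.2))) hHm]
    simp only [setLIntegral_exp (sum_cond_pos hN a E p.1) (cond_pos a E p.1 _).le]
    rw [← Finset.sum_mul, ← ENNReal.ofReal_sum_of_nonneg, ← Finset.sum_div]
    · refine mul_le_mul_left (ENNReal.ofReal_le_ofReal ?_) _
      have := hr p.1
      have h0 := sum_cond_pos hN a E p.1
      rw [div_le_div_iff₀ (by linarith) (by linarith)]
      nlinarith
    · intro i _
      exact div_nonneg (cond_pos _ _ _ _).le (by have := sum_cond_pos hN a E p.1; linarith)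
  have hI : ∀ n, ∫⁻ ξ, ENNReal.ofReal (Real.exp (-(jumps a E z ξ n).2)) ∂noise N ≤ ρ ^ n := by
    intro n
    induction n with
    | zero => simp [jumps]
    | succ n ih =>
      rw [lintegral_jumps_succ a E z n (fun p => ENNReal.ofReal (Real.exp (-p.2))) hHm]
      calc _ ≤ ∫⁻ ξ, ρ * ENNReal.ofReal (Real.exp (-(jumps a E z ξ n).2)) ∂noise N :=
            lintegral_mono fun ξ => hstep _
        _ = ρ * ∫⁻ ξ, ENNReal.ofReal (Real.exp (-(jumps a E z ξ n).2)) ∂noise N :=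
            lintegral_const_mul' _ _ ENNReal.ofReal_ne_top
        _ ≤ ρ * ρ ^ n := mul_le_mul_right ih _
        _ = ρ ^ (n + 1) := by rw [pow_succ, mul_comm]
  have hmeas : ∀ n, Measurable fun ξ => ENNReal.ofReal (Real.exp (-(jumps a E z ξ n).2)) :=
    fun n => hHm.comp (measurable_jumps_right a E z n)
  have hsum : ∫⁻ ξ, ∑' n, ENNReal.ofReal (Real.exp (-(jumps a E z ξ n).2)) ∂noise N ≠ ∞ := by
    rw [lintegral_tsum fun n => (hmeas n).aemeasurable]
    refine ne_top_of_le_ne_top ?_ (ENNReal.tsum_le_tsum hI)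
    rw [ENNReal.tsum_geometric]
    exact ENNReal.inv_ne_top.2 (tsub_pos_of_lt hρ1).ne'
  filter_upwards [ae_lt_top (Measurable.tsum hmeas) hsum] with ξ hξ
  have h1 := ENNReal.tendsto_atTop_zero_of_tsum_ne_top hξ.ne
  have h2 : Tendsto (fun n => Real.exp (-(jumps a E z ξ n).2)) atTop (𝓝 0) := by
    have := (ENNReal.tendsto_toReal ENNReal.zero_ne_top).comp h1
    refine this.congr fun n => ?_
    exact ENNReal.toReal_ofReal (Real.exp_pos _).le
  have h3 := Real.tendsto_exp_comp_nhds_zero.1 h2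
  exact (tendsto_neg_atBot_atTop.comp h3).congr fun n => neg_neg _

/-- The jump times increase strictly to infinity. -/
def Regular (ξ : ℕ → Fin N → ℝ) : Prop :=
  StrictMono (fun n => (jumps a E z ξ n).2) ∧ Tendsto (fun n => (jumps a E z ξ n).2) atTop atTop

lemma ae_regular (hN : 1 ≤ N) (a : ℝ) (E : V N → ℝ) (z : V N) :
    ∀ᵐ ξ ∂noise N, Regular a E z ξ := by
  filter_upwards [ae_noise_pos, ae_tendsto_jumps hN a E z] with ξ h1 h2
  exact ⟨strictMono_nat_of_lt_succ fun n => jumps_lt_of_pos hN a E z h1 n, h2⟩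

variable {a E z}

lemma Regular.nonneg {ξ : ℕ → Fin N → ℝ} (h : Regular a E z ξ) (n : ℕ) :
    0 ≤ (jumps a E z ξ n).2 := h.1.monotone (Nat.zero_le n)

/-- Regularity makes the set in `walk` an initial segment of `ℕ`, so its `sSup` is a genuine maximum
and not a default value. -/
lemma Regular.walk_eq {ξ : ℕ → Fin N → ℝ} (h : Regular a E z ξ) {n : ℕ} {t : ℝ}
    (h1 : (jumps a E z ξ n).2 ≤ t) (h2 : t < (jumps a E z ξ (n + 1)).2) :
    walk a E z ξ t = (jumps a E z ξ n).1 := by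
  have hset : {m : ℕ | (jumps a E z ξ m).2 ≤ t} = Set.Iic n := by
    ext m
    simp only [Set.mem_ofPred_eq, Set.mem_Iic]
    constructor
    · intro hm
      by_contra hcon
      exact absurd (h.1.monotone (Nat.succ_le_of_lt (not_le.1 hcon))) (not_le.2 (hm.trans_lt h2))
    · intro hm
      exact (h.1.monotone hm).trans h1
  rw [walk, hset, csSup_Iic]

lemma Regular.exists_index {ξ : ℕ → Fin N → ℝ} (h : Regular a E z ξ) {t : ℝ} (ht : 0 ≤ t) :
    ∃ n, (jumps a E z ξ n).2 ≤ t ∧ t < (jumps a E z ξ (n + 1)).2 := by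
  have hex : ∃ n, t < (jumps a E z ξ n).2 := (h.2.eventually_gt_atTop t).exists
  classical
  have h1 := Nat.find_spec hex
  rcases hn : Nat.find hex with _ | m
  · rw [hn] at h1
    exact absurd h1 (not_lt.2 ht)
  · rw [hn] at h1
    exact ⟨m, not_lt.1 (Nat.find_min hex (by omega)), h1⟩

lemma Regular.exists_walk_iff {ξ : ℕ → Fin N → ℝ} (h : Regular a E z ξ) (P : V N → Prop) (t : ℝ) :
    (∃ s, 0 ≤ s ∧ s ≤ t ∧ P (walk a E z ξ s)) ↔
      ∃ n, (jumps a E z ξ n).2 ≤ t ∧ P (jumps a E z ξ n).1 := by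
  constructor
  · rintro ⟨s, h0, h1, h2⟩
    obtain ⟨n, hn1, hn2⟩ := h.exists_index h0
    rw [h.walk_eq hn1 hn2] at h2
    exact ⟨n, hn1.trans h1, h2⟩
  · rintro ⟨n, h1, h2⟩
    refine ⟨(jumps a E z ξ n).2, h.nonneg n, h1, ?_⟩
    rwa [h.walk_eq le_rfl (h.1 (Nat.lt_succ_self n))]

end path

/-! ### Hitting times -/

/-- The renewal equation at the first jump. -/
lemma renewal {c : V N → Fin N → ℝ} {A : Finset (V N)} {v : ℝ → V N → ℝ}
    (hv : ∀ s, ∀ y ∉ A, HasDerivAt (fun s => v s y) (gen c (v s) y) s)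
    (hcont : ∀ y, Continuous fun s => v s y) (hv0 : ∀ y ∉ A, v 0 y = 1) {y : V N} (hy : y ∉ A)
    (hr : 0 < ∑ j, c y j) {σ : ℝ} (hσ : 0 ≤ σ) :
    ∑ i, ∫ q in Set.Ioi 0, c y i * Real.exp (-(∑ j, c y j) * q) *
      (if σ < q then 1 else v (σ - q) (y + unit i)) = v σ y := by
  set r := ∑ j, c y j with hrdef
  -- When the first jump comes after `σ` the walk has survived; this part integrates to an explicit
  -- exponential.
  have hsplit : ∀ i, ∫ q in Set.Ioi 0, c y i * Real.exp (-r * q) *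
      (if σ < q then 1 else v (σ - q) (y + unit i))
      = (∫ q in (0 : ℝ)..σ, c y i * Real.exp (-r * q) * v (σ - q) (y + unit i))
        + c y i / r * Real.exp (-r * σ) := by
    intro i
    have hc1 : Continuous fun q => c y i * Real.exp (-r * q) * v (σ - q) (y + unit i) :=
      (by fun_prop : Continuous fun q => c y i * Real.exp (-r * q)).mul
        ((hcont _).comp (continuous_const.sub continuous_id))
    have hI1 : ∀ q ∈ Set.Ioc 0 σ, c y i * Real.exp (-r * q) *
        (if σ < q then 1 else v (σ - q) (y + unit i))
        = c y i * Real.exp (-r * q) * v (σ - q) (y + unit i) := fun q hq => by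
      rw [if_neg (not_lt.2 hq.2)]
    have hI2 : ∀ q ∈ Set.Ioi σ, c y i * Real.exp (-r * q) *
        (if σ < q then 1 else v (σ - q) (y + unit i)) = c y i * Real.exp (-r * q) := fun q hq => by
      rw [if_pos (show σ < q from hq), mul_one]
    rw [← Set.Ioc_union_Ioi_eq_Ioi hσ, setIntegral_union (Set.Ioc_disjoint_Ioi le_rfl)
      measurableSet_Ioi, setIntegral_congr_fun measurableSet_Ioc hI1,
      setIntegral_congr_fun measurableSet_Ioi hI2, ← intervalIntegral.integral_of_le hσ,
      integral_const_mul, integral_exp_mul_Ioi (neg_neg_of_pos hr), neg_div_neg_eq]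
    · ring
    · rw [integrableOn_congr_fun hI1 measurableSet_Ioc]
      exact (hc1.integrableOn_Icc).mono_set Set.Ioc_subset_Icc_self
    · rw [integrableOn_congr_fun hI2 measurableSet_Ioi]
      exact (integrableOn_exp_mul_Ioi (neg_neg_of_pos hr) σ).const_mul _
  simp only [hsplit]
  rw [Finset.sum_add_distrib, ← Finset.sum_mul, ← Finset.sum_div, ← hrdef, div_self hr.ne', one_mul,
    ← intervalIntegral.integral_finsetSum]
  -- By the backward equation, what remains is the derivative of `-exp (-r q) * v (σ - q) y`.
  · have hd : ∀ q ∈ Set.uIcc 0 σ, HasDerivAt (fun q => -(Real.exp (-r * q) * v (σ - q) y))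
        (∑ i, c y i * Real.exp (-r * q) * v (σ - q) (y + unit i)) q := by
      intro q _
      have h1 : HasDerivAt (fun q => Real.exp (-r * q)) (Real.exp (-r * q) * (-r * 1)) q :=
        ((hasDerivAt_id q).const_mul (-r)).exp
      have h2 : HasDerivAt (fun q => v (σ - q) y) (-gen c (v (σ - q)) y) q :=
        (hv (σ - q) y hy).comp_const_sub σ q
      refine (h1.fun_mul h2).fun_neg.congr_deriv ?_
      have h3 : gen c (v (σ - q)) y = ∑ i, c y i * v (σ - q) (y + unit i) - r * v (σ - q) y := by
        rw [hrdef, Finset.sum_mul, ← Finset.sum_sub_distrib]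
        exact Finset.sum_congr rfl fun i _ => by ring
      rw [h3]
      have h4 : ∑ i, c y i * Real.exp (-r * q) * v (σ - q) (y + unit i)
          = Real.exp (-r * q) * ∑ i, c y i * v (σ - q) (y + unit i) := by
        rw [Finset.mul_sum]
        exact Finset.sum_congr rfl fun i _ => by ring
      rw [h4]; ring
    rw [intervalIntegral.integral_eq_sub_of_hasDerivAt hd]
    · simp [hv0 y hy]
    · refine Continuous.intervalIntegrable ?_ _ _
      exact continuous_finsetSum _ fun i _ => (by fun_prop : Continuous fun q =>
        c y i * Real.exp (-r * q)).mul ((hcont _).comp (continuous_const.sub continuous_id))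
  · intro i _
    refine Continuous.intervalIntegrable ?_ _ _
    exact (by fun_prop : Continuous fun q => c y i * Real.exp (-r * q)).mul
        ((hcont _).comp (continuous_const.sub continuous_id))

lemma sum_integral_exp (hN : 1 ≤ N) (a : ℝ) (E : V N → ℝ) (y : V N) :
    ∑ i, ∫ q in Set.Ioi 0, cond a E y i * Real.exp (-(∑ j, cond a E y j) * q) = 1 := by
  have hr := sum_cond_pos hN a E y
  simp only [integral_const_mul, integral_exp_mul_Ioi (neg_neg_of_pos hr), mul_zero, Real.exp_zero,
    neg_div_neg_eq]
  rw [← Finset.sum_mul, mul_one_div, div_self hr.ne']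

/-- The survival function over the remaining time, taken along the jump chain and multiplied by the
indicator of survival so far, has constant expectation by the renewal equation. It starts at `v s z`
and, once the time exceeds `s`, becomes the indicator of survival. -/
theorem measure_survival (hN : 1 ≤ N) (a : ℝ) (E : V N → ℝ) (z : V N) {A : Finset (V N)}
    {v : ℝ → V N → ℝ}
    (hv : ∀ s, ∀ y ∉ A, HasDerivAt (fun s => v s y) (gen (cond a E) (v s) y) s)
    (hcont : ∀ y, Continuous fun s => v s y) (hv0 : ∀ y ∉ A, v 0 y = 1)
    (hvA : ∀ s, ∀ y ∈ A, v s y = 0) {s : ℝ} (hs : 0 ≤ s) :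
    (noise N).real {ξ | ∀ n, (jumps a E z ξ n).2 ≤ s → (jumps a E z ξ n).1 ∉ A} = v s z := by
  -- Arrival times are almost surely nonnegative; the truncation `max p.2 0` only keeps `Ψ` bounded
  -- on the whole space, as `v` is bounded only over compact time intervals.
  set Ψ : V N × ℝ → ℝ := fun p => if s < p.2 then 1 else v (s - max p.2 0) p.1 with hΨ
  have hΨm : Measurable Ψ := by
    refine measurable_from_prod_countable_right fun y => ?_
    refine Measurable.ite (measurableSet_lt measurable_const measurable_id) measurable_const ?_
    exact (hcont y).measurable.comp (by fun_prop)
  obtain ⟨C, hC⟩ : ∃ C, ∀ p, |Ψ p| ≤ C := by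
    have : ∀ y, ∃ C, ∀ τ ∈ Set.Icc 0 s, ‖v τ y‖ ≤ C := fun y =>
      isCompact_Icc.exists_bound_of_continuousOn (hcont y).continuousOn
    choose D hD using this
    have hD0 : ∀ y, 0 ≤ D y := fun y => (norm_nonneg _).trans (hD y 0 ⟨le_rfl, hs⟩)
    refine ⟨1 + ∑ y, D y, fun p => ?_⟩
    have hsum : 0 ≤ ∑ y, D y := Finset.sum_nonneg fun y _ => hD0 y
    by_cases hp : s < p.2
    · simp only [hΨ, if_pos hp, abs_one]
      linarith
    · simp only [hΨ, if_neg hp]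
      have h1 := hD p.1 (s - max p.2 0) ⟨by
        rw [sub_nonneg]; exact max_le (not_lt.1 hp) hs, by
        have := le_max_right p.2 0; linarith⟩
      have h2 : D p.1 ≤ ∑ y, D y := Finset.single_le_sum (fun y _ => hD0 y) (Finset.mem_univ _)
      rw [Real.norm_eq_abs] at h1
      linarith
  set S : ℕ → Set (ℕ → Fin N → ℝ) := fun n =>
    {ξ | ∀ k ≤ n, (jumps a E z ξ k).2 ≤ s → (jumps a E z ξ k).1 ∉ A} with hS
  have hSm1 : ∀ k, MeasurableSet {ξ : ℕ → Fin N → ℝ |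
      (jumps a E z ξ k).2 ≤ s → (jumps a E z ξ k).1 ∉ A} := fun k => by
    have h1 := measurable_jumps_right a E z k
    refine MeasurableSet.imp (measurableSet_le (measurable_snd.comp h1) measurable_const) ?_
    exact (measurable_fst.comp h1) (Set.toFinite _).measurableSet.compl
  have hSm : ∀ n, MeasurableSet (S n) := fun n => by
    have : S n = ⋂ k, ⋂ (_ : k ≤ n), {ξ : ℕ → Fin N → ℝ |
      (jumps a E z ξ k).2 ≤ s → (jumps a E z ξ k).1 ∉ A} := by ext; simp [hS]
    rw [this]
    exact MeasurableSet.iInter fun k => MeasurableSet.iInter fun _ => hSm1 k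
  set F : ℕ → (ℕ → Fin N → ℝ) → ℝ := fun n => (S n).indicator fun _ => 1 with hF
  have hFm : ∀ n, Measurable (F n) := fun n => measurable_const.indicator (hSm n)
  have hFb : ∀ n ξ, |F n ξ| ≤ 1 := fun n ξ => by
    by_cases h : ξ ∈ S n
    · simp [hF, Set.indicator_of_mem h]
    · simp [hF, Set.indicator_of_notMem h]
  have hFdep : ∀ n ξ ξ', (∀ k < n, ξ k = ξ' k) → F n ξ = F n ξ' := fun n ξ ξ' h => by
    have : ξ ∈ S n ↔ ξ' ∈ S n := by
      refine forall₂_congr fun k hk => ?_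
      rw [jumps_congr a E z fun m hm => h m (lt_of_lt_of_le hm hk)]
    by_cases h1 : ξ ∈ S n
    · simp [hF, Set.indicator_of_mem h1, Set.indicator_of_mem (this.1 h1)]
    · simp [hF, Set.indicator_of_notMem h1, Set.indicator_of_notMem fun h2 => h1 (this.2 h2)]
  have hstep : ∀ p : V N × ℝ, 0 ≤ p.2 → (p.2 ≤ s → p.1 ∉ A) →
      ∫ u, Ψ (step a E p u) ∂(Measure.pi fun _ => expMeasure 1) = Ψ p := by
    intro p hp0 hpA
    rw [integral_step hN a E p Ψ hΨm hC]
    by_cases hp : s < p.2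
    · have h1 : ∀ i, ∀ q ∈ Set.Ioi (0 : ℝ), cond a E p.1 i *
          Real.exp (-(∑ j, cond a E p.1 j) * q) * Ψ (p.1 + unit i, p.2 + q)
          = cond a E p.1 i * Real.exp (-(∑ j, cond a E p.1 j) * q) := fun i q hq => by
        have : s < p.2 + q := hp.trans (lt_add_of_pos_right _ hq)
        simp only [hΨ, if_pos this, mul_one]
      rw [Finset.sum_congr rfl fun i _ => setIntegral_congr_fun measurableSet_Ioi (h1 i),
        sum_integral_exp hN]
      simp only [hΨ, if_pos hp]
    · have hA := hpA (not_lt.1 hp)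
      have h1 : ∀ i, ∀ q ∈ Set.Ioi (0 : ℝ), cond a E p.1 i *
          Real.exp (-(∑ j, cond a E p.1 j) * q) * Ψ (p.1 + unit i, p.2 + q)
          = cond a E p.1 i * Real.exp (-(∑ j, cond a E p.1 j) * q) *
            (if s - p.2 < q then 1 else v (s - p.2 - q) (p.1 + unit i)) := fun i q hq => by
        have hq0 : 0 < q := hq
        have h2 : max (p.2 + q) 0 = p.2 + q := max_eq_left (by linarith)
        simp only [hΨ, h2, sub_lt_iff_lt_add', ← sub_sub]
      rw [Finset.sum_congr rfl fun i _ => setIntegral_congr_fun measurableSet_Ioi (h1 i),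
        renewal hv hcont hv0 hA (sum_cond_pos hN a E p.1) (sub_nonneg.2 (not_lt.1 hp))]
      simp only [hΨ, if_neg hp, max_eq_left hp0]
  -- If the new site lies in `A` in time then `Ψ` vanishes there. The survival indicator may thus be
  -- taken one step earlier, where it does not depend on the resampled clocks.
  have hFΨ : ∀ n ξ, F (n + 1) ξ * Ψ (jumps a E z ξ (n + 1))
      = F n ξ * Ψ (jumps a E z ξ (n + 1)) := by
    intro n ξ
    by_cases h : (jumps a E z ξ (n + 1)).2 ≤ s → (jumps a E z ξ (n + 1)).1 ∉ A
    · have : ξ ∈ S (n + 1) ↔ ξ ∈ S n := by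
        constructor
        · intro h1 k hk
          exact h1 k (hk.trans (Nat.le_succ n))
        · intro h1 k hk
          rcases Nat.le_succ_iff.1 hk with hk | rfl
          · exact h1 k hk
          · exact h
      by_cases h1 : ξ ∈ S n
      · simp [hF, Set.indicator_of_mem h1, Set.indicator_of_mem (this.2 h1)]
      · simp [hF, Set.indicator_of_notMem h1, Set.indicator_of_notMem fun h2 => h1 (this.1 h2)]
    · push Not at h
      have : Ψ (jumps a E z ξ (n + 1)) = 0 := by
        simp only [hΨ, if_neg (not_lt.2 h.1)]
        exact hvA _ _ h.2
      rw [this, mul_zero, mul_zero]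
  have hM : ∀ n, ∫ ξ, F n ξ * Ψ (jumps a E z ξ n) ∂noise N = v s z := by
    intro n
    induction n with
    | zero =>
      have : ∀ ξ : ℕ → Fin N → ℝ, F 0 ξ * Ψ (jumps a E z ξ 0) = v s z := fun ξ => by
        simp only [jumps, hΨ, if_neg (not_lt.2 hs), max_self, sub_zero]
        by_cases hz : z ∈ A
        · rw [hvA s z hz, mul_zero]
        · have : ξ ∈ S 0 := fun k hk _ => by
            rw [Nat.le_zero.1 hk]; exact hz
          simp [hF, Set.indicator_of_mem this]
      simp [this]
    | succ n ih =>
      simp only [hFΨ]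
      rw [integral_mul_jumps_succ a E z n (F n) (hFm n) (hFdep n) (hFb n) Ψ hΨm hC, ← ih]
      refine integral_congr_ae ?_
      filter_upwards [ae_regular hN a E z] with ξ hξ
      by_cases h : ξ ∈ S n
      · rw [hstep _ (hξ.nonneg n) (h n le_rfl)]
      · simp [hF, Set.indicator_of_notMem h]
  set S' : Set (ℕ → Fin N → ℝ) :=
    {ξ | ∀ n, (jumps a E z ξ n).2 ≤ s → (jumps a E z ξ n).1 ∉ A} with hS'
  have hS'm : MeasurableSet S' := by
    have : S' = ⋂ k, {ξ : ℕ → Fin N → ℝ |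
      (jumps a E z ξ k).2 ≤ s → (jumps a E z ξ k).1 ∉ A} := by ext; simp [hS']
    rw [this]
    exact MeasurableSet.iInter hSm1
  have hlim : Tendsto (fun n => ∫ ξ, F n ξ * Ψ (jumps a E z ξ n) ∂noise N) atTop
      (𝓝 (∫ ξ, S'.indicator (fun _ => (1 : ℝ)) ξ ∂noise N)) := by
    refine tendsto_integral_of_dominated_convergence (fun _ => C)
      (fun n => ((hFm n).mul (hΨm.comp (measurable_jumps_right a E z n))).aestronglyMeasurable)
      (integrable_const _) (fun n => Eventually.of_forall fun ξ => ?_) ?_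
    · rw [norm_mul, Real.norm_eq_abs, Real.norm_eq_abs]
      calc _ ≤ 1 * C := mul_le_mul (hFb n ξ) (hC _) (abs_nonneg _) zero_le_one
        _ = C := one_mul C
    · filter_upwards [ae_regular hN a E z] with ξ hξ
      refine tendsto_const_nhds.congr' ?_
      obtain ⟨m, hm⟩ := (hξ.2.eventually_gt_atTop s).exists
      filter_upwards [eventually_ge_atTop m] with n hn
      have hgt : s < (jumps a E z ξ n).2 := hm.trans_le (hξ.1.monotone hn)
      have hΨ1 : Ψ (jumps a E z ξ n) = 1 := by simp only [hΨ, if_pos hgt]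
      have hiff : ξ ∈ S n ↔ ξ ∈ S' := by
        constructor
        · intro h k hk
          refine h k ?_ hk
          by_contra hcon
          exact absurd (hξ.1.monotone (not_le.1 hcon).le) (not_le.2 (hk.trans_lt hgt))
        · exact fun h k _ => h k
      rw [hΨ1, mul_one]
      by_cases h : ξ ∈ S'
      · simp [hF, Set.indicator_of_mem h, Set.indicator_of_mem (hiff.2 h)]
      · simp [hF, Set.indicator_of_notMem h, Set.indicator_of_notMem fun h2 => h (hiff.1 h2)]
  simp only [hM] at hlim
  have := tendsto_nhds_unique hlim tendsto_const_nhds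
  rw [← this, integral_indicator hS'm]
  simp

/-! ### The Green function -/

lemma integral_exp_neg_mul {l : ℝ} (hl : 0 < l) (b c : ℝ) :
    ∫ t in b..c, Real.exp (-l * t) = (Real.exp (-l * b) - Real.exp (-l * c)) / l := by
  have hd : ∀ t ∈ Set.uIcc b c, HasDerivAt (fun t => -(Real.exp (-l * t) / l))
      (Real.exp (-l * t)) t := fun t _ => by
    have h1 : HasDerivAt (fun t => Real.exp (-l * t)) (Real.exp (-l * t) * (-l * 1)) t :=
      ((hasDerivAt_id t).const_mul (-l)).exp
    refine (h1.div_const l).fun_neg.congr_deriv ?_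
    field_simp
  rw [intervalIntegral.integral_eq_sub_of_hasDerivAt hd
    (Continuous.intervalIntegrable (by fun_prop) _ _)]
  ring

/-- The discounted time spent at `0` up to the `n`-th jump. -/
def occupation (l a : ℝ) (E : V N → ℝ) (z : V N) (ξ : ℕ → Fin N → ℝ) (n : ℕ) : ℝ :=
  ∑ k ∈ Finset.range n, if (jumps a E z ξ k).1 = 0 then
    (Real.exp (-l * (jumps a E z ξ k).2) - Real.exp (-l * (jumps a E z ξ (k + 1)).2)) / l else 0

section occupation

variable {l a : ℝ} {E : V N → ℝ} {z : V N} {ξ : ℕ → Fin N → ℝ}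

lemma occupation_nonneg (hl : 0 < l) (h : Regular a E z ξ) (n : ℕ) :
    0 ≤ occupation l a E z ξ n := by
  refine Finset.sum_nonneg fun k _ => ?_
  split_ifs
  · refine div_nonneg (sub_nonneg.2 (Real.exp_le_exp.2 ?_)) hl.le
    have := h.1.monotone (Nat.le_succ k)
    simp only [Nat.succ_eq_add_one] at this
    nlinarith
  · exact le_rfl

/-- Forgetting the condition on the position makes the sum telescope. -/
lemma occupation_le (hl : 0 < l) (h : Regular a E z ξ) (n : ℕ) :
    occupation l a E z ξ n ≤ 1 / l := by
  have h1 : occupation l a E z ξ n ≤ ∑ k ∈ Finset.range n,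
      (Real.exp (-l * (jumps a E z ξ k).2) / l
        - Real.exp (-l * (jumps a E z ξ (k + 1)).2) / l) := by
    refine Finset.sum_le_sum fun k _ => ?_
    have h2 : 0 ≤ (Real.exp (-l * (jumps a E z ξ k).2)
        - Real.exp (-l * (jumps a E z ξ (k + 1)).2)) / l := by
      refine div_nonneg (sub_nonneg.2 (Real.exp_le_exp.2 ?_)) hl.le
      have := h.1.monotone (Nat.le_succ k)
      simp only [Nat.succ_eq_add_one] at this
      nlinarith
    rw [← sub_div]
    split_ifs
    · exact le_rfl
    · exact h2
  refine h1.trans ?_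
  rw [Finset.sum_range_sub' fun k => Real.exp (-l * (jumps a E z ξ k).2) / l]
  have h0 : (jumps a E z ξ 0).2 = 0 := rfl
  rw [h0, mul_zero, Real.exp_zero]
  have : 0 ≤ Real.exp (-l * (jumps a E z ξ n).2) / l := by positivity
  linarith

/-- The half-line is cut at the jump times, between which the walk is constant; the uniform bound `1
/ l` supplies the integrability needed for the limit. -/
lemma tendsto_occupation (hl : 0 < l) (h : Regular a E z ξ) :
    Tendsto (occupation l a E z ξ) atTop (𝓝 (∫ t in Set.Ioi (0 : ℝ), Real.exp (-l * t) *
      Set.indicator {s : ℝ | walk a E z ξ s = 0} (fun _ => (1 : ℝ)) t)) := by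
  set φ : ℝ → ℝ := fun t => Real.exp (-l * t) *
      Set.indicator {s : ℝ | walk a E z ξ s = 0} (fun _ => (1 : ℝ)) t with hφ
  set T : ℕ → ℝ := fun k => (jumps a E z ξ k).2 with hT
  have hφ0 : ∀ t, 0 ≤ φ t := fun t =>
    mul_nonneg (Real.exp_pos _).le (Set.indicator_nonneg (fun _ _ => zero_le_one) _)
  have hmono : ∀ k, T k ≤ T (k + 1) := fun k => h.1.monotone (Nat.le_succ k)
  have hon : ∀ k, ∀ t ∈ Set.Ioo (T k) (T (k + 1)), φ t
      = (if (jumps a E z ξ k).1 = 0 then 1 else 0) * Real.exp (-l * t) := fun k t ht => by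
    have hw : walk a E z ξ t = (jumps a E z ξ k).1 := h.walk_eq ht.1.le ht.2
    simp only [hφ, Set.indicator_apply, Set.mem_ofPred_eq, hw]
    rw [mul_comm]
  have hInt : ∀ k, IntervalIntegrable φ volume (T k) (T (k + 1)) := fun k => by
    rw [intervalIntegrable_iff_integrableOn_Ioc_of_le (hmono k),
      integrableOn_Ioc_iff_integrableOn_Ioo,
      integrableOn_congr_fun (hon k) measurableSet_Ioo]
    have hc : Continuous fun t => (if (jumps a E z ξ k).1 = 0 then (1 : ℝ) else 0) *
        Real.exp (-l * t) := by fun_prop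
    exact hc.integrableOn_Icc.mono_set Set.Ioo_subset_Icc_self
  have hval : ∀ k, ∫ t in T k..T (k + 1), φ t = if (jumps a E z ξ k).1 = 0 then
      (Real.exp (-l * T k) - Real.exp (-l * T (k + 1))) / l else 0 := fun k => by
    rw [intervalIntegral.integral_of_le (hmono k), integral_Ioc_eq_integral_Ioo,
      setIntegral_congr_fun measurableSet_Ioo (hon k), ← integral_Ioc_eq_integral_Ioo,
      ← intervalIntegral.integral_of_le (hmono k), intervalIntegral.integral_const_mul,
      integral_exp_neg_mul hl, ite_mul, one_mul, zero_mul]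
  have hocc : ∀ n, ∫ t in (0 : ℝ)..T n, φ t = occupation l a E z ξ n := fun n => by
    have := intervalIntegral.sum_integral_adjacent_intervals (f := φ) (μ := volume)
      (a := T) (n := n)
      fun k _ => hInt k
    have h0 : T 0 = 0 := rfl
    rw [h0] at this
    rw [← this, occupation]
    exact Finset.sum_congr rfl fun k _ => hval k
  have hintn : ∀ n, IntervalIntegrable φ volume 0 (T n) := fun n => by
    have := IntervalIntegrable.trans_iterate (f := φ) (μ := volume) (a := T) (n := n)
      fun k _ => hInt k
    exact this
  have hI : IntegrableOn φ (Set.Ioi 0) := by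
    refine integrableOn_Ioi_of_intervalIntegral_norm_bounded (1 / l) 0 (fun n => ?_) h.2
      (Eventually.of_forall fun n => ?_)
    · exact (intervalIntegrable_iff_integrableOn_Ioc_of_le (h.nonneg n)).1 (hintn n)
    · have : (fun t => ‖φ t‖) = φ := funext fun t => Real.norm_of_nonneg (hφ0 t)
      rw [this]
      exact (hocc n).trans_le (occupation_le hl h n)
  have := intervalIntegral_tendsto_integral_Ioi 0 hI h.2
  exact this.congr fun n => hocc n

end occupation

lemma setIntegral_exp_exp {c r l T : ℝ} (hrl : 0 < l + r) :
    ∫ q in Set.Ioi 0, c * Real.exp (-r * q) * Real.exp (-l * (T + q))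
      = c / (l + r) * Real.exp (-l * T) := by
  have hneg : -(l + r) < 0 := by linarith
  have h1 : ∀ q : ℝ, c * Real.exp (-r * q) * Real.exp (-l * (T + q))
      = c * Real.exp (-l * T) * Real.exp (-(l + r) * q) := fun q => by
    rw [mul_assoc, mul_assoc, ← Real.exp_add, ← Real.exp_add]
    congr 2; ring
  simp only [h1]
  rw [integral_const_mul, integral_exp_mul_Ioi hneg, mul_zero, Real.exp_zero, neg_div_neg_eq]
  ring

/-- The Green function is the resolvent of the generator. -/
theorem integral_occupation (hN : 1 ≤ N) (a : ℝ) (E : V N → ℝ) {l : ℝ} (hl : 0 < l) {g : V N → ℝ}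
    (hg : ∀ y, l * g y - gen (cond a E) g y = if y = 0 then 1 else 0) :
    ∫ ξ, (∫ t in Set.Ioi (0 : ℝ), Real.exp (-l * t) *
      Set.indicator {s : ℝ | walk a E 0 ξ s = 0} (fun _ => (1 : ℝ)) t) ∂noise N = g 0 := by
  set h : V N × ℝ → ℝ := fun p => Real.exp (-l * max p.2 0) with hh
  set G : V N × ℝ → ℝ := fun p => h p * g p.1 with hG
  have hhm : Measurable h := by fun_prop
  have hgm : Measurable fun p : V N × ℝ => g p.1 := (measurable_of_countable g).comp measurable_fst
  have hGm : Measurable G := hhm.mul hgm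
  have hhb : ∀ p, |h p| ≤ 1 := fun p => by
    rw [abs_of_pos (Real.exp_pos _)]
    refine Real.exp_le_one_iff.2 ?_
    have := le_max_right p.2 0
    nlinarith
  set B : ℝ := ∑ y, |g y| with hB
  have hgB : ∀ y, |g y| ≤ B := fun y =>
    Finset.single_le_sum (f := fun y => |g y|) (fun y _ => abs_nonneg _) (Finset.mem_univ y)
  have hGb : ∀ p, |G p| ≤ B := fun p => by
    rw [hG, abs_mul]
    calc _ ≤ 1 * B := mul_le_mul (hhb p) (hgB _) (abs_nonneg _) zero_le_one
      _ = B := one_mul B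
  set J : ℕ → (ℕ → Fin N → ℝ) → V N × ℝ := fun n ξ => jumps a E 0 ξ n with hJ
  have hJm : ∀ n, Measurable (J n) := fun n => measurable_jumps_right a E 0 n
  set F : ℕ → (ℕ → Fin N → ℝ) → ℝ := fun n ξ => if (J n ξ).1 = 0 then 1 else 0 with hF
  have hFm : ∀ n, Measurable (F n) := fun n =>
    Measurable.ite ((measurable_fst.comp (hJm n)) (measurableSet_singleton 0)) measurable_const
      measurable_const
  have hFb : ∀ n ξ, |F n ξ| ≤ 1 := fun n ξ => by
    simp only [hF]; split_ifs <;> simp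
  have hFdep : ∀ n ξ ξ', (∀ k < n, ξ k = ξ' k) → F n ξ = F n ξ' := fun n ξ ξ' hk => by
    simp only [hF, hJ, jumps_congr a E 0 hk]
  have hb : ∀ (f : (ℕ → Fin N → ℝ) → ℝ) (C : ℝ), Measurable f → (∀ ξ, |f ξ| ≤ C) →
      Integrable f (noise N) := fun f C hf hC =>
    Integrable.of_bound hf.aestronglyMeasurable C (Eventually.of_forall hC)
  have hFhb : ∀ n m ξ, |F n ξ * h (J m ξ)| ≤ 1 := fun n m ξ => by
    rw [abs_mul]
    exact mul_le_one₀ (hFb n ξ) (abs_nonneg _) (hhb _)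
  have hGi : ∀ n, Integrable (fun ξ => G (J n ξ)) (noise N) := fun n =>
    hb _ B (hGm.comp (hJm n)) fun ξ => hGb _
  have hFhi : ∀ n m, Integrable (fun ξ => F n ξ * h (J m ξ)) (noise N) := fun n m =>
    hb _ 1 ((hFm n).mul (hhm.comp (hJm m))) (hFhb n m)
  have hstep1 : ∀ p : V N × ℝ, 0 ≤ p.2 →
      ∫ u, h (step a E p u) ∂(Measure.pi fun _ => expMeasure 1)
        = (∑ j, cond a E p.1 j) / (l + ∑ j, cond a E p.1 j) * h p := fun p hp => by
    have hr := sum_cond_pos hN a E p.1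
    rw [integral_step hN a E p h hhm hhb]
    have h1 : ∀ i, ∀ q ∈ Set.Ioi (0 : ℝ), cond a E p.1 i * Real.exp (-(∑ j, cond a E p.1 j) * q) *
        h (p.1 + unit i, p.2 + q) = cond a E p.1 i * Real.exp (-(∑ j, cond a E p.1 j) * q) *
        Real.exp (-l * (p.2 + q)) := fun i q hq => by
      have hq0 : 0 < q := hq
      simp only [hh]
      rw [max_eq_left (by linarith)]
    rw [Finset.sum_congr rfl fun i _ => setIntegral_congr_fun measurableSet_Ioi (h1 i)]
    simp only [setIntegral_exp_exp (add_pos hl hr)]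
    rw [← Finset.sum_mul, ← Finset.sum_div]
    simp only [hh]
    rw [max_eq_left hp]
  have hstep2 : ∀ p : V N × ℝ, 0 ≤ p.2 →
      ∫ u, G (step a E p u) ∂(Measure.pi fun _ => expMeasure 1)
        = (∑ i, cond a E p.1 i * g (p.1 + unit i)) / (l + ∑ j, cond a E p.1 j) * h p :=
    fun p hp => by
    have hr := sum_cond_pos hN a E p.1
    rw [integral_step hN a E p G hGm hGb]
    have h1 : ∀ i, ∀ q ∈ Set.Ioi (0 : ℝ), cond a E p.1 i * Real.exp (-(∑ j, cond a E p.1 j) * q) *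
        G (p.1 + unit i, p.2 + q) = cond a E p.1 i * g (p.1 + unit i) *
          Real.exp (-(∑ j, cond a E p.1 j) * q) * Real.exp (-l * (p.2 + q)) := fun i q hq => by
      have hq0 : 0 < q := hq
      simp only [hG, hh]
      rw [max_eq_left (by linarith)]
      ring
    rw [Finset.sum_congr rfl fun i _ => setIntegral_congr_fun measurableSet_Ioi (h1 i)]
    simp only [setIntegral_exp_exp (add_pos hl hr)]
    rw [← Finset.sum_mul, ← Finset.sum_div]
    simp only [hh]
    rw [max_eq_left hp]
  -- The resolvent equation says that the occupation plus `G` is a martingale: away from `0` the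
  -- jump preserves `G` on average, while at `0` it loses the expected discounted holding time.
  have hincr : ∀ n, ∫ ξ, F n ξ * (h (J n ξ) - h (J (n + 1) ξ)) / l ∂noise N
      = ∫ ξ, G (J n ξ) ∂noise N - ∫ ξ, G (J (n + 1) ξ) ∂noise N := by
    intro n
    have e1 := integral_mul_jumps_succ a E 0 n (F n) (hFm n) (hFdep n) (hFb n) h hhm hhb
    have e2 := integral_mul_jumps_succ a E 0 n (fun _ => 1) measurable_const (fun _ _ _ => rfl)
      (B := 1) (fun _ => by simp) G hGm hGb
    simp only [one_mul] at e2
    have e3 : ∫ ξ, F n ξ * (h (J n ξ) - h (J (n + 1) ξ)) / l ∂noise N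
        = (∫ ξ, F n ξ * h (J n ξ) ∂noise N - ∫ ξ, F n ξ * h (J (n + 1) ξ) ∂noise N) / l := by
      rw [integral_div, ← integral_sub (hFhi n n) (hFhi n (n + 1))]
      simp only [mul_sub]
    rw [e3, show (fun ξ => F n ξ * h (J (n + 1) ξ)) = fun ξ => F n ξ * h (jumps a E 0 ξ (n + 1))
      from rfl, e1,
      show (fun ξ => G (J (n + 1) ξ)) = fun ξ => G (jumps a E 0 ξ (n + 1)) from rfl, e2]
    have e4 : ∫ ξ, F n ξ * ∫ u, h (step a E (jumps a E 0 ξ n) u)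
        ∂(Measure.pi fun _ => expMeasure 1) ∂noise N = ∫ ξ, F n ξ *
        ((∑ j, cond a E 0 j) / (l + ∑ j, cond a E 0 j)) * h (J n ξ) ∂noise N := by
      refine integral_congr_ae ?_
      filter_upwards [ae_regular hN a E 0] with ξ hξ
      rw [hstep1 _ (hξ.nonneg n)]
      simp only [hF, hJ]
      split_ifs with h0
      · rw [h0]; ring
      · simp
    have e5 : ∫ ξ, (∫ u, G (step a E (jumps a E 0 ξ n) u) ∂(Measure.pi fun _ => expMeasure 1))
        ∂noise N = ∫ ξ, (G (J n ξ) - F n ξ * h (J n ξ) / (l + ∑ j, cond a E 0 j)) ∂noise N := by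
      refine integral_congr_ae ?_
      filter_upwards [ae_regular hN a E 0] with ξ hξ
      rw [hstep2 _ (hξ.nonneg n)]
      simp only [hF, hG, hJ]
      set y := (jumps a E 0 ξ n).1 with hy
      have hr := sum_cond_pos hN a E y
      have hgy := hg y
      have h3 : gen (cond a E) g y = ∑ i, cond a E y i * g (y + unit i)
          - (∑ j, cond a E y j) * g y := by
        rw [Finset.sum_mul, ← Finset.sum_sub_distrib]
        exact Finset.sum_congr rfl fun i _ => by ring
      rw [h3] at hgy
      have hne : l + ∑ j, cond a E y j ≠ 0 := (add_pos hl hr).ne'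
      split_ifs at hgy ⊢ with h0
      · have : ∑ i, cond a E y i * g (y + unit i) = (l + ∑ j, cond a E y j) * g y - 1 := by
          linarith
        rw [this, ← h0]
        field_simp
      · have : ∑ i, cond a E y i * g (y + unit i) = (l + ∑ j, cond a E y j) * g y := by
          linarith
        rw [this]
        field_simp
        ring
    have hr0 := sum_cond_pos hN a E 0
    have hne0 : l + ∑ j, cond a E 0 j ≠ 0 := (add_pos hl hr0).ne'
    rw [e4, e5, integral_sub (hGi n) ((hFhi n n).div_const _), integral_div]
    have e6 : ∫ ξ, F n ξ * ((∑ j, cond a E 0 j) / (l + ∑ j, cond a E 0 j)) * h (J n ξ) ∂noise N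
        = (∑ j, cond a E 0 j) / (l + ∑ j, cond a E 0 j) * ∫ ξ, F n ξ * h (J n ξ) ∂noise N := by
      rw [← integral_const_mul]
      exact integral_congr_ae (Eventually.of_forall fun ξ => by ring)
    rw [e6]
    field_simp
    ring
  set Z : ℕ → (ℕ → Fin N → ℝ) → ℝ := fun n ξ =>
    ∑ k ∈ Finset.range n, F k ξ * (h (J k ξ) - h (J (k + 1) ξ)) / l with hZ
  have hZm : ∀ n, Measurable (Z n) := fun n => Finset.measurable_fun_sum _ fun k _ =>
    (((hFm k).mul ((hhm.comp (hJm k)).sub (hhm.comp (hJm (k + 1))))).div_const l)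
  have hZocc : ∀ ξ, Regular a E 0 ξ → ∀ n, Z n ξ = occupation l a E 0 ξ n := fun ξ hξ n => by
    refine Finset.sum_congr rfl fun k _ => ?_
    simp only [hF, hJ, hh]
    rw [max_eq_left (hξ.nonneg k), max_eq_left (hξ.nonneg (k + 1))]
    split_ifs <;> simp
  have hZint : ∀ n, ∫ ξ, Z n ξ ∂noise N = g 0 - ∫ ξ, G (J n ξ) ∂noise N := by
    intro n
    have hi : ∀ k, Integrable (fun ξ => F k ξ * (h (J k ξ) - h (J (k + 1) ξ)) / l) (noise N) :=
      fun k => by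
      simp only [mul_sub]
      exact ((hFhi k k).sub (hFhi k (k + 1))).div_const l
    simp only [hZ]
    rw [integral_finsetSum _ fun k _ => hi k, Finset.sum_congr rfl fun k _ => hincr k,
      Finset.sum_range_sub' fun k => ∫ ξ, G (J k ξ) ∂noise N]
    congr 1
    simp [hJ, jumps, hG, hh]
  have hlim1 : Tendsto (fun n => ∫ ξ, Z n ξ ∂noise N) atTop
      (𝓝 (∫ ξ, (∫ t in Set.Ioi (0 : ℝ), Real.exp (-l * t) *
      Set.indicator {s : ℝ | walk a E 0 ξ s = 0} (fun _ => (1 : ℝ)) t) ∂noise N)) := by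
    refine tendsto_integral_of_dominated_convergence (fun _ => 1 / l)
      (fun n => (hZm n).aestronglyMeasurable) (integrable_const _) (fun n => ?_) ?_
    · filter_upwards [ae_regular hN a E 0] with ξ hξ
      rw [hZocc ξ hξ, Real.norm_of_nonneg (occupation_nonneg hl hξ n)]
      exact occupation_le hl hξ n
    · filter_upwards [ae_regular hN a E 0] with ξ hξ
      exact (tendsto_occupation hl hξ).congr fun n => (hZocc ξ hξ n).symm
  -- The terminal term disappears because the discount factor tends to zero while `g` is bounded.
  have hlim2 : Tendsto (fun n => ∫ ξ, G (J n ξ) ∂noise N) atTop (𝓝 (∫ _, (0 : ℝ) ∂noise N)) := by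
    refine tendsto_integral_of_dominated_convergence (fun _ => B)
      (fun n => (hGm.comp (hJm n)).aestronglyMeasurable) (integrable_const _)
      (fun n => Eventually.of_forall fun ξ => hGb _) ?_
    filter_upwards [ae_regular hN a E 0] with ξ hξ
    have h1 : Tendsto (fun n => h (J n ξ)) atTop (𝓝 0) := by
      have h2 : Tendsto (fun n => -l * (jumps a E 0 ξ n).2) atTop atBot :=
        hξ.2.const_mul_atTop_of_neg (neg_neg_of_pos hl)
      refine (Real.tendsto_exp_atBot.comp h2).congr fun n => ?_
      simp only [hh, hJ, Function.comp_apply]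
      rw [max_eq_left (hξ.nonneg n)]
    refine squeeze_zero_norm (a := fun n => h (J n ξ) * B) (fun n => ?_)
      (by simpa using h1.mul_const B)
    rw [hG, norm_mul, Real.norm_of_nonneg (Real.exp_pos _).le]
    exact mul_le_mul_of_nonneg_left (hgB _) (Real.exp_pos _).le
  simp only [hZint] at hlim1
  have hlim3 := hlim2.const_sub (g 0)
  simp only [integral_zero, sub_zero] at hlim3
  exact tendsto_nhds_unique hlim1 hlim3

theorem green_eq (hN : 1 ≤ N) (a : ℝ) (E : V N → ℝ) {g : V N → ℝ}
    (hg : ∀ y, 1 / (N : ℝ) ^ 2 * g y - gen (cond a E) g y = if y = 0 then 1 else 0) :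
    green a E = g 0 := by
  have hl : (0 : ℝ) < 1 / (N : ℝ) ^ 2 := by
    have : (0 : ℝ) < N := by exact_mod_cast hN
    positivity
  rw [← integral_occupation hN a E hl hg, green]
  refine integral_congr_ae (Eventually.of_forall fun ξ => ?_)
  simp only
  congr 1
  funext t
  congr 2
  ring

/-! ### Quenched estimates -/

lemma cond_shift (a : ℝ) (E : V N → ℝ) (x y : V N) (i : Fin N) :
    cond a (shift x E) y i = cond a E (x + y) i := by
  simp only [cond, rate, shift, add_assoc]

lemma outflow_shift (a : ℝ) (E : V N → ℝ) (x : V N) :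
    outflow (cond a (shift x E)) 0 = outflow (cond a E) x := by
  simp only [outflow, cond_shift, zero_add]

lemma outflowSq_shift (a : ℝ) (E : V N → ℝ) (x : V N) :
    outflowSq (cond a (shift x E)) 0 = outflowSq (cond a E) x := by
  simp only [outflowSq, cond_shift, zero_add]

theorem green_shift_bounds (hN : 3 ≤ N) {a : ℝ} (ha : 0 ≤ a) {E : V N → ℝ} (hE : ∀ x, 0 ≤ E x)
    (x : V N) {s q ε : ℝ} (hs0 : 0 < s) (hS : s ≤ outflow (cond a E) x)
    (hq : outflowSq (cond a E) x ≤ q) (hε0 : 0 ≤ ε) (hε : ∀ i, 1 ≤ ε * cond a E x i) :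
    1 / (outflow (cond a E) x + 1 / (N : ℝ) ^ 2 * (N + 1)) ≤ green a (shift x E) ∧
      green a (shift x E) ≤ flowConst N s q ε ^ 2 + (N : ℝ) ^ 2 / 2 ^ N := by
  have hNpos : (0 : ℝ) < N := by exact_mod_cast (by omega : 0 < N)
  have hl : (0 : ℝ) < 1 / (N : ℝ) ^ 2 := by positivity
  have hc : ∀ y i, 1 ≤ cond a (shift x E) y i := one_le_cond ha fun y => hE _
  obtain ⟨g, hg⟩ := exists_resolvent (cond_symm a (shift x E))
    (fun y i => zero_le_one.trans (hc y i)) hl fun y => if y = 0 then 1 else 0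
  rw [green_eq (by omega) a (shift x E) hg]
  constructor
  · have := le_resolvent_zero (cond_symm a (shift x E)) hc hl hg
    rwa [outflow_shift] at this
  · have := resolvent_zero_le (cond_symm a (shift x E)) hc hl hg hN (q := q) hs0
      (by rwa [outflow_shift]) (by rwa [outflowSq_shift]) hε0
      (fun i => by rw [cond_shift, add_zero]; exact hε i)
    refine this.trans (le_of_eq ?_)
    field_simp

/-- The probability that the walk started from a uniform point visits `A` before time `s`. -/
def hitP (a : ℝ) (E : V N → ℝ) (A : Finset (V N)) (s : ℝ) : ℝ :=
  (∑ z, (noise N).real {ξ | ∃ n, (jumps a E z ξ n).2 ≤ s ∧ (jumps a E z ξ n).1 ∈ A}) / 2 ^ N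

lemma measurableSet_hit (a : ℝ) (A : (V N → ℝ) → Finset (V N))
    (hA : ∀ y, MeasurableSet {E | y ∈ A E}) (s : ℝ) :
    MeasurableSet {ω : Sample N | ∃ n, (jumps a ω.1 ω.2.1 ω.2.2 n).2 ≤ s ∧
      (jumps a ω.1 ω.2.1 ω.2.2 n).1 ∈ A ω.1} := by
  have : {ω : Sample N | ∃ n, (jumps a ω.1 ω.2.1 ω.2.2 n).2 ≤ s ∧
      (jumps a ω.1 ω.2.1 ω.2.2 n).1 ∈ A ω.1} = ⋃ n, ⋃ y, {ω : Sample N |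
        (jumps a ω.1 ω.2.1 ω.2.2 n).2 ≤ s} ∩ ({ω : Sample N |
          (jumps a ω.1 ω.2.1 ω.2.2 n).1 = y} ∩ Prod.fst ⁻¹' {E | y ∈ A E}) := by
    ext ω
    simp only [Set.mem_ofPred_eq, Set.mem_iUnion, Set.mem_inter_iff, Set.mem_preimage]
    refine exists_congr fun n => ⟨fun h => ⟨_, h.1, rfl, h.2⟩, ?_⟩
    rintro ⟨y, h1, h2, h3⟩
    exact ⟨h1, h2 ▸ h3⟩
  rw [this]
  have hm := measurable_jumps (N := N) a
  refine MeasurableSet.iUnion fun n => MeasurableSet.iUnion fun y => MeasurableSet.inter ?_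
    (MeasurableSet.inter ?_ (measurable_fst (hA y)))
  · exact measurableSet_le (measurable_snd.comp (hm n)) measurable_const
  · exact (measurable_fst.comp (hm n)) (measurableSet_singleton y)

/-- Translates the two mass bounds of the killed semigroup into probabilities: an upper bound
through the energy of an indicator, a lower one through the energy of some function equal to `1` on
the target. -/
lemma exists_survival (hN : 1 ≤ N) (a : ℝ) (E : V N → ℝ) (A : Finset (V N)) {s : ℝ} (hs : 0 < s) :
    (2 ^ N * hitP a E A s ≤ A.card + s * dir (cond a E) (ind A)) ∧
      ∃ h : V N → ℝ, (∀ y ∈ A, h y = 1) ∧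
        s * (dir (cond a E) h + 1 / s * ∑ y, h y ^ 2) ≤ 2 ^ N * hitP a E A s := by
  obtain ⟨v, hv, hcont, hv0, hvA, hlow, hup⟩ := exists_killed_semigroup (cond_symm a E)
    (fun y i => (cond_pos a E y i).le) A
  have hm : ∀ z, MeasurableSet
      {ξ | ∃ n, (jumps a E z ξ n).2 ≤ s ∧ (jumps a E z ξ n).1 ∈ A} := fun z =>
    (measurable_const.prodMk (measurable_const.prodMk measurable_id) :
      Measurable fun ξ => ((E, z, ξ) : Sample N))
      (measurableSet_hit a (fun _ => A) (fun y => MeasurableSet.const _) s)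
  have hz : ∀ z, (noise N).real {ξ | ∃ n, (jumps a E z ξ n).2 ≤ s ∧ (jumps a E z ξ n).1 ∈ A}
      = 1 - v s z := fun z => by
    rw [← measure_survival hN a E z hv hcont hv0 hvA hs.le]
    have : {ξ | ∀ n, (jumps a E z ξ n).2 ≤ s → (jumps a E z ξ n).1 ∉ A}
        = {ξ | ∃ n, (jumps a E z ξ n).2 ≤ s ∧ (jumps a E z ξ n).1 ∈ A}ᶜ := by
      ext ξ
      simp
    rw [this, probReal_compl_eq_one_sub (hm z)]
    ring
  have hP : 2 ^ N * hitP a E A s = 2 ^ N - ∑ z, v s z := by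
    rw [hitP, mul_div_cancel₀ _ (by positivity)]
    simp only [hz]
    rw [Finset.sum_sub_distrib, Finset.sum_const, Finset.card_univ, card_V]
    simp
  constructor
  · have := hlow s hs.le
    rw [hP]
    linarith
  · obtain ⟨h, h1, h2⟩ := hup s hs
    exact ⟨h, h1, by rw [hP]; linarith⟩

lemma hitP_ball_le (hN : 1 ≤ N) (a : ℝ) (E : V N → ℝ) (x : V N) {s : ℝ} (hs : 0 < s) :
    hitP a E (ball x) s ≤ (N + 1 + s * outflow (cond a E) x) / 2 ^ N := by
  have h1 := (exists_survival hN a E (ball x) hs).1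
  have h2 := dir_ind_ball_le (cond_symm a E) (fun y i => (cond_pos a E y i).le) x
  rw [card_ball] at h1
  rw [le_div_iff₀ (by positivity)]
  have := mul_le_mul_of_nonneg_left h2 hs.le
  linarith

/-- The potential of `A` sums to `|T|` over `T`, so `sum_le_sqrt_energy` with killing rate `1 / r`
bounds its energy below. The alternative on the neighbours covers two uses: a whole ball as target,
where the potential is constant near the centre, and isolated deep traps, where the conductances are
large. -/
theorem le_hitP (hN : 3 ≤ N) {a : ℝ} (ha : 0 ≤ a) {E : V N → ℝ} (hE : ∀ x, 0 ≤ E x)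
    {A T : Finset (V N)} (hTA : T ⊆ A) (hT : Separated T) (hT0 : T.Nonempty)
    {s q ε r : ℝ} (hs0 : 0 < s) (hS : ∀ x ∈ T, s ≤ outflow (cond a E) x)
    (hq : ∀ x ∈ T, outflowSq (cond a E) x ≤ q) (hε0 : 0 ≤ ε)
    (hε : ∀ x ∈ T, ∀ i, x + unit i ∈ A ∨ 1 ≤ ε * cond a E x i) (hr : 0 < r) :
    1 / (1 + 2 ^ N * flowConst N s q ε ^ 2 / (r * T.card)) ≤ hitP a E A r := by
  obtain ⟨h, h1, h2⟩ := (exists_survival (by omega) a E A hr).2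
  have hn : (0 : ℝ) < T.card := by exact_mod_cast hT0.card_pos
  have hsum : ∑ x ∈ T, h x = T.card := by
    rw [Finset.sum_congr rfl fun x hx => h1 x (hTA hx)]
    simp
  have key := sum_le_sqrt_energy (cond_symm a E) (one_le_cond ha hE) hT h hN hs0 hS hq hε0
    (by
      intro x hx i
      rcases hε x hx i with h3 | h3
      · rw [h1 x (hTA hx), h1 _ h3, sub_self, zero_pow two_ne_zero]
        exact mul_nonneg hε0 (mul_nonneg (cond_pos _ _ _ _).le (sq_nonneg _))
      · rw [edge, ← mul_assoc]
        exact le_mul_of_one_le_left (sq_nonneg _) h3) (μ := 1 / r) (by positivity)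
    (by rw [hsum]; exact hn.le)
  rw [hsum] at key
  set n : ℝ := (T.card : ℝ)
  set K := flowConst N s q ε
  set X := dir (cond a E) h + 1 / r * ∑ y, h y ^ 2
  have h2N : (0 : ℝ) < 2 ^ N := by positivity
  have hY : n * K ^ 2 + n ^ 2 / (2 ^ N * (1 / r)) = n ^ 2 * r / 2 ^ N *
      (1 + 2 ^ N * K ^ 2 / (r * n)) := by
    field_simp
    ring
  rw [hY] at key
  have hD : 0 < 1 + 2 ^ N * K ^ 2 / (r * n) := by positivity
  rw [div_le_iff₀ hD]
  have h5 : n ^ 2 * 1 ≤ n ^ 2 * (r * X / 2 ^ N * (1 + 2 ^ N * K ^ 2 / (r * n))) := by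
    calc n ^ 2 * 1 = n ^ 2 := mul_one _
      _ ≤ _ := key
      _ = _ := by ring
  have h6 := le_of_mul_le_mul_left h5 (by positivity)
  refine h6.trans (mul_le_mul_of_nonneg_right ?_ hD.le)
  rw [div_le_iff₀ h2N]
  linarith

/-! ### The annealed law -/

instance : IsProbabilityMeasure posGaussian :=
  Measure.isProbabilityMeasure_map (by fun_prop)

instance : IsProbabilityMeasure (energyLaw N) := by unfold energyLaw; infer_instance

instance : IsProbabilityMeasure (uniformOn (Set.univ : Set (V N))) :=
  isProbabilityMeasure_uniformOn Set.finite_univ Set.univ_nonempty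

instance : IsProbabilityMeasure (annealed N) := by unfold annealed; infer_instance

lemma lintegral_uniformOn (f : V N → ℝ≥0∞) :
    ∫⁻ z, f z ∂(uniformOn (Set.univ : Set (V N))) = (∑ z, f z) / 2 ^ N := by
  rw [uniformOn, ProbabilityTheory.cond, Measure.restrict_univ, lintegral_smul_measure,
    lintegral_count, tsum_fintype, Measure.count_univ, ENat.card_eq_coe_fintype_card, card_V,
    smul_eq_mul, mul_comm, div_eq_mul_inv]
  simp

lemma annealed_apply {S : Set (Sample N)} (hS : MeasurableSet S) :
    annealed N S = ∫⁻ E, (∑ z, noise N {ξ | (E, z, ξ) ∈ S}) / 2 ^ N ∂energyLaw N := by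
  rw [annealed, Measure.prod_apply hS]
  refine lintegral_congr fun E => ?_
  rw [Measure.prod_apply (measurable_prodMk_left hS), lintegral_uniformOn]
  rfl

lemma annealed_hit (a : ℝ) (A : (V N → ℝ) → Finset (V N))
    (hA : ∀ y, MeasurableSet {E | y ∈ A E}) (s : ℝ) :
    annealed N {ω | ∃ n, (jumps a ω.1 ω.2.1 ω.2.2 n).2 ≤ s ∧
      (jumps a ω.1 ω.2.1 ω.2.2 n).1 ∈ A ω.1}
      = ∫⁻ E, ENNReal.ofReal (hitP a E (A E) s) ∂energyLaw N := by
  rw [annealed_apply (measurableSet_hit a A hA s)]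
  refine lintegral_congr fun E => ?_
  rw [hitP, ENNReal.ofReal_div_of_pos (by positivity),
    ENNReal.ofReal_sum_of_nonneg fun z _ => measureReal_nonneg,
    ENNReal.ofReal_pow (by norm_num), ENNReal.ofReal_ofNat]
  congr 1
  refine Finset.sum_congr rfl fun z _ => ?_
  rw [ofReal_measureReal]
  rfl

lemma regular_iff {a : ℝ} {E : V N → ℝ} {z : V N} {ξ : ℕ → Fin N → ℝ} :
    Regular a E z ξ ↔ (∀ n, (jumps a E z ξ n).2 < (jumps a E z ξ (n + 1)).2) ∧
      ∀ k : ℕ, ∃ n, (k : ℝ) ≤ (jumps a E z ξ n).2 := by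
  constructor
  · intro h
    exact ⟨fun n => h.1 (Nat.lt_succ_self n), fun k => (h.2.eventually_ge_atTop _).exists⟩
  · rintro ⟨h1, h2⟩
    have hm := strictMono_nat_of_lt_succ h1
    refine ⟨hm, tendsto_atTop_atTop_of_monotone hm.monotone fun b => ?_⟩
    obtain ⟨k, hk⟩ := exists_nat_ge b
    obtain ⟨n, hn⟩ := h2 k
    exact ⟨n, hk.trans hn⟩

lemma ae_annealed_regular (hN : 1 ≤ N) (a : ℝ) :
    ∀ᵐ ω ∂annealed N, Regular a ω.1 ω.2.1 ω.2.2 := by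
  have hm := measurable_jumps (N := N) a
  have hS : MeasurableSet {ω : Sample N | Regular a ω.1 ω.2.1 ω.2.2} := by
    simp only [regular_iff]
    rw [Set.ofPred_and]
    refine MeasurableSet.inter ?_ ?_
    · rw [Set.ofPred_forall]
      exact MeasurableSet.iInter fun n => measurableSet_lt (measurable_snd.comp (hm n))
        (measurable_snd.comp (hm (n + 1)))
    · rw [Set.ofPred_forall]
      refine MeasurableSet.iInter fun k => ?_
      rw [Set.ofPred_exists]
      exact MeasurableSet.iUnion fun n => measurableSet_le measurable_const
        (measurable_snd.comp (hm n))
  rw [ae_iff]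
  have hS' : MeasurableSet {ω : Sample N | ¬ Regular a ω.1 ω.2.1 ω.2.2} := hS.compl
  rw [annealed_apply hS']
  have : ∀ (E : V N → ℝ) z, noise N {ξ | ¬ Regular a E z ξ} = 0 :=
    fun E z => ae_iff.1 (ae_regular hN a E z)
  simp [this]

lemma ae_posGaussian_nonneg : ∀ᵐ x ∂posGaussian, 0 ≤ x := by
  rw [posGaussian, ae_map_iff (by fun_prop) measurableSet_Ici]
  exact Eventually.of_forall fun x => le_max_right _ _

lemma ae_energy_nonneg : ∀ᵐ E ∂energyLaw N, ∀ x, 0 ≤ E x := by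
  rw [ae_all_iff]
  intro x
  exact (Measure.quasiMeasurePreserving_eval (fun _ : V N => posGaussian) x).ae
    ae_posGaussian_nonneg

lemma ae_annealed_nonneg : ∀ᵐ ω ∂annealed N, ∀ x, 0 ≤ ω.1 x :=
  (Measure.quasiMeasurePreserving_fst (μ := energyLaw N)).ae ae_energy_nonneg

/-- The expected number of discovered sites as a sum of hitting probabilities. -/
lemma dScale_eq (hN : 1 ≤ N) (a t : ℝ) :
    dScale N a t = ∑ x : V N, (∫⁻ E, ENNReal.ofReal (hitP a E (ball x) t) ∂energyLaw N).toReal := by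
  set H : V N → Set (Sample N) := fun x => {ω | ∃ n, (jumps a ω.1 ω.2.1 ω.2.2 n).2 ≤ t ∧
      (jumps a ω.1 ω.2.1 ω.2.2 n).1 ∈ ball x} with hH
  have hHm : ∀ x, MeasurableSet (H x) := fun x =>
    measurableSet_hit a (fun _ => ball x) (fun y => MeasurableSet.const _) t
  have hae : ∀ᵐ ω ∂annealed N, ((discovered a ω t).ncard : ℝ)
      = ∑ x, (H x).indicator (fun _ => (1 : ℝ)) ω := by
    filter_upwards [ae_annealed_regular hN a] with ω hω
    have hset : ∀ x, x ∈ discovered a ω t ↔ ω ∈ H x := fun x => by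
      have := hω.exists_walk_iff (fun y => hammingDist y x ≤ 1) t
      simp only [hH, Set.mem_ofPred_eq, mem_ball_iff, hammingDist_comm x]
      exact this
    classical
    have h1 : discovered a ω t = ↑(Finset.univ.filter fun x => ω ∈ H x) := by
      ext x; simp [hset]
    rw [h1, Set.ncard_coe_finset, Finset.card_filter]
    push_cast
    refine Finset.sum_congr rfl fun x _ => ?_
    rw [Set.indicator_apply]
  rw [dScale, integral_congr_ae hae, integral_finsetSum]
  · refine Finset.sum_congr rfl fun x _ => ?_
    rw [integral_indicator (hHm x)]
    simp only [integral_const, smul_eq_mul, mul_one, Measure.real, Measure.restrict_apply,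
      MeasurableSet.univ, Set.univ_inter]
    congr 1
    exact annealed_hit a (fun _ => ball x) (fun y => MeasurableSet.const _) t
  · exact fun x _ => (integrable_const _).indicator (hHm x)

/-! ### Moments of the energies -/

lemma integrable_exp_posGaussian (l : ℝ) : Integrable (fun x => Real.exp (l * x)) posGaussian := by
  rw [posGaussian, integrable_map_measure (by fun_prop) (by fun_prop)]
  refine Integrable.mono' ((integrable_const 1).add (integrable_exp_mul_gaussianReal l))
    (by fun_prop) (Eventually.of_forall fun x => ?_)
  simp only [Function.comp_apply, Pi.add_apply]
  rw [Real.norm_of_nonneg (Real.exp_pos _).le]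
  rcases le_total x 0 with h | h
  · rw [max_eq_right h, mul_zero, Real.exp_zero]
    linarith [Real.exp_pos (l * x)]
  · rw [max_eq_left h]
    linarith

lemma one_le_phi {l : ℝ} (hl : 0 ≤ l) : 1 ≤ phi l := by
  have : ∫ _, (1 : ℝ) ∂posGaussian ≤ phi l := by
    refine integral_mono_ae (integrable_const 1) (integrable_exp_posGaussian l) ?_
    filter_upwards [ae_posGaussian_nonneg] with x hx
    exact Real.one_le_exp (mul_nonneg hl hx)
  simpa using this

/-- Pointwise `exp (l * max x 0) ≤ 1 + exp (l x)`, and the Gaussian moment is explicit. -/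
lemma phi_le (l : ℝ) : phi l ≤ 1 + Real.exp (l ^ 2 / 2) := by
  have h1 : ∫ x, Real.exp (l * x) ∂gaussianReal 0 1 = Real.exp (l ^ 2 / 2) := by
    have := congrFun (mgf_id_gaussianReal (μ := 0) (v := 1)) l
    simpa [mgf] using this
  rw [phi, posGaussian, integral_map (by fun_prop) (by fun_prop), ← h1]
  calc ∫ x, Real.exp (l * max x 0) ∂gaussianReal 0 1
      ≤ ∫ x, (1 + Real.exp (l * x)) ∂gaussianReal 0 1 := by
        refine integral_mono_of_nonneg (Eventually.of_forall fun x => (Real.exp_pos _).le)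
          ((integrable_const 1).add (integrable_exp_mul_gaussianReal l))
          (Eventually.of_forall fun x => ?_)
        simp only
        rcases le_total x 0 with h | h
        · rw [max_eq_right h, mul_zero, Real.exp_zero]
          linarith [Real.exp_pos (l * x)]
        · rw [max_eq_left h]
          linarith
    _ = _ := by
        rw [integral_add (integrable_const 1) (integrable_exp_mul_gaussianReal l)]
        simp

lemma exp_sum_eq_prod (a : ℝ) (s : Finset (V N)) (E : V N → ℝ) :
    Real.exp (a * ∑ v ∈ s, E v) = ∏ v, (fun x => if v ∈ s then Real.exp (a * x) else 1) (E v) := by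
  simp only
  rw [Finset.prod_ite_mem, Finset.univ_inter, Finset.mul_sum, Real.exp_sum]

lemma integral_exp_sum (a : ℝ) (s : Finset (V N)) :
    ∫ E, Real.exp (a * ∑ v ∈ s, E v) ∂energyLaw N = phi a ^ s.card := by
  simp only [exp_sum_eq_prod]
  rw [energyLaw, integral_fintype_prod_eq_prod fun v x => if v ∈ s then Real.exp (a * x) else 1]
  have : ∀ v, ∫ x, (if v ∈ s then Real.exp (a * x) else 1) ∂posGaussian
      = if v ∈ s then phi a else 1 := fun v => by
    split_ifs
    · rfl
    · simp
  simp only [this, Finset.prod_ite_mem, Finset.univ_inter, Finset.prod_const]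

lemma integrable_exp_sum (a : ℝ) (s : Finset (V N)) :
    Integrable (fun E => Real.exp (a * ∑ v ∈ s, E v)) (energyLaw N) := by
  simp only [exp_sum_eq_prod]
  refine Integrable.fintype_prod (f := fun v x => if v ∈ s then Real.exp (a * x) else 1) fun v => ?_
  split_ifs
  · exact integrable_exp_posGaussian a
  · exact integrable_const 1

/-- The two endpoints of the edge from `x + e_i` to `x + e_i + e_j`. -/
def ends (x : V N) (p : Fin N × Fin N) : Finset (V N) := {x + unit p.1, x + unit p.1 + unit p.2}

lemma ne_add_unit (x : V N) (i : Fin N) : x ≠ x + unit i := fun h => by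
  have := hammingDist_add_unit x i
  rw [← h, hammingDist_self] at this
  exact absurd this (by norm_num)

lemma card_ends (x : V N) (p : Fin N × Fin N) : (ends x p).card = 2 :=
  Finset.card_pair (ne_add_unit _ _)

lemma cond_eq_exp (a : ℝ) (E : V N → ℝ) (x : V N) (p : Fin N × Fin N) :
    cond a E (x + unit p.1) p.2 = Real.exp (a * ∑ v ∈ ends x p, E v) := by
  rw [ends, Finset.sum_pair (ne_add_unit _ _), cond, rate]

lemma cond_sq_eq_exp (a : ℝ) (E : V N → ℝ) (x : V N) (p : Fin N × Fin N) :
    cond a E (x + unit p.1) p.2 ^ 2 = Real.exp (2 * a * ∑ v ∈ ends x p, E v) := by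
  rw [cond_eq_exp, ← Real.exp_nat_mul]
  congr 1
  push_cast
  ring

/-- Two edges leaving the ball share an endpoint only if they start at the same neighbour of `x` or,
the directions being swapped, end at the same point. All other pairs have independent conductances.
-/
lemma disjoint_ends (x : V N) {p p' : Fin N × Fin N} (hp : p ∈ pairs N) (hp' : p' ∈ pairs N)
    (h1 : p.1 ≠ p'.1) (h2 : p ≠ p'.swap) : Disjoint (ends x p) (ends x p') := by
  obtain ⟨i, j⟩ := p
  obtain ⟨i', j'⟩ := p'
  rw [mem_pairs] at hp hp'
  simp only at h1 hp hp'
  rw [Finset.disjoint_left]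
  intro v hv hv'
  simp only [ends, Finset.mem_insert, Finset.mem_singleton] at hv hv'
  rcases hv with rfl | rfl <;> rcases hv' with h | h
  · exact h1 (unit_injective (add_left_cancel h))
  · rw [add_assoc] at h
    have := congrFun (add_left_cancel h) i'
    simp [unit_apply, h1.symm, hp'] at this
  · rw [add_assoc] at h
    have := congrFun (add_left_cancel h) i
    simp [unit_apply, h1, hp] at this
  · rw [add_assoc, add_assoc] at h
    have h3 := congrFun (add_left_cancel h) i
    have h4 := congrFun (add_left_cancel h) j
    simp only [Pi.add_apply, unit_apply, if_true, h1, hp, hp.symm, if_false] at h3 h4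
    have h5 : i = j' := by
      by_contra hne
      simp [hne] at h3
    have h6 : j = i' := by
      by_contra hne
      rw [← h5] at h4
      simp [hne, hp.symm] at h4
    exact h2 (by simp [h5, h6])

/-- A variance bound for a sum of variables most of whose pairs are uncorrelated. -/
lemma integral_sq_sum_sub_le {Ω ι : Type*} [MeasurableSpace Ω] (P : Measure Ω)
    [IsProbabilityMeasure P] (s : Finset ι) (X : ι → Ω → ℝ) (m M : ℝ) (R : ℕ) (hM : 0 ≤ M)
    (rel : ι → ι → Prop) [DecidableRel rel] (hX : ∀ k ∈ s, Integrable (X k) P)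
    (hXX : ∀ k ∈ s, ∀ l ∈ s, Integrable (fun ω => X k ω * X l ω) P)
    (hm : ∀ k ∈ s, ∫ ω, X k ω ∂P = m)
    (hrel : ∀ k ∈ s, ∀ l ∈ s, rel k l → ∫ ω, X k ω * X l ω ∂P ≤ M)
    (hnrel : ∀ k ∈ s, ∀ l ∈ s, ¬ rel k l → ∫ ω, X k ω * X l ω ∂P = m ^ 2)
    (hR : ∀ k ∈ s, (s.filter (rel k)).card ≤ R) :
    Integrable (fun ω => (∑ k ∈ s, X k ω - s.card * m) ^ 2) P ∧
      ∫ ω, (∑ k ∈ s, X k ω - s.card * m) ^ 2 ∂P ≤ s.card * R * M := by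
  have hexp : ∀ ω, (∑ k ∈ s, X k ω - s.card * m) ^ 2
      = ∑ k ∈ s, ∑ l ∈ s, (X k ω * X l ω - m * X k ω - m * X l ω + m ^ 2) := fun ω => by
    have h1 : ∑ k ∈ s, X k ω - s.card * m = ∑ k ∈ s, (X k ω - m) := by
      rw [Finset.sum_sub_distrib, Finset.sum_const, nsmul_eq_mul]
    rw [h1, sq, Finset.sum_mul_sum]
    exact Finset.sum_congr rfl fun k _ => Finset.sum_congr rfl fun l _ => by ring
  have hInt : ∀ k ∈ s, ∀ l ∈ s,
      Integrable (fun ω => X k ω * X l ω - m * X k ω - m * X l ω + m ^ 2) P := fun k hk l hl =>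
    (((hXX k hk l hl).sub ((hX k hk).const_mul m)).sub ((hX l hl).const_mul m)).add
      (integrable_const _)
  simp only [hexp]
  refine ⟨integrable_finsetSum _ fun k hk => integrable_finsetSum _ fun l hl => hInt k hk l hl, ?_⟩
  rw [integral_finsetSum _ fun k hk => integrable_finsetSum _ fun l hl => hInt k hk l hl]
  have hk : ∀ k ∈ s, ∫ ω, ∑ l ∈ s, (X k ω * X l ω - m * X k ω - m * X l ω + m ^ 2) ∂P
      ≤ R * M := fun k hk => by
    rw [integral_finsetSum _ fun l hl => hInt k hk l hl]
    calc _ ≤ ∑ l ∈ s, if rel k l then M else 0 := by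
          refine Finset.sum_le_sum fun l hl => ?_
          have e1 := (hX k hk).const_mul m
          have e2 := (hX l hl).const_mul m
          have e3 : Integrable (fun ω => X k ω * X l ω - m * X k ω) P := (hXX k hk l hl).sub e1
          have e4 : Integrable (fun ω => X k ω * X l ω - m * X k ω - m * X l ω) P := e3.sub e2
          rw [integral_add e4 (integrable_const _), integral_sub e3 e2,
            integral_sub (hXX k hk l hl) e1,
            integral_const_mul, integral_const_mul, hm k hk, hm l hl]
          simp only [integral_const, probReal_univ, one_smul]
          split_ifs with h
          · have := hrel k hk l hl h
            nlinarith
          · have := hnrel k hk l hl h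
            nlinarith
      _ = (s.filter (rel k)).card * M := by
          rw [← Finset.sum_filter, Finset.sum_const, nsmul_eq_mul]
      _ ≤ R * M := mul_le_mul_of_nonneg_right (by exact_mod_cast hR k hk) hM
  refine (Finset.sum_le_sum hk).trans (le_of_eq ?_)
  rw [Finset.sum_const, nsmul_eq_mul, mul_assoc]

lemma integral_outflow (a : ℝ) (x : V N) :
    Integrable (fun E => outflow (cond a E) x) (energyLaw N) ∧
      ∫ E, outflow (cond a E) x ∂energyLaw N = N * (N - 1) * phi a ^ 2 := by
  simp only [outflow, cond_eq_exp]
  refine ⟨integrable_finsetSum _ fun p _ => integrable_exp_sum a _, ?_⟩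
  rw [integral_finsetSum _ fun p _ => integrable_exp_sum a _]
  simp only [integral_exp_sum, card_ends]
  rw [Finset.sum_const, nsmul_eq_mul, card_pairs]

lemma integral_outflowSq (a : ℝ) (x : V N) :
    Integrable (fun E => outflowSq (cond a E) x) (energyLaw N) ∧
      ∫ E, outflowSq (cond a E) x ∂energyLaw N = N * (N - 1) * phi (2 * a) ^ 2 := by
  simp only [outflowSq, cond_sq_eq_exp]
  refine ⟨integrable_finsetSum _ fun p _ => integrable_exp_sum _ _, ?_⟩
  rw [integral_finsetSum _ fun p _ => integrable_exp_sum _ _]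
  simp only [integral_exp_sum, card_ends]
  rw [Finset.sum_const, nsmul_eq_mul, card_pairs]

/-- Each of the `N (N - 1)` edges is correlated with at most `N + 1` others: `N` with the same first
direction and the swapped one. Hence a variance of order `N³`, against a squared mean of order `N⁴`.
-/
lemma integral_sq_outflow_sub_le (hN : 1 ≤ N) (a : ℝ) (x : V N) :
    Integrable (fun E => (outflow (cond a E) x - N * (N - 1) * phi a ^ 2) ^ 2) (energyLaw N) ∧
      ∫ E, (outflow (cond a E) x - N * (N - 1) * phi a ^ 2) ^ 2 ∂energyLaw N
        ≤ 2 * N ^ 3 * phi (2 * a) ^ 2 := by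
  have hprod : ∀ p p' : Fin N × Fin N, ∀ E : V N → ℝ, cond a E (x + unit p.1) p.2 *
      cond a E (x + unit p'.1) p'.2
      = Real.exp (a * ∑ v ∈ ends x p, E v) * Real.exp (a * ∑ v ∈ ends x p', E v) :=
    fun p p' E => by rw [cond_eq_exp, cond_eq_exp]
  have hle : ∀ p p' : Fin N × Fin N, ∀ E : V N → ℝ, cond a E (x + unit p.1) p.2 *
      cond a E (x + unit p'.1) p'.2 ≤ 1 / 2 * Real.exp (2 * a * ∑ v ∈ ends x p, E v)
        + 1 / 2 * Real.exp (2 * a * ∑ v ∈ ends x p', E v) := fun p p' E => by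
    rw [← cond_sq_eq_exp, ← cond_sq_eq_exp]
    nlinarith [sq_nonneg (cond a E (x + unit p.1) p.2 - cond a E (x + unit p'.1) p'.2)]
  have hdom : ∀ p p' : Fin N × Fin N, Integrable (fun E => 1 / 2 *
      Real.exp (2 * a * ∑ v ∈ ends x p, E v) + 1 / 2 * Real.exp (2 * a * ∑ v ∈ ends x p', E v))
      (energyLaw N) := fun p p' =>
    ((integrable_exp_sum _ _).const_mul _).add ((integrable_exp_sum _ _).const_mul _)
  have hXX : ∀ p p' : Fin N × Fin N, Integrable (fun E => cond a E (x + unit p.1) p.2 *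
      cond a E (x + unit p'.1) p'.2) (energyLaw N) := fun p p' => by
    refine Integrable.mono' (hdom p p') ?_ (Eventually.of_forall fun E => ?_)
    · simp only [hprod]
      fun_prop
    · rw [Real.norm_of_nonneg (mul_nonneg (cond_pos _ _ _ _).le (cond_pos _ _ _ _).le)]
      exact hle p p' E
  obtain ⟨h1, h2⟩ := integral_sq_sum_sub_le (energyLaw N) (pairs N)
    (fun p E => cond a E (x + unit p.1) p.2) (phi a ^ 2) (phi (2 * a) ^ 2) (N + 1) (sq_nonneg _)
    (fun p p' => p.1 = p'.1 ∨ p = p'.swap)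
    (fun p _ => by simpa only [cond_eq_exp] using integrable_exp_sum a _)
    (fun p _ p' _ => hXX p p')
    (fun p _ => by simp only [cond_eq_exp, integral_exp_sum, card_ends])
    (fun p _ p' _ _ => by
      refine (integral_mono (hXX p p') (hdom p p') (hle p p')).trans (le_of_eq ?_)
      rw [integral_add ((integrable_exp_sum _ _).const_mul _)
        ((integrable_exp_sum _ _).const_mul _),
        integral_const_mul, integral_const_mul, integral_exp_sum, integral_exp_sum, card_ends,
        card_ends]
      ring)
    (fun p hp p' hp' h => by
      push Not at h
      have hd := disjoint_ends x hp hp' h.1 h.2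
      have : ∀ E : V N → ℝ, cond a E (x + unit p.1) p.2 * cond a E (x + unit p'.1) p'.2
          = Real.exp (a * ∑ v ∈ ends x p ∪ ends x p', E v) := fun E => by
        rw [Finset.sum_union hd, mul_add, Real.exp_add, cond_eq_exp, cond_eq_exp]
      simp only [this, integral_exp_sum, Finset.card_union_of_disjoint hd, card_ends]
      ring)
    (fun p hp => by
      calc _ ≤ ((Finset.univ.image fun j => (p.1, j)) ∪ {p.swap}).card := by
            refine Finset.card_le_card fun p' hp' => ?_
            rw [Finset.mem_union, Finset.mem_singleton, Finset.mem_image]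
            rcases (Finset.mem_filter.1 hp').2 with h | h
            · exact Or.inl ⟨p'.2, Finset.mem_univ _, by rw [h]⟩
            · exact Or.inr (by rw [h, Prod.swap_swap])
        _ ≤ N + 1 := by
            refine (Finset.card_union_le _ _).trans (Nat.add_le_add ?_ (by simp))
            exact Finset.card_image_le.trans (by simp))
  rw [card_pairs] at h1 h2
  refine ⟨h1, h2.trans ?_⟩
  push_cast
  have hN1 : (1 : ℝ) ≤ N := by exact_mod_cast hN
  have h3 : (N : ℝ) * (N - 1) * (N + 1) ≤ 2 * N ^ 3 := by
    nlinarith [pow_pos (zero_lt_one.trans_le hN1) 3]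
  exact mul_le_mul_of_nonneg_right h3 (sq_nonneg _)

/-- The environment around `x` is typical. -/
def Good (a η : ℝ) (E : V N → ℝ) (x : V N) : Prop :=
  |outflow (cond a E) x - N ^ 2 * phi a ^ 2| ≤ η * (N ^ 2 * phi a ^ 2) ∧
    outflowSq (cond a E) x ≤ √N * N ^ 2 * phi (2 * a) ^ 2

lemma measurable_cond (a : ℝ) (y : V N) (i : Fin N) : Measurable fun E => cond a E y i := by
  unfold cond rate; fun_prop

lemma measurable_outflow (a : ℝ) (x : V N) : Measurable fun E => outflow (cond a E) x :=
  Finset.measurable_fun_sum _ fun _ _ => measurable_cond a _ _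

lemma measurable_outflowSq (a : ℝ) (x : V N) : Measurable fun E => outflowSq (cond a E) x :=
  Finset.measurable_fun_sum _ fun _ _ => (measurable_cond a _ _).pow_const 2

lemma measurableSet_good (a η : ℝ) (x : V N) : MeasurableSet {E : V N → ℝ | Good a η E x} := by
  unfold Good
  rw [Set.ofPred_and]
  exact (measurableSet_le ((measurable_outflow a x).sub_const _).abs measurable_const).inter
    (measurableSet_le (measurable_outflowSq a x) measurable_const)

/-- Chebyshev for `outflow` and Markov for `outflowSq`; the factor `√N` in `Good` is the room for
the latter. -/
lemma measure_not_good_le {a η : ℝ} (hη : 0 < η) (ha : 0 ≤ a) (hN : 1 ≤ N) (hNη : 2 / η ≤ N)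
    (x : V N) :
    (energyLaw N).real {E | ¬ Good a η E x} ≤ 8 * phi (2 * a) ^ 2 / (η ^ 2 * N) + 1 / √N := by
  have hN0 : (0 : ℝ) < N := by exact_mod_cast hN
  have hφ : 1 ≤ phi a := one_le_phi ha
  have hφ2 : 1 ≤ phi (2 * a) := one_le_phi (by linarith)
  set m : ℝ := N * (N - 1) * phi a ^ 2 with hm
  obtain ⟨i1, i2⟩ := integral_sq_outflow_sub_le hN a x
  obtain ⟨j1, j2⟩ := integral_outflowSq a x
  have hsub : {E : V N → ℝ | ¬ Good a η E x} ⊆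
      {E | (η / 2 * (N ^ 2 * phi a ^ 2)) ^ 2 ≤ (outflow (cond a E) x - m) ^ 2} ∪
      {E | √N * N ^ 2 * phi (2 * a) ^ 2 ≤ outflowSq (cond a E) x} := by
    intro E hE
    by_contra hcon
    rw [Set.mem_union, not_or] at hcon
    obtain ⟨h1, h2⟩ := hcon
    rw [Set.mem_ofPred_eq, not_le] at h1 h2
    refine hE ⟨?_, h2.le⟩
    have h3 : |outflow (cond a E) x - m| < η / 2 * (N ^ 2 * phi a ^ 2) :=
      abs_lt_of_sq_lt_sq h1 (by positivity)
    -- Half of the tolerance pays for replacing the exact mean, with `N (N - 1)`, by `N²`.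
    have h4 : |m - N ^ 2 * phi a ^ 2| ≤ η / 2 * (N ^ 2 * phi a ^ 2) := by
      have : m - N ^ 2 * phi a ^ 2 = -(N * phi a ^ 2) := by rw [hm]; ring
      rw [this, abs_neg, abs_of_pos (by positivity)]
      have : 1 ≤ η / 2 * N := by
        rw [div_le_iff₀ hη] at hNη
        linarith
      have := mul_le_mul_of_nonneg_right this (by positivity : (0 : ℝ) ≤ N * phi a ^ 2)
      linarith
    calc _ ≤ |outflow (cond a E) x - m| + |m - N ^ 2 * phi a ^ 2| := by
          have := abs_add_le (outflow (cond a E) x - m) (m - N ^ 2 * phi a ^ 2)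
          rwa [sub_add_sub_cancel] at this
      _ ≤ _ := by linarith
  have hA : (energyLaw N).real {E | (η / 2 * (N ^ 2 * phi a ^ 2)) ^ 2
      ≤ (outflow (cond a E) x - m) ^ 2} ≤ 8 * phi (2 * a) ^ 2 / (η ^ 2 * N) := by
    have h1 := mul_meas_ge_le_integral_of_nonneg (Eventually.of_forall fun E => sq_nonneg _) i1
      ((η / 2 * (N ^ 2 * phi a ^ 2)) ^ 2)
    have h2 := h1.trans i2
    rw [mul_comm, ← le_div_iff₀ (by positivity)] at h2
    refine h2.trans ?_
    rw [div_le_div_iff₀ (by positivity) (by positivity)]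
    have h4 : 1 ≤ phi a ^ 4 := one_le_pow₀ hφ
    have h5 : 0 ≤ 2 * N ^ 3 * phi (2 * a) ^ 2 * (η ^ 2 * N) := by positivity
    calc 2 * (N : ℝ) ^ 3 * phi (2 * a) ^ 2 * (η ^ 2 * N)
        ≤ 2 * N ^ 3 * phi (2 * a) ^ 2 * (η ^ 2 * N) * phi a ^ 4 := le_mul_of_one_le_right h5 h4
      _ = _ := by ring
  have hB : (energyLaw N).real {E | √N * N ^ 2 * phi (2 * a) ^ 2 ≤ outflowSq (cond a E) x}
      ≤ 1 / √N := by
    have h0 : 0 ≤ᵐ[energyLaw N] fun E => outflowSq (cond a E) x :=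
      Eventually.of_forall fun E => Finset.sum_nonneg fun _ _ => sq_nonneg _
    have h1 := mul_meas_ge_le_integral_of_nonneg h0 j1 (√N * N ^ 2 * phi (2 * a) ^ 2)
    rw [j2, mul_comm, ← le_div_iff₀ (by positivity)] at h1
    refine h1.trans ?_
    have hs : 0 < √(N : ℝ) := Real.sqrt_pos.2 hN0
    rw [div_le_div_iff₀ (by positivity) hs]
    have : 0 ≤ √(N : ℝ) * N * phi (2 * a) ^ 2 := by positivity
    nlinarith
  calc _ ≤ _ := measureReal_mono hsub
    _ ≤ _ := measureReal_union_le _ _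
    _ ≤ _ := add_le_add hA hB

/-! ### Independence of the energy at a site and its surroundings -/

/-- Resampling the coordinate `x` leaves the product law and `g` unchanged, which is the
independence of `E x` from the rest. -/
lemma lintegral_indicator_mul (x : V N) {B : Set ℝ} (hB : MeasurableSet B)
    (g : (V N → ℝ) → ℝ≥0∞) (hg : Measurable g) (hgx : ∀ E t, g (Function.update E x t) = g E) :
    ∫⁻ E, {E : V N → ℝ | E x ∈ B}.indicator g E ∂energyLaw N
      = posGaussian B * ∫⁻ E, g E ∂energyLaw N := by
  have hmp := measurePreserving_update_infinitePi (ι := V N) posGaussian x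
  rw [Measure.infinitePi_eq_pi] at hmp
  have hm : MeasurableSet {E : V N → ℝ | E x ∈ B} := measurable_pi_apply x hB
  have hgm := hg.indicator hm
  rw [energyLaw, ← hmp.lintegral_comp hgm]
  refine (lintegral_prod _ (hgm.comp hmp.measurable).aemeasurable).trans ?_
  rw [← lintegral_const_mul _ hg]
  refine lintegral_congr fun E => ?_
  have : ∀ t, ({E : V N → ℝ | E x ∈ B}.indicator g ∘ fun p : (V N → ℝ) × ℝ =>
      Function.update p.1 x p.2) (E, t) = B.indicator (fun _ => g E) t := fun t => by
    by_cases ht : t ∈ B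
    · rw [Set.indicator_of_mem ht, Function.comp_apply, Set.indicator_of_mem, hgx]
      simpa using ht
    · rw [Set.indicator_of_notMem ht, Function.comp_apply, Set.indicator_of_notMem]
      simpa using ht
  simp only [this]
  rw [lintegral_indicator hB, setLIntegral_const, mul_comm]

/-- The edges leaving the ball join sites at distances one and two from `x`; none touches `x`. So
being typical is independent of being a deep trap. -/
lemma outflow_update (a : ℝ) (E : V N → ℝ) (x : V N) (t : ℝ) :
    outflow (cond a (Function.update E x t)) x = outflow (cond a E) x ∧
      outflowSq (cond a (Function.update E x t)) x = outflowSq (cond a E) x := by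
  have : ∀ p ∈ pairs N, cond a (Function.update E x t) (x + unit p.1) p.2
      = cond a E (x + unit p.1) p.2 := fun p hp => by
    rw [cond, cond, rate, rate, Function.update_of_ne (ne_add_unit x p.1).symm,
      Function.update_of_ne]
    intro h
    rw [add_assoc] at h
    have := congrFun (add_eq_left.1 h) p.1
    simp [unit_apply, mem_pairs.1 hp] at this
  exact ⟨Finset.sum_congr rfl this, Finset.sum_congr rfl fun p hp => by rw [this p hp]⟩

lemma good_update (a η : ℝ) (E : V N → ℝ) (x : V N) (t : ℝ) :
    Good a η (Function.update E x t) x ↔ Good a η E x := by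
  rw [Good, Good, (outflow_update a E x t).1, (outflow_update a E x t).2]

/-! ### Counting deep traps -/

/-- Changing one coordinate of `y` towards `x` shows that each larger ball is covered by the unit
balls around the points of the previous one. -/
lemma card_hammingDist_le (x : V N) (k : ℕ) :
    (Finset.univ.filter fun y : V N => hammingDist x y ≤ k).card ≤ (N + 1) ^ k := by
  induction k with
  | zero =>
    simp only [Nat.le_zero, hammingDist_eq_zero, pow_zero]
    rw [Finset.card_le_one]
    intro y hy z hz
    rw [← (Finset.mem_filter.1 hy).2, ← (Finset.mem_filter.1 hz).2]
  | succ k ih =>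
    have hsub : (Finset.univ.filter fun y : V N => hammingDist x y ≤ k + 1) ⊆
        (Finset.univ.filter fun y : V N => hammingDist x y ≤ k).biUnion ball := by
      intro y hy
      have hy := (Finset.mem_filter.1 hy).2
      rw [Finset.mem_biUnion]
      by_cases hxy : x = y
      · exact ⟨x, by simp, by simp [mem_ball_iff, hxy]⟩
      obtain ⟨i, hi⟩ := Function.ne_iff.1 hxy
      refine ⟨Function.update y i (x i), ?_, ?_⟩
      · simp only [Finset.mem_filter, Finset.mem_univ, true_and]
        refine Nat.le_of_lt_succ (lt_of_lt_of_le (Finset.card_lt_card ?_) hy)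
        refine Finset.ssubset_iff_of_subset (fun j hj => ?_) |>.2 ⟨i, by simpa using hi, by simp⟩
        simp only [Finset.mem_filter, Finset.mem_univ, true_and] at hj ⊢
        by_cases hji : j = i
        · subst hji; simp at hj
        · rwa [Function.update_of_ne hji] at hj
      · rw [mem_ball_iff]
        refine (Finset.card_le_card (t := {i}) fun j hj => ?_).trans (by simp)
        simp only [Finset.mem_filter, Finset.mem_univ, true_and] at hj
        by_contra hji
        rw [Finset.mem_singleton] at hji
        exact hj (Function.update_of_ne hji _ _)
    have hb : ∀ z : V N, (ball z).card = N + 1 := fun z => by exact_mod_cast card_ball z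
    calc _ ≤ _ := Finset.card_le_card hsub
      _ ≤ _ := Finset.card_biUnion_le_card_mul _ _ (N + 1) fun z _ => (hb z).le
      _ ≤ (N + 1) ^ k * (N + 1) := Nat.mul_le_mul_right _ ih
      _ = _ := (pow_succ _ _).symm

lemma energyLaw_inter (x : V N) {B : Set ℝ} (hB : MeasurableSet B) {A : Set (V N → ℝ)}
    (hA : MeasurableSet A) (hAx : ∀ E t, Function.update E x t ∈ A ↔ E ∈ A) :
    energyLaw N ({E | E x ∈ B} ∩ A) = posGaussian B * energyLaw N A := by
  have hm : MeasurableSet {E : V N → ℝ | E x ∈ B} := measurable_pi_apply x hB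
  have := lintegral_indicator_mul x hB (A.indicator 1) (measurable_one.indicator hA) fun E t => by
    by_cases h : E ∈ A
    · rw [Set.indicator_of_mem h, Set.indicator_of_mem ((hAx E t).2 h)]; rfl
    · rw [Set.indicator_of_notMem h, Set.indicator_of_notMem (mt (hAx E t).1 h)]
  rwa [Set.indicator_indicator, lintegral_indicator_one (hm.inter hA),
    lintegral_indicator_one hA] at this

lemma energyLaw_real_inter (x : V N) {B : Set ℝ} (hB : MeasurableSet B) {A : Set (V N → ℝ)}
    (hA : MeasurableSet A) (hAx : ∀ E t, Function.update E x t ∈ A ↔ E ∈ A) :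
    (energyLaw N).real ({E | E x ∈ B} ∩ A) = posGaussian.real B * (energyLaw N).real A := by
  rw [Measure.real, energyLaw_inter x hB hA hAx, ENNReal.toReal_mul]; rfl

lemma energyLaw_real_eval (x : V N) {B : Set ℝ} (hB : MeasurableSet B) :
    (energyLaw N).real {E | E x ∈ B} = posGaussian.real B := by
  have := energyLaw_real_inter x hB MeasurableSet.univ fun E t => Iff.rfl
  simpa using this

lemma energyLaw_real_eval_eval {x y : V N} (hxy : x ≠ y) {B : Set ℝ} (hB : MeasurableSet B) :
    (energyLaw N).real ({E | E x ∈ B} ∩ {E | E y ∈ B}) = posGaussian.real B ^ 2 := by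
  rw [energyLaw_real_inter x hB (A := {E | E y ∈ B}) (measurable_pi_apply y hB),
    energyLaw_real_eval y hB, sq]
  intro E t
  simp only [Set.mem_ofPred_eq, Function.update_of_ne hxy.symm]

open Classical in
/-- The deep traps: the sites where the energy is at least `h`. -/
def deep (h : ℝ) (E : V N → ℝ) : Finset (V N) := Finset.univ.filter fun x => h ≤ E x

open Classical in
/-- The deep traps in a typical environment and far from the other deep traps. -/
def goodTraps (a η h : ℝ) (E : V N → ℝ) : Finset (V N) :=
  (deep h E).filter fun x => Good a η E x ∧ ∀ y, h ≤ E y → hammingDist x y ≤ 6 → x = y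

lemma mem_deep {h : ℝ} {E : V N → ℝ} {x : V N} : x ∈ deep h E ↔ h ≤ E x := by simp [deep]

lemma mem_goodTraps {a η h : ℝ} {E : V N → ℝ} {x : V N} : x ∈ goodTraps a η h E ↔
    h ≤ E x ∧ Good a η E x ∧ ∀ y, h ≤ E y → hammingDist x y ≤ 6 → x = y := by
  simp only [goodTraps, Finset.mem_filter, mem_deep]

lemma card_deep (h : ℝ) (E : V N → ℝ) :
    ((deep h E).card : ℝ) = ∑ x, {E : V N → ℝ | E x ∈ Set.Ici h}.indicator 1 E := by
  classical
  have : ∀ x, {E : V N → ℝ | E x ∈ Set.Ici h}.indicator (1 : (V N → ℝ) → ℝ) E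
      = if x ∈ deep h E then 1 else 0 := fun x => by
    simp only [Set.indicator_apply, mem_deep]; rfl
  simp only [this, Finset.sum_ite_mem, Finset.univ_inter, Finset.sum_const, nsmul_eq_mul, mul_one]

lemma separated_goodTraps (a η h : ℝ) (E : V N → ℝ) : Separated (goodTraps a η h E) :=
  fun _ hx y hy hxy => (mem_goodTraps.1 hx).2.2 y (mem_goodTraps.1 hy).1 hxy

lemma measurableSet_le_eval (h : ℝ) (x : V N) : MeasurableSet {E : V N → ℝ | h ≤ E x} :=
  measurable_pi_apply x measurableSet_Ici

lemma measurableSet_mem_goodTraps (a η h : ℝ) (x : V N) :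
    MeasurableSet {E | x ∈ goodTraps a η h E} := by
  have : {E : V N → ℝ | x ∈ goodTraps a η h E} = {E | h ≤ E x} ∩ ({E | Good a η E x} ∩
      ⋂ y, ({E | h ≤ E y}ᶜ ∪ {_E | hammingDist x y ≤ 6 → x = y})) := by
    ext E
    simp only [mem_goodTraps, Set.mem_ofPred_eq, Set.mem_inter_iff,
      Set.mem_iInter, Set.mem_union, Set.mem_compl_iff, imp_iff_not_or]
  rw [this]
  exact (measurableSet_le_eval h x).inter ((measurableSet_good a η x).inter
    (MeasurableSet.iInter fun y => (measurableSet_le_eval h y).compl.union (MeasurableSet.const _)))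

/-- Chebyshev for a sum of independent indicators; only the diagonal pairs contribute to the
variance. -/
lemma measure_card_deep_lt {h p : ℝ} (hp : p = posGaussian.real (Set.Ici h)) (hp0 : 0 < p) :
    (energyLaw N).real {E | ((deep h E).card : ℝ) < 2 ^ N * p / 2} ≤ 4 / (2 ^ N * p) := by
  classical
  set X : V N → (V N → ℝ) → ℝ := fun x => {E : V N → ℝ | E x ∈ Set.Ici h}.indicator 1 with hX
  have hm : ∀ x : V N, MeasurableSet {E : V N → ℝ | E x ∈ Set.Ici h} := measurableSet_le_eval h
  have hXX : ∀ x y, (fun E => X x E * X y E) =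
      ({E | E x ∈ Set.Ici h} ∩ {E | E y ∈ Set.Ici h}).indicator (1 : (V N → ℝ) → ℝ) := fun x y => by
    rw [Set.inter_indicator_one]; rfl
  have hind : ∀ {A : Set (V N → ℝ)}, MeasurableSet A →
      Integrable (A.indicator (1 : (V N → ℝ) → ℝ)) (energyLaw N) := fun hA =>
    (integrable_const (1 : ℝ)).indicator hA
  have hcard : ∀ E : V N → ℝ, ((deep h E).card : ℝ) = ∑ x, X x E := card_deep h
  obtain ⟨h1, h2⟩ := integral_sq_sum_sub_le (energyLaw N) Finset.univ X p p 1 hp0.le Eq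
    (fun x _ => hind (hm x)) (fun x _ y _ => by rw [hXX]; exact hind ((hm x).inter (hm y)))
    (fun x _ => by
      rw [hX, integral_indicator_one (hm x), energyLaw_real_eval x measurableSet_Ici, hp])
    (fun x _ y _ hxy => by
      rw [hXX, integral_indicator_one ((hm x).inter (hm y)), ← hxy, Set.inter_self,
        energyLaw_real_eval x measurableSet_Ici, hp])
    (fun x _ y _ hxy => by
      rw [hXX, integral_indicator_one ((hm x).inter (hm y)),
        energyLaw_real_eval_eval hxy measurableSet_Ici, hp])
    (fun x _ => by rw [Finset.filter_eq]; simp)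
  rw [Finset.card_univ, card_V] at h1 h2
  have h3 := mul_meas_ge_le_integral_of_nonneg (Eventually.of_forall fun E => sq_nonneg _) h1
    ((2 ^ N * p / 2) ^ 2)
  have h4 := h3.trans h2
  rw [mul_comm, ← le_div_iff₀ (by positivity)] at h4
  refine (measureReal_mono fun E hE => ?_).trans (h4.trans (le_of_eq ?_))
  · rw [Set.mem_ofPred_eq, hcard] at hE
    rw [Set.mem_ofPred_eq]
    push_cast at *
    nlinarith [Finset.sum_nonneg (s := Finset.univ) (f := fun x => X x E) fun x _ =>
      Set.indicator_nonneg (fun _ _ => zero_le_one) _]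
  · push_cast
    field_simp
    norm_num

/-- Markov's inequality for the number of rejected traps. A trap fails with conditional probability
at most `b`, by independence, or because one of at most `(N + 1)^6` nearby sites is also deep. -/
lemma measure_card_bad_le {a η h p : ℝ} (hp : p = posGaussian.real (Set.Ici h)) (hp0 : 0 < p)
    {b : ℝ} (hb : ∀ x : V N, (energyLaw N).real {E | ¬ Good a η E x} ≤ b) :
    (energyLaw N).real {E | 2 ^ N * p / 4 ≤ ((deep h E \ goodTraps a η h E).card : ℝ)}
      ≤ 4 * (b + (N + 1) ^ 6 * p) := by
  classical
  set A : V N → Set (V N → ℝ) := fun x => {E | x ∈ deep h E \ goodTraps a η h E} with hA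
  have hAm : ∀ x, MeasurableSet (A x) := fun x => by
    have : A x = {E | h ≤ E x} \ {E | x ∈ goodTraps a η h E} := by
      ext E
      simp only [hA, Set.mem_ofPred_eq, Finset.mem_sdiff, mem_deep, Set.mem_sdiff]
    rw [this]
    exact (measurableSet_le_eval h x).diff (measurableSet_mem_goodTraps a η h x)
  have hcard : ∀ E : V N → ℝ, ((deep h E \ goodTraps a η h E).card : ℝ)
      = ∑ x, (A x).indicator 1 E := fun E => by
    have : ∀ x, (A x).indicator (1 : (V N → ℝ) → ℝ) E
        = if x ∈ deep h E \ goodTraps a η h E then 1 else 0 := fun x => by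
      rw [Set.indicator_apply]; rfl
    simp only [this, Finset.sum_ite_mem, Finset.univ_inter, Finset.sum_const, nsmul_eq_mul, mul_one]
  have hind : ∀ x, Integrable ((A x).indicator (1 : (V N → ℝ) → ℝ)) (energyLaw N) := fun x =>
    (integrable_const (1 : ℝ)).indicator (hAm x)
  have hAx : ∀ x, (energyLaw N).real (A x) ≤ p * (b + (N + 1) ^ 6 * p) := fun x => by
    set S := (Finset.univ.filter fun y : V N => hammingDist x y ≤ 6 ∧ x ≠ y) with hS
    have hsub : A x ⊆ ({E | E x ∈ Set.Ici h} ∩ {E | ¬ Good a η E x}) ∪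
        ⋃ y ∈ S, ({E | E x ∈ Set.Ici h} ∩ {E | E y ∈ Set.Ici h}) := by
      intro E hE
      simp only [hA, Set.mem_ofPred_eq, Finset.mem_sdiff, mem_goodTraps, mem_deep,
        not_and] at hE
      obtain ⟨h1, h2⟩ := hE
      by_cases hG : Good a η E x
      · right
        have h3 := h2 h1 hG
        push Not at h3
        obtain ⟨y, hy1, hy2, hy3⟩ := h3
        exact Set.mem_biUnion (Finset.mem_coe.2 (Finset.mem_filter.2
          ⟨Finset.mem_univ _, hy2, hy3⟩)) ⟨h1, hy1⟩
      · exact Or.inl ⟨h1, hG⟩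
    have hScard : (S.card : ℝ) ≤ (N + 1) ^ 6 := by
      have : S.card ≤ (N + 1) ^ 6 := (Finset.card_le_card fun y hy => by
        rw [hS, Finset.mem_filter] at hy
        exact Finset.mem_filter.2 ⟨hy.1, hy.2.1⟩).trans (card_hammingDist_le x 6)
      exact_mod_cast this
    calc _ ≤ _ := measureReal_mono hsub
      _ ≤ _ := measureReal_union_le _ _
      _ ≤ p * b + ∑ y ∈ S, p ^ 2 := by
          refine add_le_add ?_ ((measureReal_biUnion_finset_le _ _).trans
            (Finset.sum_le_sum fun y hy => ?_))
          · rw [energyLaw_real_inter x measurableSet_Ici (A := {E | ¬ Good a η E x})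
              (measurableSet_good a η x).compl
              fun E t => not_congr (good_update a η E x t), ← hp]
            exact mul_le_mul_of_nonneg_left (hb x) hp0.le
          · rw [energyLaw_real_eval_eval (Finset.mem_filter.1 hy).2.2 measurableSet_Ici, hp]
      _ ≤ p * (b + (N + 1) ^ 6 * p) := by
          rw [Finset.sum_const, nsmul_eq_mul]
          nlinarith [mul_le_mul_of_nonneg_right hScard (sq_nonneg p)]
  have h0 : 0 ≤ᵐ[energyLaw N] fun E => ((deep h E \ goodTraps a η h E).card : ℝ) :=
    Eventually.of_forall fun E => Nat.cast_nonneg _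
  have hi : Integrable (fun E => ((deep h E \ goodTraps a η h E).card : ℝ)) (energyLaw N) := by
    simp only [hcard]
    exact integrable_finsetSum _ fun x _ => hind x
  have h1 := mul_meas_ge_le_integral_of_nonneg h0 hi (2 ^ N * p / 4)
  have h2 : ∫ E, ((deep h E \ goodTraps a η h E).card : ℝ) ∂energyLaw N
      ≤ 2 ^ N * (p * (b + (N + 1) ^ 6 * p)) := by
    simp only [hcard]
    rw [integral_finsetSum _ fun x _ => hind x]
    calc _ ≤ ∑ _x : V N, p * (b + (N + 1) ^ 6 * p) := Finset.sum_le_sum fun x _ => by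
          rw [integral_indicator_one (hAm x)]; exact hAx x
      _ = _ := by
          rw [Finset.sum_const, Finset.card_univ, card_V, nsmul_eq_mul]; push_cast; rfl
  have h3 := h1.trans h2
  rw [mul_comm, ← le_div_iff₀ (by positivity)] at h3
  refine h3.trans (le_of_eq ?_)
  field_simp

/-- Most environments have many good traps. -/
lemma measure_card_goodTraps_lt {a η h p : ℝ} (hp : p = posGaussian.real (Set.Ici h))
    (hp0 : 0 < p) {b : ℝ} (hb : ∀ x : V N, (energyLaw N).real {E | ¬ Good a η E x} ≤ b) :
    (energyLaw N).real {E | ((goodTraps a η h E).card : ℝ) < 2 ^ N * p / 4}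
      ≤ 4 / (2 ^ N * p) + 4 * (b + (N + 1) ^ 6 * p) := by
  refine (measureReal_mono fun E hE => ?_).trans ((measureReal_union_le _ _).trans
    (add_le_add (measure_card_deep_lt hp hp0) (measure_card_bad_le hp hp0 hb)))
  by_contra hcon
  rw [Set.mem_union, Set.mem_ofPred_eq, Set.mem_ofPred_eq, not_or, not_lt, not_le] at hcon
  rw [Set.mem_ofPred_eq] at hE
  have h1 := Finset.card_sdiff_add_card_eq_card (s := goodTraps a η h E) (t := deep h E)
    fun x hx => mem_deep.2 (mem_goodTraps.1 hx).1
  have h2 : ((deep h E \ goodTraps a η h E).card : ℝ) + (goodTraps a η h E).card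
      = (deep h E).card := by exact_mod_cast h1
  linarith [hcon.1, hcon.2]

/-! ### The exploration process -/

lemma seen_mem_ball (a : ℝ) (o : Order N) (ω : Sample N) (m : ℕ) :
    seen a o ω m ∈ ball (jumps a ω.1 ω.2.1 ω.2.2 (m / (N + 1))).1 := by
  simp only [seen]
  rw [mem_ball_iff, hammingDist_eq_hammingNorm, neg_add_cancel_left]
  exact (o _ _).2

lemma exists_seen_eq (a : ℝ) (o : Order N) (ω : Sample N) {n : ℕ} {x : V N}
    (hx : x ∈ ball (jumps a ω.1 ω.2.1 ω.2.2 n).1) :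
    ∃ m, m / (N + 1) = n ∧ seen a o ω m = x := by
  set y := (jumps a ω.1 ω.2.1 ω.2.2 n).1 with hy
  have hz : hammingNorm (x - y) ≤ 1 := by
    rwa [mem_ball_iff, hammingDist_eq_hammingNorm, neg_add_eq_sub] at hx
  obtain ⟨j, hj⟩ := (o y).surjective ⟨x - y, hz⟩
  have h1 : (n * (N + 1) + j) / (N + 1) = n := by
    rw [Nat.mul_comm, Nat.mul_add_div (Nat.succ_pos N), Nat.div_eq_of_lt j.2, add_zero]
  have h2 : Fin.ofNat (N + 1) (n * (N + 1) + j) = j := by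
    ext
    simp [Fin.ofNat, Nat.mod_eq_of_lt j.2]
  refine ⟨n * (N + 1) + j, h1, ?_⟩
  simp only [seen]
  rw [h1, h2, ← hy, hj]
  simp

/-- If a deep trap is discovered by the `n`-th jump, then so is the first deep trap. -/
lemma exists_firstDeepTrap (β a θ : ℝ) (o : Order N) (ω : Sample N) {n : ℕ} {x : V N}
    (hθ : θ ≤ tau β ω.1 x) (hx : x ∈ ball (jumps a ω.1 ω.2.1 ω.2.2 n).1) :
    ∃ y ∈ firstDeepTrap β a θ o ω, θ ≤ tau β ω.1 y ∧
      ∃ k ≤ n, y ∈ ball (jumps a ω.1 ω.2.1 ω.2.2 k).1 := by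
  classical
  obtain ⟨m, hm, hmx⟩ := exists_seen_eq a o ω hx
  have hex : ∃ m, seen a o ω m = x := ⟨m, hmx⟩
  set f := seen a o ω with hf
  set P : ℕ → Prop := fun m => ∀ k < m, f k ≠ f m with hP
  -- The first occurrence of `x` survives the removal of repetitions, hence `x` has an index in the
  -- exploration.
  set l := Nat.find hex with hl
  have hlx : f l = x := Nat.find_spec hex
  have hlm : l ≤ m := Nat.find_min' hex hmx
  have hPl : P l := fun k hk h => Nat.find_min hex hk (h.trans hlx)
  have hnth : Nat.nth P (Nat.count P l) = l := Nat.nth_count hPl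
  have hlt : Nat.count P l < Nat.count P (l + 1) := by rw [Nat.count_succ, if_pos hPl]; omega
  -- First occurrences are distinct sites, so the index of `x` stays below `2 ^ N` as
  -- `firstDeepTrap` requires.
  have hcard : Nat.count P (l + 1) ≤ 2 ^ N := by
    rw [Nat.count_eq_card_filter_range, ← card_V, ← Finset.card_univ]
    refine Finset.card_le_card_of_injOn f (fun _ _ => Finset.mem_univ _) fun i hi j hj hij => ?_
    have hi := (Finset.mem_filter.1 hi).2
    have hj := (Finset.mem_filter.1 hj).2
    rcases lt_trichotomy i j with h | h | h
    · exact absurd hij (hj i h)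
    · exact h
    · exact absurd hij.symm (hi j h)
  have h : ∃ i, i < 2 ^ N ∧ θ ≤ tau β ω.1 (explore a o ω i) := by
    refine ⟨Nat.count P l, hlt.trans_le hcard, ?_⟩
    rw [explore]
    change θ ≤ tau β ω.1 (f (Nat.nth P (Nat.count P l)))
    rwa [hnth, hlx]
  have hle : Nat.find h ≤ Nat.count P l := by
    refine Nat.find_min' h ⟨hlt.trans_le hcard, ?_⟩
    rw [explore]
    change θ ≤ tau β ω.1 (f (Nat.nth P (Nat.count P l)))
    rwa [hnth, hlx]
  refine ⟨explore a o ω (Nat.find h), by rw [firstDeepTrap, dif_pos h]; exact rfl,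
    (Nat.find_spec h).2, Nat.nth P (Nat.find h) / (N + 1), ?_, seen_mem_ball a o ω _⟩
  have : Nat.nth P (Nat.find h) < l + 1 := Nat.nth_lt_of_lt_count (hle.trans_lt hlt)
  rw [← hm]
  exact Nat.div_le_div_right (by omega)

/-! ### The expected number of discovered sites -/

/-- The typical exit rate `N² φ(a)²` of the ball around a site. -/
def exitRate (N : ℕ) (a : ℝ) : ℝ := N ^ 2 * phi a ^ 2

lemma exitRate_pos (hN : 1 ≤ N) {a : ℝ} (ha : 0 ≤ a) : 0 < exitRate N a := by
  have h1 := one_le_phi ha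
  have h2 : (0 : ℝ) < N := by exact_mod_cast hN
  unfold exitRate
  positivity

lemma sq_le_exitRate (N : ℕ) {a : ℝ} (ha : 0 ≤ a) : (N : ℝ) ^ 2 ≤ exitRate N a :=
  le_mul_of_one_le_right (sq_nonneg _) (one_le_pow₀ (one_le_phi ha))

/-- The constant of the flow inequality for centers with a typical environment. -/
def goodFlow (N : ℕ) (a η ε : ℝ) : ℝ :=
  flowConst N ((1 - η) * exitRate N a) (√N * N ^ 2 * phi (2 * a) ^ 2) ε

lemma Good.le_outflow {a η : ℝ} {E : V N → ℝ} {x : V N} (h : Good a η E x) :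
    (1 - η) * exitRate N a ≤ outflow (cond a E) x := by
  have := (abs_le.1 h.1).1
  unfold exitRate
  linarith

lemma Good.outflow_le {a η : ℝ} {E : V N → ℝ} {x : V N} (h : Good a η E x) :
    outflow (cond a E) x ≤ (1 + η) * exitRate N a := by
  have := (abs_le.1 h.1).2
  unfold exitRate
  linarith

lemma integral_outflow_le (a : ℝ) (x : V N) :
    ∫ E, outflow (cond a E) x ∂energyLaw N ≤ exitRate N a := by
  rw [(integral_outflow a x).2, exitRate]
  refine mul_le_mul_of_nonneg_right ?_ (sq_nonneg _)
  have : (0 : ℝ) ≤ N := Nat.cast_nonneg N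
  nlinarith

lemma outflow_nonneg (a : ℝ) (E : V N → ℝ) (x : V N) : 0 ≤ outflow (cond a E) x :=
  Finset.sum_nonneg fun _ _ => (cond_pos _ _ _ _).le

/-- The hitting bound is linear in `outflow`, so only its mean is needed; the `2 ^ N` sites cancel
the uniform weight of the starting point. -/
lemma dScale_le (hN : 1 ≤ N) (a : ℝ) {t : ℝ} (ht : 0 < t) :
    dScale N a t ≤ N + 1 + t * exitRate N a := by
  rw [dScale_eq hN]
  have h : ∀ x : V N, (∫⁻ E, ENNReal.ofReal (hitP a E (ball x) t) ∂energyLaw N).toReal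
      ≤ (N + 1 + t * exitRate N a) / 2 ^ N := fun x => by
    have hi : Integrable (fun E => (N + 1 + t * outflow (cond a E) x) / 2 ^ N) (energyLaw N) :=
      ((integrable_const _).add ((integral_outflow a x).1.const_mul t)).div_const _
    have h0 : ∀ E : V N → ℝ, 0 ≤ (N + 1 + t * outflow (cond a E) x) / 2 ^ N := fun E => by
      have := outflow_nonneg a E x
      positivity
    have h1 : ∫⁻ E, ENNReal.ofReal (hitP a E (ball x) t) ∂energyLaw N
        ≤ ENNReal.ofReal (∫ E, (N + 1 + t * outflow (cond a E) x) / 2 ^ N ∂energyLaw N) := by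
      rw [ofReal_integral_eq_lintegral_ofReal hi (Eventually.of_forall h0)]
      exact lintegral_mono fun E => ENNReal.ofReal_le_ofReal (hitP_ball_le hN a E x ht)
    refine (ENNReal.toReal_mono ENNReal.ofReal_ne_top h1).trans ?_
    rw [ENNReal.toReal_ofReal (integral_nonneg h0), integral_div,
      integral_add (integrable_const _) ((integral_outflow a x).1.const_mul t), integral_const_mul]
    simp only [integral_const, probReal_univ, one_smul]
    have := mul_le_mul_of_nonneg_left (integral_outflow_le a x) ht.le
    gcongr
  calc _ ≤ ∑ _x : V N, (N + 1 + t * exitRate N a) / 2 ^ N := Finset.sum_le_sum fun x _ => h x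
    _ = _ := by
        rw [Finset.sum_const, Finset.card_univ, card_V, nsmul_eq_mul]
        push_cast
        rw [mul_div_cancel₀]
        positivity

/-- Only the sites with a typical environment are kept. The target is the full ball, where the
potential is constant, so the first edge of the flow is free and `ε = 0`. -/
lemma le_dScale (hN : 3 ≤ N) {a t η b : ℝ} (ha : 0 ≤ a) (ht : 0 < t) (hη : η < 1)
    (hb : ∀ x : V N, (energyLaw N).real {E | ¬ Good a η E x} ≤ b) :
    (1 - b) / (1 + 2 ^ N * goodFlow N a η 0 ^ 2 / t) ≤ dScale N a t / 2 ^ N := by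
  rw [dScale_eq (by omega)]
  set v := 1 / (1 + 2 ^ N * goodFlow N a η 0 ^ 2 / t) with hv
  have hv0 : 0 ≤ v := by positivity
  have hs0 : 0 < (1 - η) * exitRate N a :=
    mul_pos (by linarith) (exitRate_pos (by omega) ha)
  have h : ∀ x : V N, (1 - b) * v ≤
      (∫⁻ E, ENNReal.ofReal (hitP a E (ball x) t) ∂energyLaw N).toReal := fun x => by
    have hG := measurableSet_good a η x
    have hpG : 1 - b ≤ (energyLaw N).real {E | Good a η E x} := by
      have h1 := hb x
      have h2 : {E : V N → ℝ | ¬ Good a η E x} = {E | Good a η E x}ᶜ := rfl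
      rw [h2, probReal_compl_eq_one_sub hG] at h1
      linarith
    have h1 : ENNReal.ofReal v * energyLaw N {E | Good a η E x}
        ≤ ∫⁻ E, ENNReal.ofReal (hitP a E (ball x) t) ∂energyLaw N := by
      rw [← lintegral_indicator_const hG]
      refine lintegral_mono_ae ?_
      filter_upwards [ae_energy_nonneg] with E hE
      by_cases hx : E ∈ {E | Good a η E x}
      · rw [Set.indicator_of_mem hx]
        refine ENNReal.ofReal_le_ofReal ?_
        have hx : Good a η E x := hx
        have := le_hitP hN ha hE (T := {x}) (A := ball x) (s := (1 - η) * exitRate N a)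
          (q := √N * N ^ 2 * phi (2 * a) ^ 2) (ε := 0) (r := t)
          (by simp [mem_ball_iff]) (by simp [Separated]) (Finset.singleton_nonempty x) hs0
          (by simpa using hx.le_outflow) (by simpa using hx.2) le_rfl
          (by
            intro y hy i
            rw [Finset.mem_singleton.1 hy]
            exact Or.inl (mem_ball_iff.2 (hammingDist_add_unit x i).le)) ht
        rw [Finset.card_singleton, Nat.cast_one, mul_one] at this
        exact this
      · rw [Set.indicator_of_notMem hx]
        exact zero_le
    have h2 : ∫⁻ E, ENNReal.ofReal (hitP a E (ball x) t) ∂energyLaw N ≠ ∞ := by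
      rw [← annealed_hit a (fun _ => ball x) (fun y => MeasurableSet.const _) t]
      exact measure_ne_top _ _
    have h3 := ENNReal.toReal_mono h2 h1
    rw [ENNReal.toReal_mul, ENNReal.toReal_ofReal hv0] at h3
    have := mul_le_mul_of_nonneg_right hpG hv0
    calc _ ≤ _ := this
      _ = v * (energyLaw N {E | Good a η E x}).toReal := mul_comm _ _
      _ ≤ _ := h3
  rw [le_div_iff₀ (by positivity)]
  calc _ = ∑ _x : V N, (1 - b) * v := by
        rw [Finset.sum_const, Finset.card_univ, card_V, nsmul_eq_mul, hv]
        push_cast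
        ring
    _ ≤ _ := Finset.sum_le_sum fun x _ => h x

/-! ### Gaussian tails -/

lemma posGaussian_real_Ici {h : ℝ} (hh : 0 < h) :
    posGaussian.real (Set.Ici h) = ∫ x in Set.Ici h, gaussianPDFReal 0 1 x := by
  rw [Measure.real, posGaussian, Measure.map_apply (by fun_prop) measurableSet_Ici]
  have : (fun x : ℝ => max x 0) ⁻¹' Set.Ici h = Set.Ici h := by
    ext x
    simp [hh.not_ge]
  rw [this, gaussianReal_apply_eq_integral 0 one_ne_zero, ENNReal.toReal_ofReal]
  exact integral_nonneg fun x => gaussianPDFReal_nonneg 0 1 x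

lemma gaussianPDFReal_zero_one (x : ℝ) :
    gaussianPDFReal 0 1 x = Real.exp (-x ^ 2 / 2) / √(2 * Real.pi) := by
  simp [gaussianPDFReal, div_eq_inv_mul]

/-- The tangent bound `x² ≥ 2 h x - h²` replaces the density by an exponential. -/
lemma posGaussian_real_Ici_le {h : ℝ} (hh : 0 < h) :
    posGaussian.real (Set.Ici h) ≤ Real.exp (-h ^ 2 / 2) / (h * √(2 * Real.pi)) := by
  rw [posGaussian_real_Ici hh, integral_Ici_eq_integral_Ioi]
  have h1 : IntegrableOn (fun x => Real.exp (h ^ 2 / 2) / √(2 * Real.pi) * Real.exp (-h * x))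
      (Set.Ioi h) := (integrableOn_exp_mul_Ioi (neg_neg_of_pos hh) h).const_mul _
  calc _ ≤ ∫ x in Set.Ioi h, Real.exp (h ^ 2 / 2) / √(2 * Real.pi) * Real.exp (-h * x) := by
        refine setIntegral_mono_on (integrable_gaussianPDFReal 0 1).integrableOn h1
          measurableSet_Ioi fun x _ => ?_
        rw [gaussianPDFReal_zero_one, div_mul_eq_mul_div, ← Real.exp_add]
        gcongr
        nlinarith [sq_nonneg (x - h)]
    _ = _ := by
        rw [integral_const_mul, integral_exp_mul_Ioi (neg_neg_of_pos hh), neg_div_neg_eq,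
          div_mul_div_comm, ← Real.exp_add, mul_comm h]
        congr 2
        ring

/-- On `[h, h + 1/h]` the density loses at most a factor `exp (-3/2)` when `h ≥ 1`; `exp (-2)` is a
convenient weaker constant. -/
lemma le_posGaussian_real_Ici {h : ℝ} (hh : 1 ≤ h) :
    Real.exp (-2) * (Real.exp (-h ^ 2 / 2) / (h * √(2 * Real.pi)))
      ≤ posGaussian.real (Set.Ici h) := by
  have hh0 : 0 < h := by linarith
  rw [posGaussian_real_Ici hh0]
  have h1 : ∀ x ∈ Set.Icc h (h + 1 / h), Real.exp (-2) * Real.exp (-h ^ 2 / 2) / √(2 * Real.pi)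
      ≤ gaussianPDFReal 0 1 x := fun x hx => by
    rw [gaussianPDFReal_zero_one, ← Real.exp_add]
    have h2 : x ^ 2 ≤ (h + 1 / h) ^ 2 := pow_le_pow_left₀ (by linarith [hx.1]) hx.2 2
    have h3 : (h + 1 / h) ^ 2 = h ^ 2 + 2 + (1 / h) ^ 2 := by field_simp; ring
    have h4 : (1 / h) ^ 2 ≤ 1 := pow_le_one₀ (by positivity) (by rw [div_le_one hh0]; exact hh)
    gcongr
    linarith
  have h2 := setIntegral_ge_of_const_le_real (μ := volume) measurableSet_Icc (by simp) h1
    (integrable_gaussianPDFReal 0 1).integrableOn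
  calc _ = Real.exp (-2) * Real.exp (-h ^ 2 / 2) / √(2 * Real.pi) *
        volume.real (Set.Icc h (h + 1 / h)) := by
        rw [Real.volume_real_Icc_of_le (by simp [hh0.le])]
        field_simp
        ring
    _ ≤ _ := h2
    _ ≤ _ := setIntegral_mono_set (integrable_gaussianPDFReal 0 1).integrableOn
        (Eventually.of_forall fun x => gaussianPDFReal_nonneg 0 1 x)
        (Set.Icc_subset_Ici_self.eventuallyLE)

/-- The expected number of deep traps among `d` sites, for the extreme value scale. -/
lemma posGaussian_mul_bounds {d κ C h : ℝ} (hd : 1 < d) (hh : h = bScale d + κ) (h1 : 2 ≤ h)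
    (hκ : |√(2 * Real.log d) * κ| ≤ C) (hu : |√(2 * Real.log d) - h| ≤ 1) :
    Real.exp (-(C + 3)) / 2 ≤ posGaussian.real (Set.Ici h) * d ∧
      posGaussian.real (Set.Ici h) * d ≤ 2 * Real.exp C := by
  set L := Real.log d with hL
  set r := √(2 * L) with hr
  have hL0 : 0 < L := Real.log_pos hd
  have hr0 : 0 < r := Real.sqrt_pos.2 (by linarith)
  have hr2 : r ^ 2 = 2 * L := Real.sq_sqrt (by linarith)
  have hdL : d = Real.exp L := (Real.exp_log (by linarith)).symm
  set u := r - h with hu_def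
  -- The correction in `bScale` is chosen so that `exp (r u)` is `r √(2π)` up to `exp (-(r κ))`,
  -- cancelling the prefactor of the Gaussian tail.
  have hru : r * u = (Real.log L + Real.log (4 * Real.pi)) / 2 - r * κ := by
    rw [hu_def, hh, bScale, ← hL, ← hr]
    field_simp
    ring
  have hlog : Real.exp ((Real.log L + Real.log (4 * Real.pi)) / 2) = r * √(2 * Real.pi) := by
    rw [← Real.log_mul hL0.ne' (by positivity), ← Real.log_sqrt (by positivity),
      Real.exp_log (by positivity), hr, ← Real.sqrt_mul (by positivity)]
    congr 1
    ring
  have key : Real.exp (-h ^ 2 / 2) / (h * √(2 * Real.pi)) * d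
      = r / h * Real.exp (-(r * κ) - u ^ 2 / 2) := by
    have e1 : -h ^ 2 / 2 = -L + (Real.log L + Real.log (4 * Real.pi)) / 2
        + (-(r * κ) - u ^ 2 / 2) := by
      have : h = r - u := by rw [hu_def]; ring
      rw [this]
      nlinarith
    have h0 : h ≠ 0 := by linarith
    rw [e1, Real.exp_add, Real.exp_add, hlog, hdL, Real.exp_neg]
    field_simp
  have hh0 : 0 < h := by linarith
  have hu2 : u ^ 2 ≤ 1 := by rw [← sq_abs]; exact pow_le_one₀ (abs_nonneg _) hu
  obtain ⟨k1, k2⟩ := abs_le.1 hκ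
  obtain ⟨u1, u2⟩ := abs_le.1 hu
  have hd0 : 0 < d := by linarith
  constructor
  · calc Real.exp (-(C + 3)) / 2 ≤ Real.exp (-2) * (r / h * Real.exp (-(r * κ) - u ^ 2 / 2)) := by
          have e2 : 1 / 2 ≤ r / h := by
            rw [div_le_div_iff₀ two_pos hh0]
            linarith
          have e3 : Real.exp (-(C + 3)) ≤ Real.exp (-2) * Real.exp (-(r * κ) - u ^ 2 / 2) := by
            rw [← Real.exp_add]
            exact Real.exp_le_exp.2 (by linarith)
          calc _ = 1 / 2 * Real.exp (-(C + 3)) := by ring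
            _ ≤ r / h * (Real.exp (-2) * Real.exp (-(r * κ) - u ^ 2 / 2)) := by gcongr
            _ = _ := by ring
      _ = Real.exp (-2) * (Real.exp (-h ^ 2 / 2) / (h * √(2 * Real.pi))) * d := by
          rw [← key]; ring
      _ ≤ _ := mul_le_mul_of_nonneg_right (le_posGaussian_real_Ici (by linarith)) hd0.le
  · calc _ ≤ Real.exp (-h ^ 2 / 2) / (h * √(2 * Real.pi)) * d :=
          mul_le_mul_of_nonneg_right (posGaussian_real_Ici_le hh0) hd0.le
      _ = r / h * Real.exp (-(r * κ) - u ^ 2 / 2) := key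
      _ ≤ 2 * Real.exp C := by
          have e2 : r / h ≤ 2 := by rw [div_le_iff₀ hh0]; linarith
          gcongr
          linarith [sq_nonneg u]

/-! ### Asymptotics of the scales -/

/-- The range of acceleration parameters and of time scales. -/
structure Regime (abar cbar : ℝ) (a t : ℕ → ℝ) : Prop where
  abar_lt : abar < 1 / 20
  bounds : ∀ᶠ N : ℕ in atTop, 1 ≤ a N ∧ a N ≤ abar * √(2 * Real.log (N : ℝ))
  cbar_mem : cbar ∈ Set.Ioo 0 (Real.log 2)
  t_pos : ∀ N, 0 < t N
  log_t : Asymptotics.IsEquivalent atTop (fun N => Real.log (t N)) (fun N => cbar * (N : ℝ))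

lemma tendsto_natCast_pow_mul_exp (k : ℕ) {c : ℝ} (hc : 0 < c) :
    Tendsto (fun N : ℕ => (N : ℝ) ^ k * Real.exp (-c * N)) atTop (𝓝 0) := by
  have := (tendsto_rpow_mul_exp_neg_mul_atTop_nhds_zero k c hc).comp tendsto_natCast_atTop_atTop
  simpa [Function.comp_def] using this

namespace Regime

variable {abar cbar : ℝ} {a t : ℕ → ℝ}

lemma one_le (R : Regime abar cbar a t) : ∀ᶠ N in atTop, 1 ≤ a N := R.bounds.mono fun _ h => h.1

/-- With `abar < 1/20` one has `a² ≤ log N / 200`, so `(2a)² / 2 ≤ log N / 100`. Any exponent below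
`1/2` in place of `1/50` would make `tendsto_phi` work. -/
lemma phi_le (R : Regime abar cbar a t) :
    ∀ᶠ N : ℕ in atTop, phi (2 * a N) ^ 2 ≤ 4 * (N : ℝ) ^ (1 / 50 : ℝ) ∧
    phi (a N) ^ 2 ≤ 4 * (N : ℝ) ^ (1 / 50 : ℝ) := by
  filter_upwards [R.bounds, eventually_ge_atTop 1] with N hN hN1
  have hN1' : (1 : ℝ) ≤ N := by exact_mod_cast hN1
  have hlog : 0 ≤ Real.log N := Real.log_nonneg hN1'
  have h1 : a N ≤ 1 / 20 * √(2 * Real.log N) :=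
    hN.2.trans (mul_le_mul_of_nonneg_right R.abar_lt.le (Real.sqrt_nonneg _))
  have h2 : a N ^ 2 ≤ Real.log N / 200 := by
    have := pow_le_pow_left₀ (by linarith [hN.1]) h1 2
    rw [mul_pow, Real.sq_sqrt (by positivity)] at this
    linarith
  have key : ∀ l : ℝ, 0 ≤ l → l ^ 2 / 2 ≤ Real.log N / 100 →
      phi l ^ 2 ≤ 4 * (N : ℝ) ^ (1 / 50 : ℝ) := fun l hl0 hl => by
    have h3 : phi l ≤ 2 * (N : ℝ) ^ (1 / 100 : ℝ) := by
      have h4 : Real.exp (l ^ 2 / 2) ≤ (N : ℝ) ^ (1 / 100 : ℝ) := by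
        rw [Real.rpow_def_of_pos (by linarith)]
        exact Real.exp_le_exp.2 (by linarith)
      have h5 : 1 ≤ (N : ℝ) ^ (1 / 100 : ℝ) := Real.one_le_rpow hN1' (by norm_num)
      linarith [REM.phi_le l]
    have := pow_le_pow_left₀ (zero_le_one.trans (one_le_phi hl0)) h3 2
    rw [mul_pow, ← Real.rpow_natCast ((N : ℝ) ^ (1 / 100 : ℝ)),
      ← Real.rpow_mul (by linarith)] at this
    norm_num at this ⊢
    exact this
  exact ⟨key _ (by linarith [hN.1]) (by nlinarith), key _ (by linarith [hN.1]) (by nlinarith)⟩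

lemma tendsto_phi (R : Regime abar cbar a t) :
    Tendsto (fun N : ℕ => √(N : ℝ) * phi (2 * a N) ^ 2 / N) atTop (𝓝 0) := by
  have h1 : Tendsto (fun N : ℕ => 4 * (N : ℝ) ^ (-(48 / 100) : ℝ)) atTop (𝓝 (4 * 0)) :=
    ((tendsto_rpow_neg_atTop (by norm_num)).comp tendsto_natCast_atTop_atTop).const_mul 4
  rw [mul_zero] at h1
  refine squeeze_zero' (Eventually.of_forall fun N => by positivity) ?_ h1
  filter_upwards [R.phi_le, eventually_ge_atTop 1] with N hN hN1
  have hN0 : (0 : ℝ) < N := by exact_mod_cast hN1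
  rw [div_le_iff₀ hN0]
  calc √(N : ℝ) * phi (2 * a N) ^ 2 ≤ √(N : ℝ) * (4 * (N : ℝ) ^ (1 / 50 : ℝ)) := by
        gcongr; exact hN.1
    _ = 4 * ((N : ℝ) ^ (1 / 2 : ℝ) * (N : ℝ) ^ (1 / 50 : ℝ)) := by rw [Real.sqrt_eq_rpow]; ring
    _ = 4 * ((N : ℝ) ^ (-(48 / 100) : ℝ) * (N : ℝ) ^ (1 : ℝ)) := by
        rw [← Real.rpow_add hN0, ← Real.rpow_add hN0]
        norm_num
    _ = _ := by rw [Real.rpow_one]; ring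

/-- The bound on the probability that the environment around a site is not typical. -/
lemma tendsto_bad (R : Regime abar cbar a t)
    (η : ℝ) : Tendsto (fun N : ℕ => 8 * phi (2 * a N) ^ 2 / (η ^ 2 * N) + 1 / √(N : ℝ))
    atTop (𝓝 0) := by
  have hs : Tendsto (fun N : ℕ => 1 / √(N : ℝ)) atTop (𝓝 0) := by
    have := tendsto_inv_atTop_zero.comp (Real.tendsto_sqrt_atTop.comp tendsto_natCast_atTop_atTop)
    simpa [Function.comp_def, one_div] using this
  have h2 : Tendsto (fun N : ℕ => 8 / η ^ 2 * (√(N : ℝ) * phi (2 * a N) ^ 2 / N) + 1 / √(N : ℝ))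
      atTop (𝓝 (8 / η ^ 2 * 0 + 0)) := (R.tendsto_phi.const_mul _).add hs
  rw [mul_zero, add_zero] at h2
  refine squeeze_zero' (Eventually.of_forall fun N => by positivity) ?_ h2
  filter_upwards [eventually_ge_atTop 1] with N hN1
  have hN1' : (1 : ℝ) ≤ N := by exact_mod_cast hN1
  gcongr
  have h3 : 1 ≤ √(N : ℝ) := Real.one_le_sqrt.2 hN1'
  calc 8 * phi (2 * a N) ^ 2 / (η ^ 2 * N) = 8 / η ^ 2 * (1 * phi (2 * a N) ^ 2 / N) := by
        rw [one_mul, div_mul_div_comm]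
    _ ≤ _ := by gcongr

lemma measure_not_good_le (R : Regime abar cbar a t)
    {η : ℝ} (hη : 0 < η) : ∀ᶠ N : ℕ in atTop, ∀ x : V N,
    (energyLaw N).real {E | ¬ Good (a N) η E x}
      ≤ 8 * phi (2 * a N) ^ 2 / (η ^ 2 * N) + 1 / √(N : ℝ) := by
  filter_upwards [R.one_le, eventually_ge_atTop 1,
    tendsto_natCast_atTop_atTop.eventually_ge_atTop (2 / η)] with N h1 h2 h3 x
  exact REM.measure_not_good_le hη (by linarith) h2 h3 x

lemma exitRate_le (R : Regime abar cbar a t) :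
    ∀ᶠ N : ℕ in atTop, exitRate N (a N) ≤ (N : ℝ) ^ 3 := by
  have h1 : Tendsto (fun N : ℕ => (N : ℝ) ^ (49 / 50 : ℝ)) atTop atTop :=
    (tendsto_rpow_atTop (by norm_num)).comp tendsto_natCast_atTop_atTop
  filter_upwards [R.phi_le, eventually_ge_atTop 1, h1.eventually_ge_atTop 4] with N hN hN1 h4
  have hN0 : (0 : ℝ) < N := by exact_mod_cast hN1
  rw [exitRate]
  calc (N : ℝ) ^ 2 * phi (a N) ^ 2 ≤ (N : ℝ) ^ 2 * (4 * (N : ℝ) ^ (1 / 50 : ℝ)) := by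
        gcongr; exact hN.2
    _ ≤ (N : ℝ) ^ 2 * ((N : ℝ) ^ (49 / 50 : ℝ) * (N : ℝ) ^ (1 / 50 : ℝ)) := by gcongr
    _ = (N : ℝ) ^ 2 * N := by
        rw [← Real.rpow_add hN0]
        norm_num
    _ = _ := by ring

lemma t_bounds (R : Regime abar cbar a t) : ∃ c c' : ℝ, 0 < c ∧ c' < Real.log 2 ∧
    ∀ᶠ N : ℕ in atTop, Real.exp (c * N) ≤ t N ∧ t N ≤ Real.exp (c' * N) := by
  obtain ⟨h1, h2⟩ := R.cbar_mem
  set ε := min (cbar / 2) ((Real.log 2 - cbar) / 2) with hε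
  have hε0 : 0 < ε := lt_min (by linarith) (by linarith)
  have e1 : ε ≤ cbar / 2 := min_le_left _ _
  have e2 : ε ≤ (Real.log 2 - cbar) / 2 := min_le_right _ _
  have h3 := R.log_t.isLittleO.def (c := ε / cbar) (by positivity)
  refine ⟨cbar - ε, cbar + ε, by linarith, by linarith, ?_⟩
  filter_upwards [h3] with N hN
  have hN' : |Real.log (t N) - cbar * N| ≤ ε * N := by
    rw [Real.norm_eq_abs, Real.norm_eq_abs,
      abs_of_nonneg (by positivity : 0 ≤ cbar * (N : ℝ))] at hN
    refine hN.trans (le_of_eq ?_)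
    field_simp
  obtain ⟨h5, h6⟩ := abs_le.1 hN'
  rw [← Real.le_log_iff_exp_le (R.t_pos N), ← Real.log_le_iff_le_exp (R.t_pos N)]
  constructor <;> linarith

/-- The discovered sites are a vanishing fraction of the cube because `cbar < log 2`, while the exit
rate is polynomial. -/
lemma tendsto_t_mul (R : Regime abar cbar a t) :
    Tendsto (fun N : ℕ => t N * exitRate N (a N) / 2 ^ N) atTop (𝓝 0) := by
  obtain ⟨c, c', hc, hc', h⟩ := R.t_bounds
  refine squeeze_zero' ?_ ?_ (tendsto_natCast_pow_mul_exp 3 (sub_pos.2 hc'))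
  · filter_upwards [R.one_le, eventually_ge_atTop 1] with N h1 h2
    have := exitRate_pos h2 (zero_le_one.trans h1)
    have := R.t_pos N
    positivity
  · filter_upwards [h, R.exitRate_le] with N h1 h2
    have h3 : (2 : ℝ) ^ N = Real.exp (Real.log 2 * N) := by
      rw [Real.exp_mul, Real.exp_log two_pos, Real.rpow_natCast]
    rw [div_le_iff₀ (by positivity), mul_assoc, h3, ← Real.exp_add, mul_comm (t N)]
    have h4 : -(Real.log 2 - c') * N + Real.log 2 * N = c' * N := by ring
    rw [h4]
    have := R.t_pos N
    gcongr
    exact h1.2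

/-- The constant of the flow inequality is asymptotically the inverse of the exit rate. -/
lemma tendsto_goodFlow (R : Regime abar cbar a t) {η : ℝ} (hη : η < 1) {ε : ℕ → ℝ}
    (hε : Tendsto (fun N => ε N * exitRate N (a N)) atTop (𝓝 0)) :
    Tendsto (fun N : ℕ => exitRate N (a N) * goodFlow N (a N) η (ε N) ^ 2) atTop
      (𝓝 (1 / (1 - η))) := by
  have hη' : 0 < 1 - η := by linarith
  have h1 : Tendsto (fun N : ℕ => √(2 * (ε N * exitRate N (a N)))) atTop (𝓝 √(2 * 0)) :=
    (Real.continuous_sqrt.tendsto _).comp (hε.const_mul 2)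
  -- The spread part of the flow is negligible: relative to `1 / exitRate` its energy is of order
  -- `√N φ(2a)² / N`.
  have h2 : Tendsto (fun N : ℕ => √(exitRate N (a N) * (√(N : ℝ) * N ^ 2 * phi (2 * a N) ^ 2 /
      (((1 - η) * exitRate N (a N)) ^ 2 * (N - 2))))) atTop (𝓝 √0) := by
    refine (Real.continuous_sqrt.tendsto _).comp ?_
    have h3 := R.tendsto_phi.const_mul (2 / (1 - η) ^ 2)
    rw [mul_zero] at h3
    have hev : ∀ᶠ N : ℕ in atTop, (4 : ℝ) ≤ N := tendsto_natCast_atTop_atTop.eventually_ge_atTop 4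
    refine squeeze_zero' ?_ ?_ h3
    · filter_upwards [hev, R.one_le] with N h4 h5
      have : (0 : ℝ) ≤ N - 2 := by linarith
      have := exitRate_pos (by exact_mod_cast (by linarith : (1 : ℝ) ≤ N)) (zero_le_one.trans h5)
      positivity
    · filter_upwards [hev, R.one_le] with N h4 h5
      have hN2 : (0 : ℝ) < N - 2 := by linarith
      have hN0 : (0 : ℝ) < N := by linarith
      have hM := exitRate_pos (by exact_mod_cast (by linarith : (1 : ℝ) ≤ N)) (zero_le_one.trans h5)
      have hM2 := sq_le_exitRate N (zero_le_one.trans h5)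
      set M := exitRate N (a N)
      set Φ := phi (2 * a N) ^ 2 with hΦ
      have hΦ0 : 0 ≤ Φ := sq_nonneg _
      calc M * (√(N : ℝ) * N ^ 2 * Φ / (((1 - η) * M) ^ 2 * (N - 2)))
          = N ^ 2 / M * (√(N : ℝ) * Φ / ((1 - η) ^ 2 * (N - 2))) := by
            field_simp
        _ ≤ 1 * (√(N : ℝ) * Φ / ((1 - η) ^ 2 * (N / 2))) := by
            have : N ^ 2 / M ≤ 1 := by rw [div_le_one hM]; exact hM2
            gcongr
            linarith
        _ = _ := by field_simp
  have h3 : Tendsto (fun N : ℕ => (√(1 / (1 - η)) + √(2 * (ε N * exitRate N (a N))) +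
      9 * √(exitRate N (a N) * (√(N : ℝ) * N ^ 2 * phi (2 * a N) ^ 2 /
      (((1 - η) * exitRate N (a N)) ^ 2 * (N - 2))))) ^ 2) atTop
      (𝓝 ((√(1 / (1 - η)) + √(2 * 0) + 9 * √0) ^ 2)) :=
    ((tendsto_const_nhds.add h1).add (h2.const_mul 9)).pow 2
  have h4 : (√(1 / (1 - η)) + √(2 * 0) + 9 * √0) ^ 2 = 1 / (1 - η) := by
    rw [mul_zero, Real.sqrt_zero, mul_zero, add_zero, add_zero, Real.sq_sqrt (by positivity)]
  rw [h4] at h3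
  refine h3.congr' ?_
  filter_upwards [R.one_le, eventually_ge_atTop 1] with N h5 h6
  have hM := exitRate_pos h6 (zero_le_one.trans h5)
  rw [goodFlow, flowConst]
  set M := exitRate N (a N)
  have e1 : √(1 / (1 - η)) = √M * √(1 / ((1 - η) * M)) := by
    rw [← Real.sqrt_mul hM.le]
    congr 1
    field_simp
  have e2 : √(2 * (ε N * M)) = √M * √(2 * ε N) := by
    rw [← Real.sqrt_mul hM.le]
    congr 1
    ring
  have e3 : ∀ u v w : ℝ, (√M * u + √M * v + 9 * (√M * w)) ^ 2 = M * (u + v + 9 * w) ^ 2 :=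
    fun u v w => by
      calc _ = √M ^ 2 * (u + v + 9 * w) ^ 2 := by ring
        _ = _ := by rw [Real.sq_sqrt hM.le]
  rw [e1, e2, Real.sqrt_mul hM.le, e3]

lemma tendsto_t_atTop (R : Regime abar cbar a t) : Tendsto t atTop atTop := by
  obtain ⟨c, c', hc, hc', h⟩ := R.t_bounds
  refine tendsto_atTop_mono' _ (h.mono fun N hN => hN.1) (Real.tendsto_exp_atTop.comp ?_)
  exact tendsto_natCast_atTop_atTop.const_mul_atTop hc

/-- The expected number of discovered sites. -/
theorem tendsto_dScale (R : Regime abar cbar a t) :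
    Tendsto (fun N : ℕ => dScale N (a N) (t N) / (t N * exitRate N (a N))) atTop (𝓝 1) := by
  have hpos : ∀ᶠ N : ℕ in atTop, 0 < exitRate N (a N) := by
    filter_upwards [R.one_le, eventually_ge_atTop 1] with N h1 h2
    exact exitRate_pos h2 (zero_le_one.trans h1)
  rw [tendsto_order]
  constructor
  · intro v hv
    -- The tolerance is tied to the level `v`: the lower bound tends to `1 - η`, which exceeds `v`.
    set η := min ((1 - v) / 2) (1 / 2) with hη
    have hη0 : 0 < η := lt_min (by linarith) (by norm_num)
    have hη1 : η < 1 := (min_le_right _ _).trans_lt (by norm_num)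
    have hvη : v < 1 - η := by have := min_le_left ((1 - v) / 2) (1 / 2); linarith
    have hlim : Tendsto (fun N : ℕ => (1 - (8 * phi (2 * a N) ^ 2 / (η ^ 2 * N) + 1 / √(N : ℝ))) /
        (t N * exitRate N (a N) / 2 ^ N + exitRate N (a N) * goodFlow N (a N) η 0 ^ 2)) atTop
        (𝓝 ((1 - 0) / (0 + 1 / (1 - η)))) := by
      refine Tendsto.div (tendsto_const_nhds.sub (R.tendsto_bad η))
        (R.tendsto_t_mul.add (R.tendsto_goodFlow hη1 (ε := fun _ => 0) ?_)) ?_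
      · simp
      · have : 0 < 1 - η := by linarith
        positivity
    have hval : (1 - 0) / (0 + 1 / (1 - η)) = 1 - η := by simp
    rw [hval] at hlim
    filter_upwards [(tendsto_order.1 hlim).1 v hvη, R.one_le, eventually_ge_atTop 3,
      R.measure_not_good_le hη0, hpos] with N h1 h2 h3 h4 hM
    refine h1.trans_le ?_
    have := le_dScale h3 (zero_le_one.trans h2) (R.t_pos N) hη1 h4
    have ht := R.t_pos N
    set b := 8 * phi (2 * a N) ^ 2 / (η ^ 2 * N) + 1 / √(N : ℝ)
    set M := exitRate N (a N)
    set K := goodFlow N (a N) η 0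
    set d := dScale N (a N) (t N)
    rw [le_div_iff₀ (by positivity)] at this ⊢
    refine le_trans (le_of_eq ?_) this
    have hD : 0 < t N + 2 ^ N * K ^ 2 := by positivity
    have e1 : t N * M / 2 ^ N + M * K ^ 2 = M / 2 ^ N * (t N + 2 ^ N * K ^ 2) := by field_simp
    have e2 : 1 + 2 ^ N * K ^ 2 / t N = (t N + 2 ^ N * K ^ 2) / t N := by field_simp
    rw [e1, e2]
    field_simp
  · intro v hv
    have hlim : Tendsto (fun N : ℕ => 2 * (t N)⁻¹ + 1) atTop (𝓝 (2 * 0 + 1)) :=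
      ((tendsto_inv_atTop_zero.comp R.tendsto_t_atTop).const_mul 2).add_const 1
    rw [mul_zero, zero_add] at hlim
    filter_upwards [(tendsto_order.1 hlim).2 v hv, R.one_le, eventually_ge_atTop 1, hpos]
      with N h1 h2 h3 hM
    refine lt_of_le_of_lt ?_ h1
    have ht := R.t_pos N
    have h4 := dScale_le h3 (a N) ht
    have h5 := sq_le_exitRate N (zero_le_one.trans h2)
    have h6 : (1 : ℝ) ≤ N := by exact_mod_cast h3
    rw [div_le_iff₀ (by positivity)]
    have h7 : (2 * (t N)⁻¹ + 1) * (t N * exitRate N (a N))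
        = 2 * exitRate N (a N) + t N * exitRate N (a N) := by
      field_simp
    rw [h7]
    nlinarith

end Regime

/-! ### The depth of the deep traps -/

/-- The energy of a site `x` with `τ_{N,x} = δ B_N`. -/
def trapDepth (N : ℕ) (β a t δ : ℝ) : ℝ := bScale (dScale N a t) + Real.log δ / (β * √(N : ℝ))

lemma le_tau_iff {N : ℕ} (hN : 1 ≤ N) {β δ : ℝ} (hβ : 0 < β) (hδ : 0 < δ) (a t : ℝ)
    (E : V N → ℝ) (x : V N) :
    δ * BScale N β a t ≤ tau β E x ↔ trapDepth N β a t δ ≤ E x := by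
  have hs : 0 < √(N : ℝ) := Real.sqrt_pos.2 (by exact_mod_cast hN)
  have h1 : δ * BScale N β a t = Real.exp (β * √(N : ℝ) * trapDepth N β a t δ) := by
    rw [BScale, trapDepth, mul_add, Real.exp_add, mul_div_cancel₀ _ (by positivity),
      Real.exp_log hδ, mul_comm]
  rw [h1, tau, Real.exp_le_exp]
  exact mul_le_mul_iff_right₀ (by positivity)

lemma tendsto_sub_bScale : Tendsto (fun d => √(2 * Real.log d) - bScale d) atTop (𝓝 0) := by
  have h1 : Tendsto (fun L : ℝ => Real.log L / L ^ (1 / 2 : ℝ)) atTop (𝓝 0) :=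
    (isLittleO_log_rpow_atTop (by norm_num)).tendsto_div_nhds_zero
  have h2 : Tendsto (fun L : ℝ => Real.log (4 * Real.pi) / √L) atTop (𝓝 0) :=
    tendsto_const_nhds.div_atTop Real.tendsto_sqrt_atTop
  have h3 := ((h1.add h2).const_mul (1 / (2 * √2))).comp Real.tendsto_log_atTop
  rw [add_zero, mul_zero] at h3
  refine h3.congr' ?_
  filter_upwards [eventually_gt_atTop 1] with d hd
  have hL : 0 < Real.log d := Real.log_pos hd
  have hs : √(Real.log d) ≠ 0 := (Real.sqrt_pos.2 hL).ne'
  rw [Function.comp_apply, ← Real.sqrt_eq_rpow, bScale, Real.sqrt_mul two_pos.le]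
  field_simp
  ring

namespace Regime

variable {abar cbar : ℝ} {a t : ℕ → ℝ}

lemma exitRate_pos (R : Regime abar cbar a t) : ∀ᶠ N : ℕ in atTop, 0 < exitRate N (a N) := by
  filter_upwards [R.one_le, eventually_ge_atTop 1] with N h1 h2
  exact REM.exitRate_pos h2 (zero_le_one.trans h1)

lemma dScale_bounds (R : Regime abar cbar a t) :
    ∀ᶠ N : ℕ in atTop, t N * exitRate N (a N) ≤ 2 * dScale N (a N) (t N) ∧
    dScale N (a N) (t N) ≤ 2 * (t N * exitRate N (a N)) := by
  filter_upwards [(tendsto_order.1 R.tendsto_dScale).1 (1 / 2) (by norm_num),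
    (tendsto_order.1 R.tendsto_dScale).2 2 (by norm_num), R.exitRate_pos] with N h1 h2 h3
  have := mul_pos (R.t_pos N) h3
  rw [lt_div_iff₀ this] at h1
  rw [div_lt_iff₀ this] at h2
  constructor <;> linarith

lemma exp_le_dScale (R : Regime abar cbar a t) :
    ∃ c > 0, ∀ᶠ N : ℕ in atTop, Real.exp (c * N) ≤ dScale N (a N) (t N) := by
  obtain ⟨c, c', hc, -, h⟩ := R.t_bounds
  refine ⟨c, hc, ?_⟩
  filter_upwards [h, R.dScale_bounds, R.one_le, eventually_ge_atTop 2] with N h1 h2 h3 h4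
  have h5 := sq_le_exitRate N (zero_le_one.trans h3)
  have h6 : (2 : ℝ) ≤ N := by exact_mod_cast h4
  have h7 : 2 ≤ exitRate N (a N) := by nlinarith
  have := mul_le_mul_of_nonneg_left h7 (R.t_pos N).le
  linarith [h1.1, h2.1]

lemma dScale_le_two_pow (R : Regime abar cbar a t) :
    ∀ᶠ N : ℕ in atTop, dScale N (a N) (t N) ≤ 2 ^ N := by
  filter_upwards [R.dScale_bounds, (tendsto_order.1 R.tendsto_t_mul).2 (1 / 2) (by norm_num)]
    with N h1 h2
  rw [div_lt_iff₀ (by positivity)] at h2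
  linarith [h1.2]

lemma tendsto_dScale_atTop (R : Regime abar cbar a t) :
    Tendsto (fun N : ℕ => dScale N (a N) (t N)) atTop atTop := by
  obtain ⟨c, hc, h⟩ := R.exp_le_dScale
  exact tendsto_atTop_mono' _ h
    (Real.tendsto_exp_atTop.comp (tendsto_natCast_atTop_atTop.const_mul_atTop hc))

variable {β δ : ℝ}

lemma tendsto_sub_trapDepth (R : Regime abar cbar a t) (β δ : ℝ) :
    Tendsto (fun N : ℕ => √(2 * Real.log (dScale N (a N) (t N))) - trapDepth N β (a N) (t N) δ)
      atTop (𝓝 0) := by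
  have h1 := tendsto_sub_bScale.comp R.tendsto_dScale_atTop
  have h2 : Tendsto (fun N : ℕ => Real.log δ / β / √(N : ℝ)) atTop (𝓝 0) :=
    tendsto_const_nhds.div_atTop (Real.tendsto_sqrt_atTop.comp tendsto_natCast_atTop_atTop)
  have h3 := h1.sub h2
  rw [sub_zero] at h3
  refine h3.congr fun N => ?_
  rw [Function.comp_apply, trapDepth, div_div]
  ring

/-- Deep traps have energy of order `√N`, so `exp (-trapDepth)`, the resistance of the edges at a
trap, beats every power of `N`. -/
lemma le_trapDepth (R : Regime abar cbar a t) (β δ : ℝ) :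
    ∃ c > 0, ∀ᶠ N : ℕ in atTop, c * √(N : ℝ) - 1 ≤ trapDepth N β (a N) (t N) δ := by
  obtain ⟨c, hc, h⟩ := R.exp_le_dScale
  refine ⟨√(2 * c), by positivity, ?_⟩
  filter_upwards [h, (tendsto_order.1 (R.tendsto_sub_trapDepth β δ)).2 1 one_pos] with N h1 h2
  have h3 : c * N ≤ Real.log (dScale N (a N) (t N)) :=
    (Real.le_log_iff_exp_le ((Real.exp_pos _).trans_le h1)).2 h1
  have h4 : √(2 * c) * √(N : ℝ) ≤ √(2 * Real.log (dScale N (a N) (t N))) := by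
    rw [← Real.sqrt_mul (by positivity)]
    exact Real.sqrt_le_sqrt (by linarith)
  linarith

lemma tendsto_trapDepth (R : Regime abar cbar a t) (β δ : ℝ) :
    Tendsto (fun N : ℕ => trapDepth N β (a N) (t N) δ) atTop atTop := by
  obtain ⟨c, hc, h⟩ := R.le_trapDepth β δ
  refine tendsto_atTop_mono' _ h (tendsto_atTop_add_const_right _ _ ?_)
  exact (Real.tendsto_sqrt_atTop.comp tendsto_natCast_atTop_atTop).const_mul_atTop hc

lemma tendsto_exp_trapDepth (R : Regime abar cbar a t) (β δ : ℝ) :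
    Tendsto (fun N : ℕ => Real.exp (-trapDepth N β (a N) (t N) δ) * exitRate N (a N))
      atTop (𝓝 0) := by
  obtain ⟨c, hc, h⟩ := R.le_trapDepth β δ
  have h1 := ((tendsto_rpow_mul_exp_neg_mul_atTop_nhds_zero (6 : ℕ) c hc).comp
    (Real.tendsto_sqrt_atTop.comp tendsto_natCast_atTop_atTop)).const_mul (Real.exp 1)
  rw [mul_zero] at h1
  refine squeeze_zero' ?_ ?_ h1
  · filter_upwards [R.exitRate_pos] with N hN
    positivity
  · filter_upwards [h, R.exitRate_le, R.exitRate_pos] with N h2 h3 h5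
    simp only [Function.comp_apply]
    rw [Real.rpow_natCast]
    have h4 : √(N : ℝ) ^ 6 = N ^ 3 := by
      rw [show 6 = 2 * 3 from rfl, pow_mul, Real.sq_sqrt (Nat.cast_nonneg N)]
    rw [h4]
    calc _ ≤ Real.exp (1 + -c * √(N : ℝ)) * N ^ 3 := by
          gcongr
          linarith
      _ = _ := by rw [Real.exp_add]; ring

/-- The factor `δ` moves the level by `log δ / (β √N)`. This changes the tail by a bounded factor
only, because `dScale ≤ 2 ^ N` forces the extreme value scale to be at most `√2 √N`. -/
lemma posGaussian_bounds (R : Regime abar cbar a t)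
    (hβ : 0 < β) : ∃ c > 0, ∃ C > 0, ∀ᶠ N : ℕ in atTop,
    c ≤ posGaussian.real (Set.Ici (trapDepth N β (a N) (t N) δ)) * dScale N (a N) (t N) ∧
      posGaussian.real (Set.Ici (trapDepth N β (a N) (t N) δ)) * dScale N (a N) (t N) ≤ C := by
  refine ⟨Real.exp (-(√2 * |Real.log δ| / β + 3)) / 2, by positivity,
    2 * Real.exp (√2 * |Real.log δ| / β), by positivity, ?_⟩
  filter_upwards [R.tendsto_dScale_atTop.eventually_gt_atTop 1, R.dScale_le_two_pow,
    (R.tendsto_trapDepth β δ).eventually_ge_atTop 2,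
    (tendsto_order.1 (R.tendsto_sub_trapDepth β δ)).1 (-1) (by norm_num),
    (tendsto_order.1 (R.tendsto_sub_trapDepth β δ)).2 1 (by norm_num), eventually_ge_atTop 1]
    with N h1 h2 h3 h4 h5 h6
  refine posGaussian_mul_bounds h1 rfl h3 ?_ (abs_le.2 ⟨h4.le, h5.le⟩)
  have hs : 0 < √(N : ℝ) := Real.sqrt_pos.2 (by exact_mod_cast h6)
  have h7 : √(2 * Real.log (dScale N (a N) (t N))) ≤ √2 * √(N : ℝ) := by
    rw [← Real.sqrt_mul two_pos.le]
    refine Real.sqrt_le_sqrt (mul_le_mul_of_nonneg_left ?_ two_pos.le)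
    calc Real.log (dScale N (a N) (t N)) ≤ Real.log (2 ^ N) := Real.log_le_log (by linarith) h2
      _ = N * Real.log 2 := Real.log_pow _ _
      _ ≤ N * 1 := by
          gcongr
          linarith [Real.log_two_lt_d9]
      _ = N := mul_one _
  rw [abs_mul, abs_of_nonneg (Real.sqrt_nonneg _), abs_div,
    abs_of_pos (by positivity : 0 < β * √(N : ℝ))]
  calc _ ≤ √2 * √(N : ℝ) * (|Real.log δ| / (β * √(N : ℝ))) := by gcongr
    _ = _ := by field_simp

/-- The density of traps is at least of order `1 / (t M)`, and `t M` is negligible against `2 ^ N`.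
-/
lemma tendsto_number_traps (R : Regime abar cbar a t) (hβ : 0 < β) : Tendsto (fun N : ℕ =>
    4 / (2 ^ N * posGaussian.real (Set.Ici (trapDepth N β (a N) (t N) δ)))) atTop (𝓝 0) := by
  obtain ⟨c, hc, C, -, h⟩ := R.posGaussian_bounds (δ := δ) hβ
  have h1 := R.tendsto_t_mul.const_mul (8 / c)
  rw [mul_zero] at h1
  refine squeeze_zero' (Eventually.of_forall fun N => by positivity) ?_ h1
  filter_upwards [h, R.dScale_bounds, R.tendsto_dScale_atTop.eventually_gt_atTop 0] with N h2 h3 h4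
  set p := posGaussian.real (Set.Ici (trapDepth N β (a N) (t N) δ))
  have hp : 0 < p := by
    by_contra hcon
    nlinarith [h2.1]
  rw [div_mul_div_comm, div_le_div_iff₀ (by positivity) (by positivity)]
  have h5 : c ≤ p * (2 * (t N * exitRate N (a N))) :=
    h2.1.trans (mul_le_mul_of_nonneg_left h3.2 hp.le)
  have h6 : (0 : ℝ) < 4 * 2 ^ N := by positivity
  nlinarith [mul_le_mul_of_nonneg_left h5 h6.le]

lemma tendsto_near_traps (R : Regime abar cbar a t) (hβ : 0 < β) : Tendsto (fun N : ℕ =>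
    ((N : ℝ) + 1) ^ 6 * posGaussian.real (Set.Ici (trapDepth N β (a N) (t N) δ)))
      atTop (𝓝 0) := by
  obtain ⟨c, hc, C, hC, h⟩ := R.posGaussian_bounds (δ := δ) hβ
  obtain ⟨c', hc', h'⟩ := R.exp_le_dScale
  have h1 := (tendsto_natCast_pow_mul_exp 6 hc').const_mul (2 ^ 6 * C)
  rw [mul_zero] at h1
  refine squeeze_zero' (Eventually.of_forall fun N => by positivity) ?_ h1
  filter_upwards [h, h', eventually_ge_atTop 1] with N h2 h3 h4
  have h5 : (1 : ℝ) ≤ N := by exact_mod_cast h4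
  set p := posGaussian.real (Set.Ici (trapDepth N β (a N) (t N) δ))
  have hp : p ≤ C * Real.exp (-c' * N) := by
    have h6 : p * Real.exp (c' * N) ≤ C :=
      (mul_le_mul_of_nonneg_left h3 measureReal_nonneg).trans h2.2
    rw [neg_mul, Real.exp_neg, ← div_eq_mul_inv, le_div_iff₀ (Real.exp_pos _)]
    exact h6
  calc ((N : ℝ) + 1) ^ 6 * p ≤ (2 * N) ^ 6 * (C * Real.exp (-c' * N)) := by
        gcongr
        linarith
    _ = _ := by ring

end Regime

/-! ### The first deep trap -/

/-- This is where `1 ≤ a` matters: every edge at a site of energy `h` conducts at least `exp h`. -/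
lemma one_le_exp_mul_cond {a h : ℝ} (ha : 1 ≤ a) (hh : 0 ≤ h) {E : V N → ℝ} (hE : ∀ x, 0 ≤ E x)
    {x : V N} (hx : h ≤ E x) (i : Fin N) : 1 ≤ Real.exp (-h) * cond a E x i := by
  rw [cond, rate, ← Real.exp_add]
  refine Real.one_le_exp ?_
  have := hE (x + unit i)
  nlinarith

/-- Above, the flow starts at the trap itself, with `ε = exp (-h)`. Below, the indicator of the ball
is tested; the killing rate `1 / N²` adds the negligible `(N + 1) / N²`. -/
lemma abs_green_sub_one_le (hN : 3 ≤ N) {a h η η' : ℝ} (ha : 1 ≤ a) (hh : 0 ≤ h)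
    {E : V N → ℝ} (hE : ∀ x, 0 ≤ E x) {x : V N} (hx : h ≤ E x) (hG : Good a η' E x)
    (hη0 : 0 ≤ η') (hη1 : η' < 1)
    (h1 : exitRate N a * (goodFlow N a η' (Real.exp (-h)) ^ 2 + N ^ 2 / 2 ^ N) ≤ 1 + η)
    (h2 : η' + (N + 1) / N ^ 2 ≤ η) :
    |N ^ 2 * phi a ^ 2 * green a (shift x E) - 1| ≤ η := by
  have hM : 0 < exitRate N a := exitRate_pos (by omega) (by linarith)
  have hM2 := sq_le_exitRate N (a := a) (by linarith)
  have hN1 : (1 : ℝ) ≤ N := by exact_mod_cast (by omega : 1 ≤ N)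
  obtain ⟨g1, g2⟩ := green_shift_bounds hN (by linarith) hE x
    (mul_pos (by linarith) hM : 0 < (1 - η') * exitRate N a) hG.le_outflow hG.2
    (Real.exp_pos _).le (one_le_exp_mul_cond ha hh hE hx)
  change |exitRate N a * green a (shift x E) - 1| ≤ η
  have hS := hG.outflow_le
  have hS0 := outflow_nonneg a E x
  rw [abs_le]
  constructor
  · set u := η' + ((N : ℝ) + 1) / N ^ 2 with hu
    have hu0 : 0 ≤ u := by positivity
    have h3 : 1 / (exitRate N a * (1 + u)) ≤ green a (shift x E) := by
      refine le_trans (one_div_le_one_div_of_le (by positivity) ?_) g1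
      have h4 : (1 : ℝ) / N ^ 2 * (N + 1) ≤ exitRate N a * ((N + 1) / N ^ 2) := by
        rw [one_div_mul_eq_div]
        refine le_mul_of_one_le_left (by positivity) ?_
        nlinarith
      rw [hu]
      linarith
    have h5 := mul_le_mul_of_nonneg_left h3 hM.le
    have h6 : exitRate N a * (1 / (exitRate N a * (1 + u))) = 1 / (1 + u) := by field_simp
    have h7 : 1 - u ≤ 1 / (1 + u) := by
      rw [le_div_iff₀ (by positivity)]
      nlinarith
    linarith
  · have := mul_le_mul_of_nonneg_left g2 hM.le
    unfold goodFlow at h1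
    linarith

/-- Untypical environments may have a large `outflow`, but typical ones already account for `(1 - η)
M (1 - b)` of a total of at most `M`. Only `M (η + b)` is left, with no further moment estimate. -/
lemma setIntegral_not_good_le {a η b : ℝ} (ha : 0 ≤ a) (hη0 : 0 ≤ η) (hη1 : η < 1) (x : V N)
    (hb : (energyLaw N).real {E | ¬ Good a η E x} ≤ b) {s : ℝ} (hs : 0 ≤ s) :
    ∫ E in {E | ¬ Good a η E x}, (N + 1 + s * outflow (cond a E) x) / 2 ^ N ∂energyLaw N
      ≤ ((N + 1) * b + s * exitRate N a * (η + b)) / 2 ^ N := by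
  have hG := measurableSet_good (N := N) a η x
  obtain ⟨i1, -⟩ := integral_outflow a x
  have hM0 : 0 ≤ exitRate N a := (sq_nonneg _).trans (sq_le_exitRate N ha)
  have hc : {E : V N → ℝ | ¬ Good a η E x} = {E | Good a η E x}ᶜ := rfl
  have hpG : (energyLaw N).real {E | Good a η E x}
      = 1 - (energyLaw N).real {E | ¬ Good a η E x} := by
    rw [hc, probReal_compl_eq_one_sub hG]
    ring
  have h1 : (1 - η) * exitRate N a * (energyLaw N).real {E | Good a η E x}
      ≤ ∫ E in {E | Good a η E x}, outflow (cond a E) x ∂energyLaw N :=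
    setIntegral_ge_of_const_le_real hG (measure_ne_top _ _)
      (fun E (hE : Good a η E x) => hE.le_outflow) i1.integrableOn
  have h2 := integral_add_compl hG i1
  have h3 := integral_outflow_le a x
  rw [integral_div, integral_add (integrable_const _).integrableOn (i1.const_mul s).integrableOn,
    setIntegral_const, integral_const_mul, smul_eq_mul]
  refine div_le_div_of_nonneg_right (add_le_add ?_ ?_) (by positivity)
  · rw [mul_comm]
    gcongr
  · rw [mul_assoc]
    refine mul_le_mul_of_nonneg_left ?_ hs
    rw [hc]
    rw [hpG] at h1
    have h4 : 0 ≤ η * exitRate N a := mul_nonneg hη0 hM0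
    have h5 : (1 - η) * exitRate N a * (1 - b)
        ≤ (1 - η) * exitRate N a * (1 - (energyLaw N).real {E | ¬ Good a η E x}) :=
      mul_le_mul_of_nonneg_left (by linarith) (mul_nonneg (by linarith) hM0)
    have h6 : 0 ≤ η * exitRate N a * b := mul_nonneg h4 (measureReal_nonneg.trans hb)
    linarith

/-- Few deep traps with an untypical environment are discovered. -/
lemma annealed_discover_bad_le (hN : 1 ≤ N) {a h η b s : ℝ} (ha : 0 ≤ a) (hη0 : 0 ≤ η)
    (hη1 : η < 1) (hb : ∀ x : V N, (energyLaw N).real {E | ¬ Good a η E x} ≤ b) (hs : 0 < s) :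
    annealed N {ω | ∃ x, (h ≤ ω.1 x ∧ ¬ Good a η ω.1 x) ∧
      ∃ n, (jumps a ω.1 ω.2.1 ω.2.2 n).2 ≤ s ∧ (jumps a ω.1 ω.2.1 ω.2.2 n).1 ∈ ball x}
      ≤ ENNReal.ofReal (posGaussian.real (Set.Ici h) *
        ((N + 1) * b + s * exitRate N a * (η + b))) := by
  classical
  set S : V N → Set (V N → ℝ) := fun x => {E | h ≤ E x} ∩ {E | ¬ Good a η E x} with hS
  have hSm : ∀ x, MeasurableSet (S x) := fun x =>
    (measurableSet_le_eval h x).inter (measurableSet_good a η x).compl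
  -- Emptying the target when `x` is not a bad trap encodes the condition on the environment in the
  -- hitting event.
  set A : V N → (V N → ℝ) → Finset (V N) := fun x E => if E ∈ S x then ball x else ∅ with hA
  have hAm : ∀ x y, MeasurableSet {E | y ∈ A x E} := fun x y => by
    have : {E | y ∈ A x E} = S x ∩ {_E | y ∈ ball x} := by
      ext E
      by_cases hE : E ∈ S x <;> simp [hA, hE]
    rw [this]
    exact (hSm x).inter (MeasurableSet.const _)
  set D : V N → Set (Sample N) := fun x => {ω | ∃ n, (jumps a ω.1 ω.2.1 ω.2.2 n).2 ≤ s ∧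
      (jumps a ω.1 ω.2.1 ω.2.2 n).1 ∈ A x ω.1} with hD
  have hB0 : 0 ≤ ((N + 1) * b + s * exitRate N a * (η + b)) / 2 ^ N := by
    have hM0 : 0 ≤ exitRate N a := (sq_nonneg _).trans (sq_le_exitRate N ha)
    have hb0 : 0 ≤ b := measureReal_nonneg.trans (hb 0)
    positivity
  have hDx : ∀ x, annealed N (D x) ≤ ENNReal.ofReal (posGaussian.real (Set.Ici h) *
        (((N + 1) * b + s * exitRate N a * (η + b)) / 2 ^ N)) := fun x => by
    rw [hD, annealed_hit a (A x) (hAm x) s]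
    set g : (V N → ℝ) → ℝ≥0∞ := {E | ¬ Good a η E x}.indicator
      fun E => ENNReal.ofReal ((N + 1 + s * outflow (cond a E) x) / 2 ^ N) with hg
    have hGm : MeasurableSet {E : V N → ℝ | ¬ Good a η E x} := (measurableSet_good a η x).compl
    have hgm : Measurable g :=
      Measurable.indicator
        (((measurable_outflow a x).const_mul s).const_add _ |>.div_const _).ennreal_ofReal hGm
    -- The hitting probability depends on `E x` but its upper bound does not, so the probability of
    -- being deep factors out.
    have hgx : ∀ E t, g (Function.update E x t) = g E := fun E t => by
      by_cases hE : E ∈ {E | ¬ Good a η E x}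
      · rw [hg, Set.indicator_of_mem hE, Set.indicator_of_mem (mt (good_update a η E x t).1 hE),
          (outflow_update a E x t).1]
      · have hE' : Good a η E x := not_not.1 hE
        rw [hg, Set.indicator_of_notMem hE, Set.indicator_of_notMem]
        exact not_not.2 ((good_update a η E x t).2 hE')
    have hle : ∀ E : V N → ℝ, ENNReal.ofReal (hitP a E (A x E) s)
        ≤ {E : V N → ℝ | E x ∈ Set.Ici h}.indicator g E := fun E => by
      by_cases hE : E ∈ S x
      · rw [Set.indicator_of_mem (show E ∈ {E : V N → ℝ | E x ∈ Set.Ici h} from hE.1), hg,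
          Set.indicator_of_mem hE.2, hA]
        simp only [if_pos hE]
        exact ENNReal.ofReal_le_ofReal (hitP_ball_le hN a E x hs)
      · have : hitP a E (A x E) s = 0 := by simp [hA, if_neg hE, hitP]
        rw [this, ENNReal.ofReal_zero]
        exact zero_le
    refine (lintegral_mono hle).trans ?_
    rw [lintegral_indicator_mul x measurableSet_Ici g hgm hgx, hg, lintegral_indicator hGm,
      ← ofReal_integral_eq_lintegral_ofReal, ENNReal.ofReal_mul measureReal_nonneg,
      ofReal_measureReal]
    · gcongr
      exact setIntegral_not_good_le ha hη0 hη1 x (hb x) hs.le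
    · exact (((integrable_const _).add
        ((integral_outflow a x).1.const_mul s)).div_const _).integrableOn
    · exact Eventually.of_forall fun E => by
        have := outflow_nonneg a E x
        positivity
  calc _ ≤ annealed N (⋃ x, D x) := by
        refine measure_mono ?_
        rintro ω ⟨x, hx, n, hn1, hn2⟩
        refine Set.mem_iUnion.2 ⟨x, n, hn1, ?_⟩
        have : ω.1 ∈ S x := hx
        simpa only [hA, if_pos this] using hn2
    _ ≤ ∑ x, annealed N (D x) := measure_iUnion_fintype_le _ _
    _ ≤ ∑ _x : V N, _ := Finset.sum_le_sum fun x _ => hDx x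
    _ = _ := by
        rw [Finset.sum_const, Finset.card_univ, card_V, ← ENNReal.ofReal_nsmul, nsmul_eq_mul]
        congr 1
        push_cast
        field_simp

/-- A good trap is visited before time `s`. -/
lemma annealed_no_good_trap_le (hN : 3 ≤ N) {a h η b p s : ℝ} (ha : 1 ≤ a) (hh : 0 ≤ h)
    (hη1 : η < 1) (hp : p = posGaussian.real (Set.Ici h)) (hp0 : 0 < p)
    (hb : ∀ x : V N, (energyLaw N).real {E | ¬ Good a η E x} ≤ b) (hs : 0 < s) :
    annealed N {ω | ¬ ∃ n, (jumps a ω.1 ω.2.1 ω.2.2 n).2 ≤ s ∧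
      (jumps a ω.1 ω.2.1 ω.2.2 n).1 ∈ goodTraps a η h ω.1}
      ≤ ENNReal.ofReal (4 * goodFlow N a η (Real.exp (-h)) ^ 2 / (s * p) +
        (4 / (2 ^ N * p) + 4 * (b + (N + 1) ^ 6 * p))) := by
  set H : Set (Sample N) := {ω | ∃ n, (jumps a ω.1 ω.2.1 ω.2.2 n).2 ≤ s ∧
      (jumps a ω.1 ω.2.1 ω.2.2 n).1 ∈ goodTraps a η h ω.1} with hH
  have hTm := measurableSet_mem_goodTraps (N := N) a η h
  have hHm : MeasurableSet H := measurableSet_hit a (goodTraps a η h) hTm s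
  set F := goodFlow N a η (Real.exp (-h)) with hF
  set w := 4 * F ^ 2 / (s * p) with hw
  have hw0 : 0 ≤ w := by positivity
  set G : Set (V N → ℝ) := {E | ((goodTraps a η h E).card : ℝ) < 2 ^ N * p / 4} with hG
  have hGm : MeasurableSet G := by
    classical
    have : ∀ E : V N → ℝ, ((goodTraps a η h E).card : ℝ)
        = ∑ x, {E | x ∈ goodTraps a η h E}.indicator (1 : (V N → ℝ) → ℝ) E := fun E => by
      have h1 : ∀ x, {E | x ∈ goodTraps a η h E}.indicator (1 : (V N → ℝ) → ℝ) E
          = if x ∈ goodTraps a η h E then 1 else 0 := fun x => by rw [Set.indicator_apply]; rfl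
      simp only [h1, Finset.sum_ite_mem, Finset.univ_inter, Finset.sum_const, nsmul_eq_mul, mul_one]
    rw [hG]
    simp only [this]
    exact measurableSet_lt (Finset.measurable_fun_sum _ fun x _ => measurable_one.indicator (hTm x))
      measurable_const
  have hGb := measure_card_goodTraps_lt (N := N) hp hp0 hb
  have hM : 0 < exitRate N a := exitRate_pos (by omega) (by linarith)
  have hhit : ENNReal.ofReal (1 / (1 + w)) * energyLaw N Gᶜ ≤ annealed N H := by
    rw [hH, annealed_hit a (goodTraps a η h) hTm s, ← lintegral_indicator_const hGm.compl]
    refine lintegral_mono_ae ?_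
    filter_upwards [ae_energy_nonneg] with E hE
    by_cases hEG : E ∈ Gᶜ
    · rw [Set.indicator_of_mem hEG]
      refine ENNReal.ofReal_le_ofReal ?_
      have hcard : 2 ^ N * p / 4 ≤ ((goodTraps a η h E).card : ℝ) := not_lt.1 hEG
      have hcard0 : 0 < 2 ^ N * p / 4 := by positivity
      have hne : (goodTraps a η h E).Nonempty := by
        rw [← Finset.card_pos]
        exact_mod_cast hcard0.trans_le hcard
      refine le_trans ?_ (le_hitP hN (by linarith) hE (Finset.Subset.refl _)
        (separated_goodTraps a η h E) hne (mul_pos (by linarith) hM : 0 < (1 - η) * exitRate N a)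
        (fun x hx => (mem_goodTraps.1 hx).2.1.le_outflow) (fun x hx => (mem_goodTraps.1 hx).2.1.2)
        (Real.exp_pos (-h)).le (fun x hx i => Or.inr
          (one_le_exp_mul_cond ha hh hE (mem_goodTraps.1 hx).1 i)) hs)
      refine one_div_le_one_div_of_le (by positivity) ?_
      gcongr
      calc _ ≤ 2 ^ N * F ^ 2 / (s * (2 ^ N * p / 4)) := by
            rw [hF, goodFlow]
            gcongr
        _ = _ := by
            rw [hw]
            field_simp
    · rw [Set.indicator_of_notMem hEG]
      exact zero_le
  have hreal : 1 / (1 + w) * (1 - (energyLaw N).real G) ≤ (annealed N).real H := by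
    have := ENNReal.toReal_mono (measure_ne_top _ _) hhit
    rw [ENNReal.toReal_mul, ENNReal.toReal_ofReal (by positivity)] at this
    rwa [← probReal_compl_eq_one_sub hGm]
  have hc : {ω : Sample N | ¬ ∃ n, (jumps a ω.1 ω.2.1 ω.2.2 n).2 ≤ s ∧
      (jumps a ω.1 ω.2.1 ω.2.2 n).1 ∈ goodTraps a η h ω.1} = Hᶜ := rfl
  rw [hc, ← ofReal_measureReal (μ := annealed N), probReal_compl_eq_one_sub hHm]
  refine ENNReal.ofReal_le_ofReal ?_
  have h1 : 1 - w ≤ 1 / (1 + w) := by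
    rw [le_div_iff₀ (by positivity)]
    nlinarith
  have h2 : 1 / (1 + w) ≤ 1 := by
    rw [div_le_one (by positivity)]
    linarith
  have h3 : 0 ≤ (energyLaw N).real G := measureReal_nonneg
  nlinarith

/-- The Green function at the first deep trap. -/
lemma annealed_firstDeepTrap_le (hN : 3 ≤ N) {β a t δ η η' b s p : ℝ} (o : Order N) (hβ : 0 < β)
    (hδ : 0 < δ) (ha : 1 ≤ a) (hh : 0 ≤ trapDepth N β a t δ) (hη0 : 0 ≤ η') (hη1 : η' < 1)
    (hp : p = posGaussian.real (Set.Ici (trapDepth N β a t δ))) (hp0 : 0 < p)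
    (hb : ∀ x : V N, (energyLaw N).real {E | ¬ Good a η' E x} ≤ b) (hs : 0 < s)
    (h1 : exitRate N a * (goodFlow N a η' (Real.exp (-trapDepth N β a t δ)) ^ 2 + N ^ 2 / 2 ^ N)
      ≤ 1 + η) (h2 : η' + (N + 1) / N ^ 2 ≤ η) :
    annealed N {ω | ¬ ∃ x ∈ firstDeepTrap β a (δ * BScale N β a t) o ω,
      |(N : ℝ) ^ 2 * phi a ^ 2 * green a (shift x ω.1) - 1| ≤ η}
      ≤ ENNReal.ofReal (4 * goodFlow N a η' (Real.exp (-trapDepth N β a t δ)) ^ 2 / (s * p) +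
        (4 / (2 ^ N * p) + 4 * (b + (N + 1) ^ 6 * p))) +
        ENNReal.ofReal (p * ((N + 1) * b + s * exitRate N a * (η' + b))) := by
  have hM1 : 1 ≤ N := by omega
  set h := trapDepth N β a t δ with hh_def
  -- The event need not be measurable; an almost sure inclusion is enough for the outer measure.
  refine le_trans (le_trans (measure_mono_ae ?_) (measure_union_le _ _)) (add_le_add
    (annealed_no_good_trap_le hN ha hh hη1 hp hp0 hb hs)
    (hp ▸ annealed_discover_bad_le hM1 (h := h) (by linarith) hη0 hη1 hb hs))
  filter_upwards [ae_annealed_nonneg, ae_annealed_regular hM1 a] with ω hE hreg hω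
  by_cases hH : ∃ n, (jumps a ω.1 ω.2.1 ω.2.2 n).2 ≤ s ∧
      (jumps a ω.1 ω.2.1 ω.2.2 n).1 ∈ goodTraps a η' h ω.1
  · right
    by_contra hD
    refine hω ?_
    obtain ⟨n, hn, hx⟩ := hH
    -- The good trap visited at jump `n` lies in the block of that jump. The first deep trap is thus
    -- discovered no later, within time `s`, and outside the second bad event it must be `Good`.
    obtain ⟨y, hy, hyθ, k, hkn, hyk⟩ := exists_firstDeepTrap β a (δ * BScale N β a t) o ω
      ((le_tau_iff hM1 hβ hδ a t ω.1 _).2 (mem_goodTraps.1 hx).1)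
      (mem_ball_iff.2 (by rw [hammingDist_self]; exact zero_le_one))
    have hyh := (le_tau_iff hM1 hβ hδ a t ω.1 y).1 hyθ
    have hyG : Good a η' ω.1 y := by
      by_contra hyG
      refine hD ⟨y, ⟨hyh, hyG⟩, k, (hreg.1.monotone hkn).trans hn, ?_⟩
      rwa [mem_ball_iff, hammingDist_comm, ← mem_ball_iff]
    exact ⟨y, hy, abs_green_sub_one_le hN ha hh hE hyh hyG hη0 hη1 h1 h2⟩
  · exact Or.inl hH

/-- The arithmetic of the error terms. -/
lemma error_le {c C ρ K η p M F b d t n : ℝ} (hc : 0 < c) (hC : 0 < C) (hρ : 0 < ρ) (ht : 0 < t)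
    (hM : 0 < M) (hp : 0 < p) (hn : 0 ≤ n) (hη : 0 ≤ η) (hb : 0 ≤ b) (hF : M * F ^ 2 ≤ 3)
    (hnp : (n + 1) ^ 6 * p ≤ ρ / 8) (hb1 : b ≤ 1) (hη' : η ≤ ρ / (16 * K * C))
    (hb' : b ≤ ρ / (16 * K * C)) (hd : t * M ≤ 2 * d ∧ d ≤ 2 * (t * M))
    (hpd : c ≤ p * d ∧ p * d ≤ C) (hK : K = 100 / (c * ρ)) :
    4 * F ^ 2 / (K * t * p) ≤ ρ / 4 ∧
      p * ((n + 1) * b + K * t * M * (η + b)) ≤ 3 * ρ / 8 := by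
  have hK0 : 0 < K := by rw [hK]; positivity
  have hx : c / 2 ≤ t * M * p := by linarith [mul_le_mul_of_nonneg_left hd.2 hp.le, hpd.1]
  have hy : t * M * p ≤ 2 * C := by linarith [mul_le_mul_of_nonneg_left hd.1 hp.le, hpd.2]
  constructor
  · have h1 : 4 * F ^ 2 / (K * t * p) = 4 * (M * F ^ 2) / (K * (t * M * p)) := by field_simp
    rw [h1, div_le_iff₀ (by positivity)]
    have h2 : ρ / 4 * (K * (c / 2)) ≤ ρ / 4 * (K * (t * M * p)) := by gcongr
    have h3 : ρ / 4 * (K * (c / 2)) = 100 / 8 := by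
      rw [hK]
      field_simp
      norm_num
    linarith
  · have h1 : p * ((n + 1) * b) ≤ ρ / 8 := by
      have : n + 1 ≤ (n + 1) ^ 6 := le_self_pow₀ (by linarith) (by norm_num)
      calc p * ((n + 1) * b) ≤ p * ((n + 1) ^ 6 * 1) := by gcongr
        _ ≤ _ := by linarith
    have h2 : η + b ≤ 2 * (ρ / (16 * K * C)) := by linarith
    have h3 : K * (t * M * p) * (η + b) ≤ K * (2 * C) * (2 * (ρ / (16 * K * C))) := by gcongr
    have h4 : K * (2 * C) * (2 * (ρ / (16 * K * C))) = ρ / 4 := by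
      field_simp
      norm_num
    calc _ = p * ((n + 1) * b) + K * (t * M * p) * (η + b) := by ring
      _ ≤ _ := by linarith

namespace Regime

variable {abar cbar : ℝ} {a t : ℕ → ℝ}

lemma tendsto_exitRate_mul_sq_div (R : Regime abar cbar a t) :
    Tendsto (fun N : ℕ => exitRate N (a N) * ((N : ℝ) ^ 2 / 2 ^ N)) atTop (𝓝 0) := by
  refine squeeze_zero' (R.exitRate_pos.mono fun N hN => by positivity) ?_
    (tendsto_natCast_pow_mul_exp 5 (Real.log_pos one_lt_two))
  filter_upwards [R.exitRate_le] with N h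
  have h3 : Real.exp (-Real.log 2 * N) = 1 / 2 ^ N := by
    rw [Real.exp_mul, Real.exp_neg, Real.exp_log two_pos, Real.rpow_natCast, inv_pow, one_div]
  rw [h3]
  calc _ ≤ (N : ℝ) ^ 3 * (N ^ 2 / 2 ^ N) := by gcongr
    _ = _ := by ring

/-- The Green function at the first deep trap is asymptotically the inverse of the exit rate. -/
theorem tendsto_annealed (R : Regime abar cbar a t)
    {β δ η : ℝ} (hβ : 0 < β) (hδ : 0 < δ) (hη : 0 < η) (o : ∀ N, Order N) :
    Tendsto (fun N : ℕ => annealed N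
      {ω | ¬ ∃ x ∈ firstDeepTrap β (a N) (δ * BScale N β (a N) (t N)) (o N) ω,
        |(N : ℝ) ^ 2 * phi (a N) ^ 2 * green (a N) (shift x ω.1) - 1| ≤ η}) atTop (𝓝 0) := by
  rw [ENNReal.tendsto_nhds_zero]
  intro ε hε
  obtain ⟨ρ, hρ0, hρε⟩ := ENNReal.lt_iff_exists_nnreal_btwn.1 hε
  have hρ : (0 : ℝ) < ρ := by exact_mod_cast hρ0
  obtain ⟨c, hc, C, hC, hpd⟩ := R.posGaussian_bounds (δ := δ) hβ
  -- The horizon `K t` must be long enough to visit a good trap; `K` is fixed before `η'`, which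
  -- then makes the bad discoveries rare up to that time.
  set K : ℝ := 100 / (c * ρ) with hK
  have hK0 : 0 < K := by positivity
  -- The three terms serve `1 / (1 - η') ≤ 1 + 2 η'`, the tolerance `η` on the Green function, and
  -- the expected number of bad discoveries.
  set η' : ℝ := min (1 / 2) (min (η / 4) (ρ / (16 * K * C))) with hη'
  have hη0 : 0 < η' := lt_min (by norm_num) (lt_min (by positivity) (by positivity))
  have e1 : η' ≤ 1 / 2 := min_le_left _ _
  have e2 : η' ≤ η / 4 := (min_le_right _ _).trans (min_le_left _ _)
  have e3 : η' ≤ ρ / (16 * K * C) := (min_le_right _ _).trans (min_le_right _ _)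
  have hη1 : η' < 1 := by linarith
  have e4 : 1 / (1 - η') ≤ 1 + 2 * η' := by
    rw [div_le_iff₀ (by linarith)]
    nlinarith
  have hF := R.tendsto_goodFlow hη1 (R.tendsto_exp_trapDepth β δ)
  have hF2 := hF.add R.tendsto_exitRate_mul_sq_div
  rw [add_zero] at hF2
  have hbad := R.tendsto_bad η'
  have hfar : Tendsto (fun N : ℕ => ((N : ℝ) + 1) / N ^ 2) atTop (𝓝 0) := by
    have h1 : Tendsto (fun N : ℕ => (1 / (N : ℝ) + 1 / (N : ℝ) * (1 / (N : ℝ)))) atTop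
        (𝓝 (0 + 0 * 0)) := tendsto_one_div_atTop_nhds_zero_nat.add
      (tendsto_one_div_atTop_nhds_zero_nat.mul tendsto_one_div_atTop_nhds_zero_nat)
    rw [mul_zero, add_zero] at h1
    refine h1.congr' ?_
    filter_upwards [eventually_ge_atTop 1] with N hN
    have : (N : ℝ) ≠ 0 := by positivity
    field_simp
  have hnear := R.tendsto_near_traps (δ := δ) hβ
  have htraps := (R.tendsto_number_traps (δ := δ) hβ).add
    ((hbad.add hnear).const_mul 4)
  rw [add_zero, mul_zero, add_zero] at htraps
  filter_upwards [hpd, (tendsto_order.1 hF).2 3 (by linarith),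
    (tendsto_order.1 hF2).2 (1 + η) (by linarith),
    (tendsto_order.1 hfar).2 (η / 2) (by positivity),
    (tendsto_order.1 htraps).2 (ρ / 4) (by positivity),
    (tendsto_order.1 hnear).2 (ρ / 8) (by positivity),
    (tendsto_order.1 hbad).2 (min 1 (ρ / (16 * K * C))) (lt_min one_pos (by positivity)),
    R.measure_not_good_le hη0, R.dScale_bounds, R.tendsto_dScale_atTop.eventually_gt_atTop 0,
    R.one_le, eventually_ge_atTop 3, (R.tendsto_trapDepth β δ).eventually_ge_atTop 0,
    R.exitRate_pos] with N g1 g2 g3 g4 g5 g6 g7 g8 g9 g10 g11 g12 g13 g14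
  have ht := R.t_pos N
  set p := posGaussian.real (Set.Ici (trapDepth N β (a N) (t N) δ)) with hp
  set M := exitRate N (a N) with hM
  set F := goodFlow N (a N) η' (Real.exp (-trapDepth N β (a N) (t N) δ)) with hFdef
  set b := 8 * phi (2 * a N) ^ 2 / (η' ^ 2 * N) + 1 / √(N : ℝ) with hb
  set d := dScale N (a N) (t N) with hd
  have hb0 : 0 ≤ b := by positivity
  have hp0 : 0 < p := by
    by_contra hcon
    nlinarith [g1.1]
  have hs : 0 < K * t N := by positivity
  refine (annealed_firstDeepTrap_le g12 (o N) hβ hδ g11 g13 hη0.le hη1 hp hp0 g8 hs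
    (by rw [mul_add]; exact g3.le) (by linarith)).trans ?_
  obtain ⟨k1, k2⟩ := error_le hc hC hρ ht g14 hp0 (Nat.cast_nonneg N) hη0.le hb0 g2.le g6.le
    (g7.trans_le (min_le_left _ _)).le e3 (g7.trans_le (min_le_right _ _)).le g9 g1 hK
  calc _ ≤ ENNReal.ofReal (ρ / 4 + ρ / 4) + ENNReal.ofReal (3 * ρ / 8) := by
        gcongr
    _ = ENNReal.ofReal (ρ / 4 + ρ / 4 + 3 * ρ / 8) :=
        (ENNReal.ofReal_add (by positivity) (by positivity)).symm
    _ ≤ ENNReal.ofReal ρ := ENNReal.ofReal_le_ofReal (by linarith)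
    _ = ρ := ENNReal.ofReal_coe_nnreal
    _ ≤ ε := hρε.le

theorem isEquivalent_dScale (R : Regime abar cbar a t) : Asymptotics.IsEquivalent atTop
    (fun N : ℕ => dScale N (a N) (t N) / t N) (fun N : ℕ => (N : ℝ) ^ 2 * phi (a N) ^ 2) := by
  rw [Asymptotics.isEquivalent_iff_tendsto_one]
  · refine R.tendsto_dScale.congr fun N => ?_
    rw [Pi.div_apply, div_div, exitRate]
  · filter_upwards [R.exitRate_pos] with N hN
    exact hN.ne'

end Regime

end REM

end

theorem theoremt
    (β : ℝ) (hβ : 0 < β)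
    (abar : ℝ) (habar : abar < 1 / 20)
    (a : ℕ → ℝ) (ha : ∀ᶠ N : ℕ in atTop, 1 ≤ a N ∧ a N ≤ abar * √(2 * Real.log (N : ℝ)))
    (cbar : ℝ) (hcbar : cbar ∈ Set.Ioo 0 (Real.log 2))
    (t : ℕ → ℝ) (ht : ∀ N, 0 < t N)
    (hlogt : Asymptotics.IsEquivalent atTop (fun N => Real.log (t N)) (fun N => cbar * (N : ℝ)))
    (o : ∀ N, REM.Order N) :
    (∀ δ : ℝ, 0 < δ → ∀ η : ℝ, 0 < η →
      Tendsto (fun N : ℕ => REM.annealed N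
        {ω | ¬ ∃ x ∈ REM.firstDeepTrap β (a N) (δ * REM.BScale N β (a N) (t N)) (o N) ω,
          |(N : ℝ) ^ 2 * REM.phi (a N) ^ 2 * REM.green (a N) (REM.shift x ω.1) - 1| ≤ η})
        atTop (𝓝 0)) ∧
    Asymptotics.IsEquivalent atTop
      (fun N : ℕ => REM.dScale N (a N) (t N) / t N)
      (fun N : ℕ => (N : ℝ) ^ 2 * REM.phi (a N) ^ 2) :=
  have R : REM.Regime abar cbar a t := ⟨habar, ha, hcbar, ht, hlogt⟩
  ⟨fun _ hδ _ hη => R.tendsto_annealed hβ hδ hη o, R.isEquivalent_dScale⟩
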